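/- Let $m\ge 2$ and let $M$ be a threefold, possibly with boundary, glued from finitely many copies of the tetrahedron $T=\{x\in\mathbb R^4: x_0+x_1+x_2+x_3=m,\ x_i\ge 0\}$ by identifying some pairs of distinct faces by affine isomorphisms (an ideal triangulation $\tau$). The vertices (the special points, or punctures) are removed, some further open faces may be removed too, and no edge in $M$ is glued to itself with reversed orientation. Faces of the same tetrahedron may be glued. *The diagram.* In every tetrahedron take the planes $x_i=k+\frac12$, $0\le i\le 3$, $0\le k\le m-1$, cooriented towards the face $x_i=0$. Concatenated, they form the cooriented surfaces of the ${\cal Q}$-diagram ${\cal Q}_{\tau,m}$ in $M$. Its quadruple points are the points of the tetrahedra all of whose coordinates are half-integers. A component $C$ of $M-{\cal Q}_{\tau,m}$ is *colored* if it has a quadruple point in its closure and at each such point $q$ the faces of $C$ meeting at $q$ are either all cooriented into $C$ or all cooriented out of $C$; otherwise it is *mixed*. For a smooth structure on $M$ (with or without boundary or corners) in which the surfaces of ${\cal Q}_{\tau,m}$ are smooth with pairwise disjoint Legendrians (each surface piece has a local defining function with non-zero differential, and different pieces through a point have different positive conormal rays), ${\Bbb L}^\circ_{\tau,m}\subset T^*M$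 is the union of the zero section and of the positive conormal rays (without zero) to the surfaces, minus the zero section over the mixed components. *The spectral space.* The planes $x_i\in\mathbb Z$ cut each tetrahedron into hypersimplices $\{x : a_i\le x_i\le a_i+1,\ \sum x_i=m\}$, $a\in\mathbb Z_{\ge0}^4$, $\sum a_i=m-s$: $\circ$-tetrahedra ($s=1$), octahedra ($s=2$) and $\bullet$-tetrahedra ($s=3$). A triangular facet on which the three varying coordinates, reduced by their minima, have sum $2$ is a $\bullet$-triangle. The singular hypersurface of a segment is its midpoint, and that of a face or hypersimplex of dimension $\geq 2$ is the cone, with vertex at its center, over the singular hypersurfaces of its facets; the singular surface ${\Bbb S}_{\tau,m}\subset M$ is the union of those of the three-dimensional hypersimplices. It cuts each hypersimplex into closed pieces, one around each of its vertices. For a corner $i$ of a tetrahedron and $0\le k<m$, let ${\Bbb D}_{i,k}$ be the union of the pieces around the lattice points $v$ with $v_i>k+\frac12$ (the part, on the side of the corner, cut out by the zig-zag surface parallel to $x_i=k+\frac12$). The spectral space $\Sigma_{\tau,m}$ is obtained from the disjoint union of copies of all ${\Bbb D}_{i,k}$ by gluing, for every $k$, the copies at corresponding corners across the glued faces of the tetrahedra,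 and gluing copies of ${\Bbb D}_{i,k}$ and ${\Bbb D}_{j,l}$, $i\ne j$, in a tetrahedron along the rectangles shared by the two zig-zag surfaces (the intersections of the pieces around $v$ and $v+e_i-e_j$ in a hypersimplex, where $v_i=k$, $v_j=l+1$). The spectral map $\pi:\Sigma_{\tau,m}\to M$ is the tautological projection. The singular $\bullet$-vertices are the centers of the $\bullet$-tetrahedra; the singular $\bullet$-edges are the segments connecting the centers of the octahedra and $\bullet$-tetrahedra with the centers of their $\bullet$-triangles. Let $B\subset M$ be the union of all of these. **Statement.** 1. For every smooth structure on $M$ as above, $\Sigma_{\tau,m}$ is homeomorphic to ${\Bbb L}^\circ_{\tau,m}$. 2. The map $\pi$ is proper (in particular continuous), $M-B$ is dense in $M$, and $\pi$ is a covering map with exactly $m$ sheets over $M-B$. 3. Over each $\bullet$-vertex there is one ramification point, of degree $d=3$, and over each other point of a $\bullet$-edge there is one ramification point, of degree $d=2$. That is, near this point $\pi$ is $d:1$ over the points outside of $B$. At the other points of the fiber, $m-d$ in number, $\pi$ is a local homeomorphism. -/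

import Mathlib

open Set Filter Topology
open scoped Manifold ContDiff

universe u v

noncomputable section

/-! ### Threefolds glued from tetrahedra -/

/-- Combinatorial gluing data. `glue t i = some (t', σ)` means that the face of the tetrahedron `t`
opposite to its vertex `i` is glued to the face of `t'` opposite to the vertex `σ i`, the vertex
`j ≠ i` of `t` going to the vertex `σ j` of `t'`; `glue t i = none` means that the face is free.
`mem t s` says that the open face of `t` spanned by the vertices in `s` belongs to the threefold. -/
structure TetGluing where
  Tet : Type u
  finite : Finite Tet
  glue : Tet → Fin 4 → Option (Tet × Equiv.Perm (Fin 4))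
  glue_symm : ∀ t i t' σ, glue t i = some (t', σ) → glue t' (σ i) = some (t, σ⁻¹)
  glue_ne : ∀ t i t' σ, glue t i = some (t', σ) → (t', σ i) ≠ (t, i)
  mem : Tet → Set (Fin 4) → Prop
  mem_univ : ∀ t, mem t univ
  mem_glue : ∀ t i t' σ s, glue t i = some (t', σ) → i ∉ s → (mem t s ↔ mem t' (σ '' s))

namespace TetGluing

/-- Passing from an oriented edge `(i, j)` of `t` to the one glued to it across a face of `t`. -/
def EdgeStep (τ : TetGluing.{u}) (e e' : τ.Tet × Fin 4 × Fin 4) : Prop :=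
  ∃ l σ, τ.glue e.1 l = some (e'.1, σ) ∧ e.2.1 ≠ l ∧ e.2.2 ≠ l ∧
    e'.2.1 = σ e.2.1 ∧ e'.2.2 = σ e.2.2

end TetGluing

/-- An ideal triangulation: the vertices (the special points, or punctures) are not in the
threefold, and no edge of the threefold is glued to itself with the orientation reversed. -/
structure IdealTriangulation extends TetGluing.{u} where
  not_mem_vertex : ∀ t i, ¬ mem t {i}
  edge_not_reversed : ∀ t i j, i ≠ j → mem t {i, j} →
    ¬ Relation.ReflTransGen toTetGluing.EdgeStep (t, i, j) (t, j, i)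

/-! ### The hypersimplicial decomposition of the tetrahedron `x₀ + x₁ + x₂ + x₃ = m`, `xᵢ ≥ 0` -/

/-- A hypersimplex of positive dimension of the decomposition, or a face of one. The coordinates
outside `free` are constant, equal to `lo`; the others vary in `[lo, lo + 1]`. In the coordinates
`uᵢ = xᵢ - loᵢ`, `i ∈ free`, it is `{0 ≤ uᵢ ≤ 1, ∑ uᵢ = level}`, of dimension `#free - 1`.
For `#free = 3` the `∘`-triangles (parallel to the faces of the big triangle) have level `1` and the
`•`-triangles (upside down) level `2`; for `#free = 4` the levels `1, 2, 3` are
the `∘`-tetrahedra `Δ^{2,0}`, the octahedra `Δ^{1,1}` and the `•`-tetrahedra `Δ^{0,2}`. -/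
structure Hypersimplex (m : ℕ) where
  free : Finset (Fin 4)
  lo : Fin 4 → ℕ
  level : ℕ
  level_pos : 0 < level
  level_lt : level < free.card
  sum_eq : ∑ i, lo i + level = m

namespace Hypersimplex

variable {m : ℕ}

def carrier (F : Hypersimplex m) : Set (Fin 4 → ℝ) :=
  {x | (∀ i ∈ F.free, (F.lo i : ℝ) ≤ x i ∧ x i ≤ F.lo i + 1) ∧
    (∀ i ∉ F.free, x i = F.lo i) ∧ ∑ i, x i = m}

def center (F : Hypersimplex m) : Fin 4 → ℝ :=
  fun i => F.lo i + if i ∈ F.free then (F.level : ℝ) / F.free.card else 0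

/-- `G` is a facet of `F`: one coordinate of `F` is set to its minimal or maximal value. -/
def IsFacet (G F : Hypersimplex m) : Prop :=
  ∃ i ∈ F.free, G.free = F.free.erase i ∧ (∀ j ≠ i, G.lo j = F.lo j) ∧
    (G.lo i = F.lo i ∨ G.lo i = F.lo i + 1)

/-- The singular hypersurface of a hypersimplex: the center of a segment, and inductively the cone,
from the center, over the singular hypersurfaces of the facets. -/
inductive InSingular : Hypersimplex m → (Fin 4 → ℝ) → Prop
  | segment (F : Hypersimplex m) (h : F.free.card = 2) : InSingular F F.center
  | cone (F G : Hypersimplex m) (y x : Fin 4 → ℝ) (hG : G.IsFacet F) (hy : InSingular G y)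
      (hx : x ∈ segment ℝ F.center y) : InSingular F x

/-- The closed piece, around a lattice point `v` (a vertex of `F`), into which the singular
hypersurface cuts `F`. -/
def chamber (F : Hypersimplex m) (v : Fin 4 → ℕ) : Set (Fin 4 → ℝ) :=
  closure (connectedComponentIn (F.carrier \ {x | F.InSingular x}) (fun i => (v i : ℝ)))

end Hypersimplex

/-- The domain of the zig-zag surface parallel to the plane `xᵢ = k + 1/2`, on the side of the
`i`-th vertex of the tetrahedron: the union of the pieces around the lattice points on this side of
the plane. -/
def zigzagDomain (m : ℕ) (i : Fin 4) (k : ℕ) : Set (Fin 4 → ℝ) :=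
  {x | ∃ (F : Hypersimplex m) (v : Fin 4 → ℕ), F.free = Finset.univ ∧
    (fun j => (v j : ℝ)) ∈ F.carrier ∧ k < v i ∧ x ∈ F.chamber v}

/-- `x` lies on a rectangle shared by the zig-zag surfaces parallel to `xᵢ = k + 1/2` and
`xⱼ = l + 1/2`: the rectangle consists of the common points of the pieces around two adjacent lattice
points `v` and `w = v + eᵢ - eⱼ` that are separated by both planes (and by no others). -/
def OnRectangle (m : ℕ) (i : Fin 4) (k : ℕ) (j : Fin 4) (l : ℕ) (x : Fin 4 → ℝ) : Prop :=
  ∃ (F : Hypersimplex m) (v w : Fin 4 → ℕ), F.free = Finset.univ ∧ i ≠ j ∧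
    (fun n => (v n : ℝ)) ∈ F.carrier ∧ (fun n => (w n : ℝ)) ∈ F.carrier ∧
    v i = k ∧ w i = k + 1 ∧ w j = l ∧ v j = l + 1 ∧ (∀ n, n ≠ i → n ≠ j → v n = w n) ∧
    x ∈ F.chamber v ∧ x ∈ F.chamber w

/-- Being a positive half-integer. -/
def IsHalf (r : ℝ) : Prop := ∃ k : ℕ, r = k + 1 / 2

namespace IdealTriangulation

/-! ### The threefold -/

/-- The points of the tetrahedron `t` that belong to the threefold. -/
def InTet (τ : IdealTriangulation.{u}) (m : ℕ) (t : τ.Tet) (x : Fin 4 → ℝ) : Prop :=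
  (∀ i, 0 ≤ x i) ∧ ∑ i, x i = m ∧ τ.mem t (Function.support x)

/-- The disjoint union of the tetrahedra. -/
abbrev Point (τ : IdealTriangulation.{u}) (m : ℕ) : Type u :=
  Σ t : τ.Tet, {x : Fin 4 → ℝ // τ.InTet m t x}

/-- The point `x` of the `j`-th face of `t` is glued, through `σ`, to the point `x'` of `t'`. -/
def GlueVia (τ : IdealTriangulation.{u}) (t : τ.Tet) (x : Fin 4 → ℝ) (j : Fin 4)
    (σ : Equiv.Perm (Fin 4)) (t' : τ.Tet) (x' : Fin 4 → ℝ) : Prop :=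
  τ.glue t j = some (t', σ) ∧ x j = 0 ∧ ∀ i, x' (σ i) = x i

def PointStep (τ : IdealTriangulation.{u}) (m : ℕ) (p p' : τ.Point m) : Prop :=
  ∃ j σ, τ.GlueVia p.1 p.2.1 j σ p'.1 p'.2.1

/-- The threefold `M` glued from the tetrahedra, with the quotient topology. -/
def Space (τ : IdealTriangulation.{u}) (m : ℕ) : Type u := Quot (τ.PointStep m)

instance (τ : IdealTriangulation.{u}) (m : ℕ) : TopologicalSpace (τ.Space m) :=
  inferInstanceAs (TopologicalSpace (Quot (τ.PointStep m)))

def toSpace (τ : IdealTriangulation.{u}) (m : ℕ) (p : τ.Point m) : τ.Space m := Quot.mk _ p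

/-! ### The spectral space -/

/-- The disjoint union of the copies of the parts in the tetrahedra `t` of the zig-zag domains,
indexed by the corners `(t, i)` and by `k = 0, …, m - 1`. -/
abbrev SheetPoint (τ : IdealTriangulation.{u}) (m : ℕ) : Type u :=
  Σ c : τ.Tet × Fin 4 × Fin m,
    {x : Fin 4 → ℝ // τ.InTet m c.1 x ∧ x ∈ zigzagDomain m c.2.1 c.2.2}

/-- Gluing of the parts of one zig-zag domain across the faces of the tetrahedra. -/
def SheetFaceStep (τ : IdealTriangulation.{u}) (m : ℕ) (p p' : τ.SheetPoint m) : Prop :=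
  ∃ j σ, τ.GlueVia p.1.1 p.2.1 j σ p'.1.1 p'.2.1 ∧ p'.1.2.1 = σ p.1.2.1 ∧ p'.1.2.2 = p.1.2.2

/-- Gluing of different zig-zag domains along the rectangles. -/
def SheetRectangleStep (τ : IdealTriangulation.{u}) (m : ℕ) (p p' : τ.SheetPoint m) : Prop :=
  p.1.1 = p'.1.1 ∧ p.2.1 = p'.2.1 ∧ OnRectangle m p.1.2.1 p.1.2.2 p'.1.2.1 p'.1.2.2 p.2.1

def SheetStep (τ : IdealTriangulation.{u}) (m : ℕ) (p p' : τ.SheetPoint m) : Prop :=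
  τ.SheetFaceStep m p p' ∨ τ.SheetRectangleStep m p p'

/-- The spectral space, with the quotient topology. -/
def SpectralSpace (τ : IdealTriangulation.{u}) (m : ℕ) : Type u := Quot (τ.SheetStep m)

instance (τ : IdealTriangulation.{u}) (m : ℕ) : TopologicalSpace (τ.SpectralSpace m) :=
  inferInstanceAs (TopologicalSpace (Quot (τ.SheetStep m)))

/-- The spectral map: each copy of a domain is mapped tautologically. -/
def spectralMap (τ : IdealTriangulation.{u}) (m : ℕ) : τ.SpectralSpace m → τ.Space m :=
  Quot.lift (fun p => τ.toSpace m ⟨p.1.1, p.2.1, p.2.2.1⟩) (by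
    rintro ⟨⟨t, i, k⟩, x, hx⟩ ⟨⟨t', i', k'⟩, x', hx'⟩ (⟨j, σ, h, -⟩ | ⟨h, h', -⟩)
    · exact Quot.sound ⟨j, σ, h⟩
    · dsimp only at h h'
      subst h h'
      rfl)

/-- The singular `•`-vertices: the centers of the `•`-tetrahedra. -/
def blackVertices (τ : IdealTriangulation.{u}) (m : ℕ) : Set (τ.Space m) :=
  {z | ∃ (p : τ.Point m) (F : Hypersimplex m), F.free = Finset.univ ∧ F.level = 3 ∧
    p.2.1 = F.center ∧ τ.toSpace m p = z}

/-- The union of the singular `•`-edges: they connect the centers of the octahedra and of the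
`•`-tetrahedra with the centers of their `•`-triangles. -/
def blackEdges (τ : IdealTriangulation.{u}) (m : ℕ) : Set (τ.Space m) :=
  {z | ∃ (p : τ.Point m) (F G : Hypersimplex m), F.free = Finset.univ ∧ G.IsFacet F ∧ G.level = 2 ∧
    p.2.1 ∈ segment ℝ F.center G.center ∧ τ.toSpace m p = z}

/-! ### The `Q`-diagram and its domains -/

/-- The union of the surfaces of the `Q`-diagram. -/
def diagram (τ : IdealTriangulation.{u}) (m : ℕ) : Set (τ.Space m) :=
  {z | ∃ p : τ.Point m, τ.toSpace m p = z ∧ ∃ i, IsHalf (p.2.1 i)}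

/-- The domain (component of the complement of the diagram) containing `z`. -/
def domain (τ : IdealTriangulation.{u}) (m : ℕ) (z : τ.Space m) : Set (τ.Space m) :=
  connectedComponentIn (τ.diagram m)ᶜ z

/-- `p` is a point of the closure of `C` lying on just one plane of the diagram in its tetrahedron,
of the form `xᵢ = k + 1/2`. -/
def IsFacePoint (τ : IdealTriangulation.{u}) (m : ℕ) (C : Set (τ.Space m)) (p : τ.Point m)
    (i : Fin 4) : Prop :=
  τ.toSpace m p ∈ closure C ∧ IsHalf (p.2.1 i) ∧ ∀ j ≠ i, ¬ IsHalf (p.2.1 j)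

/-- The face of `C` at `p` is cooriented into `C`. The plane `xᵢ = k + 1/2` is cooriented towards
the `i`-th face `xᵢ = 0`, so into `C` means that `C` lies on the side where `xᵢ` is smaller. -/
def CoorientedIn (τ : IdealTriangulation.{u}) (m : ℕ) (C : Set (τ.Space m)) (p : τ.Point m)
    (i : Fin 4) : Prop :=
  ∀ᶠ y in 𝓝 p.2, y.1 i < p.2.1 i → τ.toSpace m ⟨p.1, y⟩ ∈ C

/-- The face of `C` at `p` is cooriented out of `C`. -/
def CoorientedOut (τ : IdealTriangulation.{u}) (m : ℕ) (C : Set (τ.Space m)) (p : τ.Point m)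
    (i : Fin 4) : Prop :=
  ∀ᶠ y in 𝓝 p.2, p.2.1 i < y.1 i → τ.toSpace m ⟨p.1, y⟩ ∈ C

/-- `q` is a vertex of `C`, that is a quadruple point in its closure. -/
def IsVertexOf (τ : IdealTriangulation.{u}) (m : ℕ) (C : Set (τ.Space m)) (q : τ.Point m) : Prop :=
  (∀ i, IsHalf (q.2.1 i)) ∧ τ.toSpace m q ∈ closure C

/-- The faces of `C` meeting at `q` are either all cooriented in, or all cooriented out. -/
def ConsistentAt (τ : IdealTriangulation.{u}) (m : ℕ) (C : Set (τ.Space m)) (q : τ.Point m) :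
    Prop :=
  (∀ᶠ p in 𝓝 q, ∀ i, τ.IsFacePoint m C p i → τ.CoorientedIn m C p i) ∨
  (∀ᶠ p in 𝓝 q, ∀ i, τ.IsFacePoint m C p i → τ.CoorientedOut m C p i)

/-- A colored (`•` or `∘`) domain: all its vertices are consistently cooriented. A domain with no
vertices at all (a neighborhood of a puncture) is not colored. -/
def IsColored (τ : IdealTriangulation.{u}) (m : ℕ) (C : Set (τ.Space m)) : Prop :=
  (∃ q, τ.IsVertexOf m C q) ∧ ∀ q, τ.IsVertexOf m C q → τ.ConsistentAt m C q

/-! ### The surfaces of the diagram and the Lagrangian -/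

/-- A corner `(t, i)` with a point `x` of `t`. The ones with `xᵢ = k + 1/2` are, up to gluing, the
points of the (possibly self-intersecting) surfaces of the diagram. -/
abbrev Corner (τ : IdealTriangulation.{u}) (m : ℕ) : Type u := τ.Point m × Fin 4

def CornerStep (τ : IdealTriangulation.{u}) (m : ℕ) (c c' : τ.Corner m) : Prop :=
  ∃ j σ, τ.GlueVia c.1.1 c.1.2.1 j σ c'.1.1 c'.1.2.1 ∧ c.2 ≠ j ∧ c'.2 = σ c.2

/-- Two corners with points are identified by the gluing of the tetrahedra. -/
def CornerEqv (τ : IdealTriangulation.{u}) (m : ℕ) : τ.Corner m → τ.Corner m → Prop :=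
  Relation.EqvGen (τ.CornerStep m)

variable {H : Type*} [TopologicalSpace H]

/-- The total space `T^*M` of the cotangent bundle of the threefold `M`, for a smooth structure
on `M`. -/
abbrev CotangentSpace (τ : IdealTriangulation.{u}) (m : ℕ)
    (I : ModelWithCorners ℝ (EuclideanSpace ℝ (Fin 3)) H) [ChartedSpace H (τ.Space m)]
    [IsManifold I ∞ (τ.Space m)] : Type u :=
  Bundle.TotalSpace (EuclideanSpace ℝ (Fin 3) →L[ℝ] ℝ)
    (fun z : τ.Space m => TangentSpace I z →L[ℝ] Bundle.Trivial (τ.Space m) ℝ z)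

/-- `ξ` is a (nonzero) conormal covector, positive for the coorientation, to the surface of the
diagram that passes through the corner point `c`: it is the differential of a local
equation `f` of the surface, and `f` increases in the direction of the coorientation. -/
def IsConormal (τ : IdealTriangulation.{u}) (m : ℕ)
    (I : ModelWithCorners ℝ (EuclideanSpace ℝ (Fin 3)) H) [ChartedSpace H (τ.Space m)]
    [IsManifold I ∞ (τ.Space m)] (c : τ.Corner m) (ξ : τ.CotangentSpace m I) : Prop :=
  IsHalf (c.1.2.1 c.2) ∧ ξ.proj = τ.toSpace m c.1 ∧ ξ.snd ≠ 0 ∧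
  ∃ f : τ.Space m → ℝ, ContMDiffAt I 𝓘(ℝ, ℝ) ∞ f ξ.proj ∧
    (∀ w : TangentSpace I ξ.proj, ξ.snd w = mfderiv I 𝓘(ℝ, ℝ) f ξ.proj w) ∧
    ∀ c', τ.CornerEqv m c c' → ∀ᶠ y in 𝓝 c'.1.2,
      SignType.sign (f (τ.toSpace m ⟨c'.1.1, y⟩)) = SignType.sign (c'.1.2.1 c'.2 - y.1 c'.2)

/-- For the given smooth structure on `M`, the diagram is a collection of smooth cooriented surfaces
with disjoint Legendrians. -/
def IsSmoothDiagram (τ : IdealTriangulation.{u}) (m : ℕ)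
    (I : ModelWithCorners ℝ (EuclideanSpace ℝ (Fin 3)) H) [ChartedSpace H (τ.Space m)]
    [IsManifold I ∞ (τ.Space m)] : Prop :=
  (∀ c : τ.Corner m, IsHalf (c.1.2.1 c.2) → ∃ ξ, τ.IsConormal m I c ξ) ∧
  ∀ c c' ξ, τ.IsConormal m I c ξ → τ.IsConormal m I c' ξ → τ.CornerEqv m c c'

/-- The union of the zero section and of the conormal bundles, minus the zero sections over the mixed
(that is, not colored) domains. -/
def lagrangian (τ : IdealTriangulation.{u}) (m : ℕ)
    (I : ModelWithCorners ℝ (EuclideanSpace ℝ (Fin 3)) H) [ChartedSpace H (τ.Space m)]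
    [IsManifold I ∞ (τ.Space m)] : Set (τ.CotangentSpace m I) :=
  ({ξ | ξ.snd = 0} ∪ {ξ | ∃ c, τ.IsConormal m I c ξ}) \
    {ξ | ξ.snd = 0 ∧ ξ.proj ∉ τ.diagram m ∧ ¬ τ.IsColored m (τ.domain m ξ.proj)}

end IdealTriangulation

/-! ### Ramification -/

/-- Near `p` the map `π` is generically (away from the locus `B`) `d` to one. -/
def HasRamificationDegree {X Y : Type*} [TopologicalSpace X] [TopologicalSpace Y] (π : X → Y)
    (B : Set Y) (p : X) (d : ℕ) : Prop :=
  ∀ U ∈ 𝓝 p, ∃ V ∈ 𝓝 p, V ⊆ U ∧ ∃ W ∈ 𝓝 (π p), ∀ y ∈ W \ B, (V ∩ π ⁻¹' {y}).encard = d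

/-- `π` is ramified over the point `y` with degree `d`, as a map with `m` sheets: over `y` there is
one ramification point, of degree `d`, and `m - d` points at which `π` is a local homeomorphism. -/
def IsRamifiedOver {X Y : Type*} [TopologicalSpace X] [TopologicalSpace Y] (π : X → Y)
    (B : Set Y) (m d : ℕ) (y : Y) : Prop :=
  (∃ p, π p = y ∧ HasRamificationDegree π B p d ∧
    ∀ p', π p' = y → p' ≠ p → IsLocalHomeomorphOn π {p'}) ∧
  (π ⁻¹' {y}).encard + d = m + 1

end

/-! Think of a pair `(i, k)` as a unit of height `x i - k`. A lattice point `v` of total `m` uses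
the units with `k < v i`, and `x - v` lies in the Voronoi cell of the root lattice exactly when no
unused unit is higher than a used one: `v` selects `m` highest units. The choice is unique unless
there is a tie at the threshold height; a tie height is unique and lies in `(0, 1)`, and the units
at that height can be exchanged (`IsRounding.exchange`, `IsRounding.swap`).

The pieces cut out by the singular surface are these Voronoi cells intersected with the
hypersimplices (`Hypersimplex.chamber_eq`). Hence a zig-zag domain is the set where some selection
uses `(i, k)`, and the rectangles are the places where two units are tied. The fiber of the spectral
map over `x` is therefore the list of the `m` selected units, with those at the tie height
identified. Monodromy around the edges does not disturb this, because a chain of gluings that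
returns to a point fixes every vertex with nonzero coordinate (`Path.fixed`).

Covering and ramification then come from counting. The number of selected units whose points lie in
an open set isolated in the fiber does not depend on the selection (`IsRounding.sum_eq`), and a
selection for a nearby point is also one for the given point, so the number is locally constant
(`eventually_card_sheetIndices`). A point of the fiber that carries `d` selected units has local
degree `d`. Two selected units coincide exactly when at least two of them are tied with an
unselected one, and the vanishing of the sum of `x - v` turns this into the equations of the black
edges; three coincide at the black vertices only. Closedness of the spectral map, from finiteness of
the gluings, makes it proper and a cover elsewhere.

For the Lagrangian, the sum of the integers nearest to the coordinates is constant on each domain of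
the diagram and equals `m - 1`, `m` or `m + 1`; the value `m` characterizes the mixed domains
(`isColored_domain_iff`). The regions between the planes and their zig-zag surfaces ("flat parts")
cover the diagram together with the colored domains, avoid the mixed ones, and overlap only along
the rectangles (`exists_inFlat`, `InFlat.roundSum_ne`, `InFlat.eq_or_tie`). Each line through the
vertex `i` enters the zig-zag domain once and then stays in it. Folding that half-line makes it run
from the zig-zag surface to the plane `xᵢ = k + 1/2` and then along a ray over the plane. The first
part is sent to the zero section, the ray to the positive conormal ray, parametrized by a continuous
norm (`UnitConormals.lift`). Conormal rays are well defined since two local equations with equal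
signs have positively proportional differentials, also at boundary and corner points
(`exists_pos_mul_fderivWithin_eq`). The resulting map is continuous, proper, has the Lagrangian as
image, and identifies exactly the points glued in the spectral space; so the quotient is
homeomorphic to the Lagrangian. -/

noncomputable section

/-! ### Rounding points of the simplex to lattice points -/

/-- `x - v` belongs to the Voronoi cell of the root lattice `A₃`. -/
def Rounds (x : Fin 4 → ℝ) (v : Fin 4 → ℕ) : Prop := ∀ i j, x j - v j ≤ x i - v i + 1

/-- The unit `(i, k)` has height `x i - k` and is used by `v` when `k < v i`. The highest unused
unit at `j` has height `x j - v j`, the lowest used one at `i` has height `x i - v i + 1`; so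
`Rounds` says that no unused unit is above a used one. -/
def IsRounding (m : ℕ) (x : Fin 4 → ℝ) (v : Fin 4 → ℕ) : Prop := ∑ i, v i = m ∧ Rounds x v

def InSimplex (m : ℕ) (x : Fin 4 → ℝ) : Prop := (∀ i, 0 ≤ x i) ∧ ∑ i, x i = m

/-- There is a choice at the height `a`: some rounding does not use a unit at this height, and uses
another one. -/
def Ties (m : ℕ) (x : Fin 4 → ℝ) (a : ℝ) : Prop :=
  ∃ v, IsRounding m x v ∧ (∃ p, x p - v p = a) ∧ ∃ q, x q - v q = a - 1

theorem exists_lt_of_sum_eq {v w : Fin 4 → ℕ} (h : ∑ i, v i = ∑ i, w i) {i : Fin 4}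
    (hi : v i < w i) : ∃ j, w j < v j := by
  by_contra! H
  exact (Finset.sum_lt_sum (fun j _ => H j) ⟨i, Finset.mem_univ _, hi⟩).ne h

theorem exists_sum_eq_of_ne {i j : Fin 4} (h : i ≠ j) : ∃ p q : Fin 4, i ≠ p ∧ i ≠ q ∧ j ≠ p ∧
    j ≠ q ∧ p ≠ q ∧ ∀ f : Fin 4 → ℝ, ∑ n, f n = f i + f j + f p + f q := by
  obtain ⟨p, q, h1, h2, h3, h4, h5⟩ : ∃ p q : Fin 4, i ≠ p ∧ i ≠ q ∧ j ≠ p ∧ j ≠ q ∧ p ≠ q := by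
    revert i j; decide
  refine ⟨p, q, h1, h2, h3, h4, h5, fun f => ?_⟩
  have hu : (Finset.univ : Finset (Fin 4)) = {i, j, p, q} := by
    symm
    apply Finset.eq_univ_of_card
    rw [Finset.card_insert_of_notMem (by simp [h, h1, h2]),
      Finset.card_insert_of_notMem (by simp [h3, h4]),
      Finset.card_insert_of_notMem (by simp [h5])]
    simp
  rw [hu, Finset.sum_insert (by simp [h, h1, h2]), Finset.sum_insert (by simp [h3, h4]),
    Finset.sum_insert (by simp [h5]), Finset.sum_singleton]
  ring

theorem rounds_of_mem_Icc {x : Fin 4 → ℝ} {v : Fin 4 → ℕ} {a : ℝ}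
    (h : ∀ n, a - 1 ≤ x n - v n ∧ x n - v n ≤ a) : Rounds x v :=
  fun i j => by linarith [(h i).1, (h j).2]

namespace IsRounding

variable {m : ℕ} {x : Fin 4 → ℝ} {v w : Fin 4 → ℕ} {i j p q : Fin 4} {k : ℕ} {a : ℝ}

theorem sum_sub (hv : IsRounding m x v) (hx : InSimplex m x) : ∑ n, (x n - v n) = 0 := by
  rw [Finset.sum_sub_distrib, hx.2, ← Nat.cast_sum, hv.1, sub_self]

theorem le_total (hv : IsRounding m x v) (n : Fin 4) : v n ≤ m :=
  hv.1 ▸ Finset.single_le_sum (f := v) (fun _ _ => Nat.zero_le _) (Finset.mem_univ n)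

/-- Adding the Voronoi inequality of `v` for the pair `(q, p)` to that of `w` for `(p, q)` cancels
`x` and leaves `(w p - v p) + (v q - w q) ≤ 2`. Both terms are at least one, so everything is an
equality. -/
theorem exchange (hv : IsRounding m x v) (hw : IsRounding m x w) (hp : v p < w p)
    (hq : w q < v q) : w p = v p + 1 ∧ v q = w q + 1 ∧ x p - v p = x q - w q := by
  have h1 := hv.2 q p
  have h2 := hw.2 p q
  have h3 : (v p : ℝ) + 1 ≤ w p := by exact_mod_cast hp
  have h4 : (w q : ℝ) + 1 ≤ v q := by exact_mod_cast hq
  refine ⟨?_, ?_, by linarith⟩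
  · have : (w p : ℝ) ≤ v p + 1 := by linarith
    have : w p ≤ v p + 1 := by exact_mod_cast this
    omega
  · have : (v q : ℝ) ≤ w q + 1 := by linarith
    have : v q ≤ w q + 1 := by exact_mod_cast this
    omega

theorem ties_of_lt (hv : IsRounding m x v) (hw : IsRounding m x w) (hp : v p < w p) :
    w p = v p + 1 ∧ Ties m x (x p - v p) := by
  obtain ⟨q, hq⟩ := exists_lt_of_sum_eq (hv.1.trans hw.1.symm) hp
  obtain ⟨h1, h2, h3⟩ := hv.exchange hw hp hq
  refine ⟨h1, v, hv, ⟨p, rfl⟩, q, ?_⟩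
  rw [h2, h3]; push_cast; ring

theorem mem_Icc (hv : IsRounding m x v) (hp : x p - v p = a) (hq : x q - v q = a - 1) (n : Fin 4) :
    a - 1 ≤ x n - v n ∧ x n - v n ≤ a :=
  ⟨by linarith [hv.2 n p], by linarith [hv.2 q n]⟩

/-- The differences `x n - v n` lie in `[a - 1, a]`, attain both ends, and have sum zero. For `a ≤
0` the sum would be negative, for `a ≥ 1` positive. -/
theorem pos_of_tie (hv : IsRounding m x v) (hx : InSimplex m x) (hp : x p - v p = a)
    (hq : x q - v q = a - 1) : 0 < a ∧ a < 1 := by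
  have hs := hv.sum_sub hx
  constructor <;> by_contra! H
  · have := Finset.sum_lt_sum (s := Finset.univ) (f := fun n => x n - v n) (g := fun _ => (0 : ℝ))
      (fun n _ => by linarith [(hv.mem_Icc hp hq n).2]) ⟨q, Finset.mem_univ _, by linarith⟩
    simp only [Finset.sum_const_zero] at this
    linarith
  · have := Finset.sum_lt_sum (s := Finset.univ) (g := fun n => x n - v n) (f := fun _ => (0 : ℝ))
      (fun n _ => by linarith [(hv.mem_Icc hp hq n).1]) ⟨p, Finset.mem_univ _, by linarith⟩
    simp only [Finset.sum_const_zero] at this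
    linarith

/-- If `v i ≥ 1`, the Voronoi inequalities against `i` make all differences `x n - v n` nonpositive,
and the one at `i` negative, contrary to their sum being zero. -/
theorem eq_zero (hv : IsRounding m x v) (hx : InSimplex m x) (hi : x i = 0) : v i = 0 := by
  by_contra H
  have h1 : (1 : ℝ) ≤ v i := by exact_mod_cast Nat.one_le_iff_ne_zero.mpr H
  have := Finset.sum_lt_sum (s := Finset.univ) (f := fun n => x n - v n) (g := fun _ => (0 : ℝ))
      (fun n _ => by linarith [hv.2 i n]) ⟨i, Finset.mem_univ _, by linarith⟩
  simp only [Finset.sum_const_zero] at this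
  linarith [hv.sum_sub hx]

/-- Exchanging the two units of a tie. -/
theorem swap (hv : IsRounding m x v) (hx : InSimplex m x) (hp : x p - v p = a)
    (hq : x q - v q = a - 1) :
    ∃ w, IsRounding m x w ∧ w p = v p + 1 ∧ v q = w q + 1 ∧ ∀ n, n ≠ p → n ≠ q → w n = v n := by
  have hpq : p ≠ q := by rintro rfl; linarith
  -- There is a unit to remove: `v q = 0` would give `a = x q + 1 ≥ 1`.
  have hq1 : 1 ≤ v q := by
    rw [Nat.one_le_iff_ne_zero]
    intro h
    rw [h] at hq
    have := hx.1 q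
    have := (hv.pos_of_tie hx hp (by rw [h]; exact hq)).2
    push_cast at hq
    linarith
  obtain ⟨r, s, h1, h2, h3, h4, h5, hsum⟩ := exists_sum_eq_of_ne hpq
  let w : Fin 4 → ℕ := fun n => if n = p then v n + 1 else if n = q then v n - 1 else v n
  have wp : w p = v p + 1 := by simp [w]
  have wq : w q = v q - 1 := by simp [w, hpq.symm]
  have wn : ∀ n, n ≠ p → n ≠ q → w n = v n := fun n h h' => by simp [w, h, h']
  have wq' : (w q : ℝ) = v q - 1 := by rw [wq]; push_cast [hq1]; ring
  have wp' : (w p : ℝ) = v p + 1 := by rw [wp]; push_cast; ring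
  refine ⟨w, ⟨?_, rounds_of_mem_Icc (a := a) fun n => ?_⟩, wp, by omega, wn⟩
  · have hv' := hsum fun n => (v n : ℝ)
    have hw' := hsum fun n => (w n : ℝ)
    rw [← Nat.cast_sum] at hv' hw'
    rw [hv.1] at hv'
    rw [wn r h1.symm h3.symm, wn s h2.symm h4.symm, wq', wp'] at hw'
    exact_mod_cast (show ((∑ n, w n : ℕ) : ℝ) = m by linarith)
  · by_cases hn : n = p
    · subst hn; constructor <;> linarith
    by_cases hn' : n = q
    · subst hn'; constructor <;> linarith
    rw [wn n hn hn']
    exact hv.mem_Icc hp hq n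

/-- The tie is visible from every rounding. If `v` differs from the witness `w`, the units they
exchange have a common height, and the interval `[a - 1, a]` containing the differences of `w`
bounds that height by `a` from both sides. -/
theorem exists_tie (hv : IsRounding m x v) (h : Ties m x a) :
    (∃ p, x p - v p = a) ∧ ∃ q, x q - v q = a - 1 := by
  obtain ⟨w, hw, ⟨p, hp⟩, ⟨q, hq⟩⟩ := h
  by_cases hvw : v = w
  · subst hvw; exact ⟨⟨p, hp⟩, ⟨q, hq⟩⟩
  obtain ⟨n, hn⟩ := Function.ne_iff.mp hvw
  obtain ⟨r, s, hr, hs⟩ : ∃ r s, v r < w r ∧ w s < v s := by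
    rcases lt_or_gt_of_ne hn with hn | hn
    · exact ⟨n, _, hn, (exists_lt_of_sum_eq (hv.1.trans hw.1.symm) hn).choose_spec⟩
    · exact ⟨_, n, (exists_lt_of_sum_eq (hw.1.trans hv.1.symm) hn).choose_spec, hn⟩
  obtain ⟨h1, h2, h3⟩ := hv.exchange hw hr hs
  have e1 : (w r : ℝ) = v r + 1 := by exact_mod_cast h1
  have e2 : (v s : ℝ) = w s + 1 := by exact_mod_cast h2
  have := hw.mem_Icc hp hq r
  have := hw.mem_Icc hp hq s
  exact ⟨⟨r, by linarith⟩, ⟨s, by linarith⟩⟩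

/-- For any rounding `v`, a tie height is the largest of the differences `x n - v n`. -/
theorem ties_unique {b : ℝ} (hv : IsRounding m x v) (h : Ties m x a) (h' : Ties m x b) : a = b := by
  obtain ⟨⟨p, hp⟩, ⟨q, hq⟩⟩ := hv.exists_tie h
  obtain ⟨⟨r, hr⟩, ⟨s, hs⟩⟩ := hv.exists_tie h'
  have := hv.mem_Icc hp hq r
  have := hv.mem_Icc hr hs p
  linarith

/-- A sum over the units used by a rounding depends only on the point. -/
theorem sum_eq (hv : IsRounding m x v) (hw : IsRounding m x w) (g : Fin 4 → ℕ → ℤ)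
    (hg : ∀ (i : Fin 4) (k : ℕ) (j : Fin 4) (l : ℕ), x i - k = x j - l → Ties m x (x i - k) →
      g i k = g j l) :
    ∑ n, ∑ k ∈ Finset.range (v n), g n k = ∑ n, ∑ k ∈ Finset.range (w n), g n k := by
  -- All units on which `v` and `w` disagree have the same tied height, so `g` has one value `c` on
  -- them. The disagreements are by single units and cancel in total.
  obtain ⟨c, hc⟩ : ∃ c : ℤ, ∀ n, ∑ k ∈ Finset.range (w n), g n k - ∑ k ∈ Finset.range (v n), g n k
      = ((w n : ℤ) - v n) * c := by
    by_cases hvw : v = w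
    · exact ⟨0, fun n => by simp [hvw]⟩
    obtain ⟨n, hn⟩ := Function.ne_iff.mp hvw
    obtain ⟨r, s, hr, hs⟩ : ∃ r s, v r < w r ∧ w s < v s := by
      rcases lt_or_gt_of_ne hn with hn | hn
      · exact ⟨n, _, hn, (exists_lt_of_sum_eq (hv.1.trans hw.1.symm) hn).choose_spec⟩
      · exact ⟨_, n, (exists_lt_of_sum_eq (hw.1.trans hv.1.symm) hn).choose_spec, hn⟩
    have ht := (hv.ties_of_lt hw hr).2
    obtain ⟨-, -, h3⟩ := hv.exchange hw hr hs
    refine ⟨g r (v r), fun n => ?_⟩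
    rcases lt_trichotomy (v n) (w n) with h | h | h
    · obtain ⟨e, -, h'⟩ := hv.exchange hw h hs
      rw [e, Finset.sum_range_succ, hg r (v r) n (v n) (by linarith) ht]
      push_cast; ring
    · rw [h]; ring
    · obtain ⟨-, e, h'⟩ := hv.exchange hw hr h
      rw [e, Finset.sum_range_succ, hg r (v r) n (w n) (by linarith) ht]
      push_cast; ring
  have : ∑ n, (∑ k ∈ Finset.range (w n), g n k - ∑ k ∈ Finset.range (v n), g n k) = 0 := by
    simp_rw [hc, ← Finset.sum_mul, Finset.sum_sub_distrib]
    have h1 : ∑ n, (w n : ℤ) = m := by exact_mod_cast hw.1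
    have h2 : ∑ n, (v n : ℤ) = m := by exact_mod_cast hv.1
    rw [h1, h2, sub_self, zero_mul]
  rw [Finset.sum_sub_distrib] at this
  linarith

end IsRounding

section

variable {m : ℕ} {x : Fin 4 → ℝ}

/-- Take a closest point `v` among the lattice points of the simplex. Moving a unit from `i` to `j`
does not bring it closer, which is the Voronoi inequality when `v i > 0`. When `v i = 0` the move is
unavailable, but a violation would make all differences nonnegative and one positive, against the
zero sum. -/
theorem exists_isRounding (hx : InSimplex m x) : ∃ v, IsRounding m x v := by
  obtain ⟨v, hv, hmin⟩ := Finset.exists_min_image (Finset.piAntidiag (Finset.univ : Finset (Fin 4)) m)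
    (fun v => ∑ n, (x n - v n) ^ 2) ⟨fun n => if n = 0 then m else 0, by simp⟩
  have hs : ∑ n, v n = m := by simpa using hv
  have hsum : ∑ n, (x n - v n) = 0 := by
    rw [Finset.sum_sub_distrib, hx.2, ← Nat.cast_sum, hs, sub_self]
  have key : ∀ i j, 0 < v i → x j - v j ≤ x i - v i + 1 := by
    intro i j hi
    by_cases hij : i = j
    · subst hij; linarith
    obtain ⟨p, q, h1, h2, h3, h4, h5, hS⟩ := exists_sum_eq_of_ne hij
    let w : Fin 4 → ℕ := fun n => if n = j then v n + 1 else if n = i then v n - 1 else v n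
    have wj : (w j : ℝ) = v j + 1 := by simp [w]
    have wi : (w i : ℝ) = v i - 1 := by
      simp only [w, hij, if_false, if_true]; push_cast [Nat.one_le_iff_ne_zero.mpr hi.ne']; ring
    have wp : (w p : ℝ) = v p := by simp [w, h3.symm, h1.symm]
    have wq : (w q : ℝ) = v q := by simp [w, h4.symm, h2.symm]
    have hw : ∑ n, w n = m := by
      have e1 := hS fun n => (w n : ℝ)
      have e2 := hS fun n => (v n : ℝ)
      rw [← Nat.cast_sum] at e1 e2
      rw [hs] at e2
      rw [wj, wi, wp, wq] at e1
      exact_mod_cast (show ((∑ n, w n : ℕ) : ℝ) = m by linarith)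
    have := hmin w (by simpa using hw)
    rw [hS, hS, wj, wi, wp, wq] at this
    nlinarith
  refine ⟨v, hs, fun i j => ?_⟩
  by_cases hi : 0 < v i
  · exact key i j hi
  by_contra! H
  have hi0 : v i = 0 := by omega
  have h0 : ∀ n, 0 ≤ x n - v n := fun n => by
    by_cases hn : 0 < v n
    · have := key n j hn
      have := hx.1 i
      rw [hi0] at H; push_cast at H
      linarith
    · have : v n = 0 := by omega
      rw [this]; simpa using hx.1 n
  have := Finset.sum_pos' (fun n (_ : n ∈ Finset.univ) => h0 n)
    ⟨j, Finset.mem_univ j, by linarith [h0 i]⟩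
  linarith

/-- Semicontinuity: only finitely many lattice points have total `m`, and each Voronoi cell is
closed. Every closedness and local constancy statement about sheets rests on this. -/
theorem eventually_isRounding (m : ℕ) (x : Fin 4 → ℝ) :
    ∀ᶠ y in 𝓝 x, ∀ v, IsRounding m y v → IsRounding m x v := by
  have : ∀ v ∈ (Finset.piAntidiag (Finset.univ : Finset (Fin 4)) m : Set (Fin 4 → ℕ)),
      ∀ᶠ y in 𝓝 x, Rounds y v → Rounds x v := by
    intro v _
    by_cases h : Rounds x v
    · exact Eventually.of_forall fun _ _ => h
    have hc : IsClosed {y : Fin 4 → ℝ | Rounds y v} := by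
      simp only [Rounds, ofPred_forall]
      exact isClosed_iInter fun i => isClosed_iInter fun j =>
        isClosed_le (by fun_prop) (by fun_prop)
    filter_upwards [hc.isOpen_compl.mem_nhds h] with y hy hy'
    exact absurd hy' hy
  filter_upwards [(Filter.eventually_all_finite (Finset.finite_toSet _)).mpr this] with y hy v hv
  exact ⟨hv.1, hy v (by simpa using hv.1) hv.2⟩

/-- The points whose sheets include the one of `x i - k`. -/
def InSheet (m : ℕ) (x : Fin 4 → ℝ) (i : Fin 4) (k : ℕ) : Prop := ∃ v, IsRounding m x v ∧ k < v i

/-- The closed complement of `InSheet`. -/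
def OffSheet (m : ℕ) (x : Fin 4 → ℝ) (i : Fin 4) (k : ℕ) : Prop := ∃ v, IsRounding m x v ∧ v i ≤ k

theorem InSheet.of_isRounding {i : Fin 4} {k : ℕ} (h : InSheet m x i k) {v : Fin 4 → ℕ}
    (hv : IsRounding m x v) : k < v i ∨ k = v i ∧ Ties m x (x i - k) := by
  obtain ⟨w, hw, hk⟩ := h
  by_cases hvi : k < v i
  · exact Or.inl hvi
  obtain ⟨e, ht⟩ := hv.ties_of_lt hw (show v i < w i by omega)
  have : k = v i := by omega
  subst this
  exact Or.inr ⟨rfl, ht⟩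

theorem OffSheet.of_isRounding {i : Fin 4} {k : ℕ} (h : OffSheet m x i k) {v : Fin 4 → ℕ}
    (hv : IsRounding m x v) : v i ≤ k ∨ v i = k + 1 ∧ Ties m x (x i - k) := by
  obtain ⟨w, hw, hk⟩ := h
  by_cases hvi : v i ≤ k
  · exact Or.inl hvi
  obtain ⟨e, ht⟩ := hw.ties_of_lt hv (show w i < v i by omega)
  have : w i = k := by omega
  subst this
  exact Or.inr ⟨e, ht⟩

theorem Ties.pos {a : ℝ} (h : Ties m x a) (hx : InSimplex m x) : 0 < a ∧ a < 1 := by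
  obtain ⟨v, hv, ⟨p, hp⟩, ⟨q, hq⟩⟩ := h
  exact hv.pos_of_tie hx hp hq

theorem IsRounding.eq_or_eq_of_tie {v : Fin 4 → ℕ} {p q i : Fin 4} {a : ℝ} {k : ℕ}
    (hv : IsRounding m x v) (hp : x p - v p = a)
    (hq : x q - v q = a - 1) (hk : x i - k = a) : v i = k ∨ v i = k + 1 := by
  have := hv.mem_Icc hp hq i
  have h1 : (v i : ℝ) ≤ k + 1 := by linarith
  have h2 : (k : ℝ) ≤ v i := by linarith
  have h1 : v i ≤ k + 1 := by exact_mod_cast h1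
  have h2 : k ≤ v i := by exact_mod_cast h2
  omega

/-- Any two units at the height of a tie can be the unused and the used one of a rounding. -/
theorem Ties.exists_isRounding {i j : Fin 4} {k l : ℕ} (hx : InSimplex m x) (hij : i ≠ j)
    (h : x i - k = x j - l) (ht : Ties m x (x i - k)) :
    ∃ v, IsRounding m x v ∧ v i = k ∧ v j = l + 1 := by
  obtain ⟨v, hv, ⟨p, hp⟩, ⟨q, hq⟩⟩ := ht
  set a := x i - k with ha
  rcases hv.eq_or_eq_of_tie hp hq ha.symm with hi | hi <;>
    rcases hv.eq_or_eq_of_tie hp hq h.symm with hj | hj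
  · have hj' : x j - v j = a := by rw [hj, h]
    have hqi : q ≠ i := by rintro rfl; rw [hi] at hq; linarith
    obtain ⟨w, hw, w1, w2, w3⟩ := hv.swap hx hj' hq
    exact ⟨w, hw, by rw [w3 i hij hqi.symm, hi], by rw [w1, hj]⟩
  · exact ⟨v, hv, hi, hj⟩
  · have hi' : x i - v i = a - 1 := by rw [hi, ha]; push_cast; ring
    have hj' : x j - v j = a := by rw [hj, h]
    obtain ⟨w, hw, w1, w2, w3⟩ := hv.swap hx hj' hi'
    exact ⟨w, hw, by omega, by omega⟩
  · have hi' : x i - v i = a - 1 := by rw [hi, ha]; push_cast; ring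
    have hpj : p ≠ j := by rintro rfl; rw [hj] at hp; push_cast at hp; linarith
    obtain ⟨w, hw, w1, w2, w3⟩ := hv.swap hx hp hi'
    exact ⟨w, hw, by omega, by rw [w3 j hpj.symm hij.symm, hj]⟩

theorem Ties.inSheet {i : Fin 4} {k : ℕ} (hx : InSimplex m x) (ht : Ties m x (x i - k)) :
    InSheet m x i k := by
  obtain ⟨v, hv, ⟨p, hp⟩, ⟨q, hq⟩⟩ := ht
  rcases hv.eq_or_eq_of_tie hp hq rfl with hi | hi
  · obtain ⟨w, hw, w1, w2, w3⟩ := hv.swap hx (show x i - v i = x i - k by rw [hi]) hq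
    exact ⟨w, hw, by omega⟩
  · exact ⟨v, hv, by omega⟩

theorem Ties.offSheet {i : Fin 4} {k : ℕ} (hx : InSimplex m x) (ht : Ties m x (x i - k)) :
    OffSheet m x i k := by
  obtain ⟨v, hv, ⟨p, hp⟩, ⟨q, hq⟩⟩ := ht
  rcases hv.eq_or_eq_of_tie hp hq rfl with hi | hi
  · exact ⟨v, hv, by omega⟩
  · obtain ⟨w, hw, w1, w2, w3⟩ := hv.swap hx hp
      (show x i - v i = x i - k - 1 by rw [hi]; push_cast; ring)
    exact ⟨w, hw, by omega⟩

/-- Together with `Ties.inSheet` and `Ties.offSheet`: the zig-zag surface, where the two closed sets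
meet, is the locus at which the unit `(i, k)` is tied. -/
theorem ties_of_inSheet_of_offSheet {i : Fin 4} {k : ℕ} (h : InSheet m x i k)
    (h' : OffSheet m x i k) : Ties m x (x i - k) := by
  obtain ⟨v, hv, hk⟩ := h
  rcases h'.of_isRounding hv with h | h
  · omega
  · exact h.2

theorem isClosed_setOf_inSheet (m : ℕ) (i : Fin 4) (k : ℕ) : IsClosed {x | InSheet m x i k} := by
  rw [← isOpen_compl_iff, isOpen_iff_mem_nhds]
  intro x hx
  filter_upwards [eventually_isRounding m x] with y hy ⟨v, hv, hk⟩
  exact hx ⟨v, hy v hv, hk⟩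

theorem isClosed_setOf_offSheet (m : ℕ) (i : Fin 4) (k : ℕ) : IsClosed {x | OffSheet m x i k} := by
  rw [← isOpen_compl_iff, isOpen_iff_mem_nhds]
  intro x hx
  filter_upwards [eventually_isRounding m x] with y hy ⟨v, hv, hk⟩
  exact hx ⟨v, hy v hv, hk⟩

theorem eventually_ties (m : ℕ) (x : Fin 4 → ℝ) (i : Fin 4) (k : ℕ) :
    ∀ᶠ y in 𝓝 x, InSimplex m y → Ties m y (y i - k) → Ties m x (x i - k) := by
  filter_upwards [eventually_isRounding m x] with y hy hs ht
  obtain ⟨v, hv, h⟩ := ht.inSheet hs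
  obtain ⟨w, hw, h'⟩ := ht.offSheet hs
  exact ties_of_inSheet_of_offSheet ⟨v, hy v hv, h⟩ ⟨w, hy w hw, h'⟩

/-- Moving towards the corner `i`, one stays strictly inside the sheet. -/
theorem InSheet.not_offSheet {y : Fin 4 → ℝ} {i : Fin 4} {k : ℕ} (h : InSheet m x i k)
    (hi : x i < y i) (hj : ∀ j ≠ i, y j ≤ x j) : ¬ OffSheet m y i k := by
  rintro ⟨w, hw, hwk⟩
  obtain ⟨v, hv, hvk⟩ := h
  obtain ⟨j, hj'⟩ := exists_lt_of_sum_eq (hw.1.trans hv.1.symm) (show w i < v i by omega)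
  have hji : j ≠ i := by rintro rfl; omega
  have h1 := hv.2 i j
  have h2 := hw.2 j i
  have h3 := hj j hji
  have : (v j : ℝ) + 1 ≤ w j := by exact_mod_cast hj'
  have : (w i : ℝ) + 1 ≤ v i := by exact_mod_cast (by omega : w i + 1 ≤ v i)
  linarith

theorem inSheet_or_offSheet (hx : InSimplex m x) (i : Fin 4) (k : ℕ) :
    InSheet m x i k ∨ OffSheet m x i k := by
  obtain ⟨v, hv⟩ := exists_isRounding hx
  rcases lt_or_ge k (v i) with h | h
  · exact Or.inl ⟨v, hv, h⟩
  · exact Or.inr ⟨v, hv, h⟩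

/-- A sheet stays off the face opposite to its corner, so its corner survives on every face across
which it is continued. -/
theorem InSheet.pos {i : Fin 4} {k : ℕ} (h : InSheet m x i k) (hx : InSimplex m x) : 0 < x i := by
  obtain ⟨v, hv, hk⟩ := h
  refine (hx.1 i).lt_of_ne fun h0 => ?_
  have := hv.eq_zero hx h0.symm
  omega

theorem InSheet.lt {i : Fin 4} {k : ℕ} (h : InSheet m x i k) : k < m := by
  obtain ⟨v, hv, hk⟩ := h
  exact hk.trans_le (hv.le_total i)

section Perm

variable (ρ : Equiv.Perm (Fin 4))

theorem IsRounding.comp {v : Fin 4 → ℕ} (h : IsRounding m x v) : IsRounding m (x ∘ ρ) (v ∘ ρ) :=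
  ⟨by rw [← h.1]; exact Equiv.sum_comp ρ v, fun i j => h.2 _ _⟩

theorem Ties.comp {a : ℝ} (h : Ties m x a) : Ties m (x ∘ ρ) a := by
  obtain ⟨v, hv, ⟨p, hp⟩, ⟨q, hq⟩⟩ := h
  exact ⟨_, hv.comp ρ, ⟨ρ.symm p, by simpa⟩, ⟨ρ.symm q, by simpa⟩⟩

theorem InSheet.comp {i : Fin 4} {k : ℕ} (h : InSheet m x (ρ i) k) : InSheet m (x ∘ ρ) i k := by
  obtain ⟨v, hv, hk⟩ := h
  exact ⟨_, hv.comp ρ, hk⟩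

theorem OffSheet.comp {i : Fin 4} {k : ℕ} (h : OffSheet m x (ρ i) k) : OffSheet m (x ∘ ρ) i k := by
  obtain ⟨v, hv, hk⟩ := h
  exact ⟨_, hv.comp ρ, hk⟩

end Perm

end

/-! ### The chambers of the hypersimplices are Voronoi cells -/

namespace Hypersimplex

variable {m : ℕ}

/-- The coordinates of `x` relative to `F` that are chosen to be large are not determined. -/
def Ambiguous (F : Hypersimplex m) (x : Fin 4 → ℝ) : Prop :=
  ∃ θ : ℝ, (F.free.filter fun i => θ < x i - F.lo i).card < F.level ∧
    F.level < (F.free.filter fun i => θ ≤ x i - F.lo i).card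

theorem card_filter_eq_erase {s : Finset (Fin 4)} {i : Fin 4} (hi : i ∈ s) (p : Fin 4 → Prop)
    [DecidablePred p] :
    (s.filter p).card = ((s.erase i).filter p).card + if p i then 1 else 0 := by
  rw [← Finset.insert_erase hi, Finset.filter_insert, Finset.erase_insert (Finset.notMem_erase i s)]
  split_ifs
  · rw [Finset.card_insert_of_notMem (by simp)]
  · rfl

/-- The facet on which a coordinate is minimal. -/
def facetMin (F : Hypersimplex m) (i : Fin 4) (hi : i ∈ F.free) (h : F.level + 1 < F.free.card) :
    Hypersimplex m where
  free := F.free.erase i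
  lo := F.lo
  level := F.level
  level_pos := F.level_pos
  level_lt := by rw [Finset.card_erase_of_mem hi]; omega
  sum_eq := F.sum_eq

theorem sum_update_succ (l : Fin 4 → ℕ) (i : Fin 4) :
    ∑ j, Function.update l i (l i + 1) j = ∑ j, l j + 1 := by
  rw [Finset.sum_update_of_mem (Finset.mem_univ i),
    ← Finset.add_sum_erase _ _ (Finset.mem_univ i), Finset.sdiff_singleton_eq_erase]
  ring

/-- The facet on which a coordinate is maximal. -/
def facetMax (F : Hypersimplex m) (i : Fin 4) (hi : i ∈ F.free) (h : 1 < F.level) :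
    Hypersimplex m where
  free := F.free.erase i
  lo := Function.update F.lo i (F.lo i + 1)
  level := F.level - 1
  level_pos := by omega
  level_lt := by rw [Finset.card_erase_of_mem hi]; have := F.level_lt; omega
  sum_eq := by rw [sum_update_succ]; have := F.sum_eq; omega

theorem facetMin_isFacet (F : Hypersimplex m) (i : Fin 4) (hi : i ∈ F.free)
    (h : F.level + 1 < F.free.card) : (F.facetMin i hi h).IsFacet F :=
  ⟨i, hi, rfl, fun _ _ => rfl, Or.inl rfl⟩

theorem facetMax_isFacet (F : Hypersimplex m) (i : Fin 4) (hi : i ∈ F.free) (h : 1 < F.level) :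
    (F.facetMax i hi h).IsFacet F :=
  ⟨i, hi, rfl, fun _ hj => Function.update_of_ne hj _ _, Or.inr (Function.update_self ..)⟩

/-- The level is determined by the lower bounds through the fixed total `m`. -/
theorem facet_cases {F G : Hypersimplex m} {i : Fin 4} (hj : ∀ j ≠ i, G.lo j = F.lo j)
    (h : G.lo i = F.lo i ∨ G.lo i = F.lo i + 1) :
    (G.lo = F.lo ∧ G.level = F.level) ∨ (G.lo i = F.lo i + 1 ∧ G.level + 1 = F.level) := by
  have h1 := F.sum_eq
  have h2 := G.sum_eq
  rcases h with h | h
  · have : G.lo = F.lo := by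
      ext j
      by_cases hji : j = i
      · rw [hji, h]
      · exact hj j hji
    rw [this] at h2
    exact Or.inl ⟨this, by omega⟩
  · have : G.lo = Function.update F.lo i (F.lo i + 1) := by
      ext j
      by_cases hji : j = i
      · subst hji; rw [h, Function.update_self]
      · rw [hj j hji, Function.update_of_ne hji]
    rw [this, sum_update_succ] at h2
    exact Or.inr ⟨h, by omega⟩

theorem center_sub (F : Hypersimplex m) {i : Fin 4} (hi : i ∈ F.free) :
    F.center i - F.lo i = (F.level : ℝ) / F.free.card := by simp [center, hi]

theorem card_free_pos (F : Hypersimplex m) : (0 : ℝ) < F.free.card := by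
  exact_mod_cast (Nat.zero_le _).trans_lt F.level_lt

theorem center_mem (F : Hypersimplex m) : F.center ∈ F.carrier := by
  have hc := F.card_free_pos
  refine ⟨fun i hi => ?_, fun i hi => by simp [center, hi], ?_⟩
  · have h := F.center_sub hi
    have h1 : (F.level : ℝ) / F.free.card ≤ 1 := by
      rw [div_le_one hc]; exact_mod_cast F.level_lt.le
    have h2 : 0 ≤ (F.level : ℝ) / F.free.card := by positivity
    constructor <;> linarith
  · have := F.sum_eq
    simp only [center, Finset.sum_add_distrib, Finset.sum_ite_mem, Finset.univ_inter,
      Finset.sum_const, nsmul_eq_mul, mul_div_cancel₀ _ hc.ne']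
    exact_mod_cast this

theorem center_ambiguous (F : Hypersimplex m) : F.Ambiguous F.center := by
  refine ⟨(F.level : ℝ) / F.free.card, ?_, ?_⟩
  · rw [Finset.filter_false_of_mem, Finset.card_empty]
    · exact F.level_pos
    · intro i hi; rw [F.center_sub hi]; exact lt_irrefl _
  · rw [Finset.filter_true_of_mem]
    · exact F.level_lt
    · intro i hi; rw [F.center_sub hi]

theorem convex_carrier (F : Hypersimplex m) : Convex ℝ F.carrier := by
  rintro x ⟨hx1, hx2, hx3⟩ y ⟨hy1, hy2, hy3⟩ a b ha hb hab
  refine ⟨fun i hi => ?_, fun i hi => ?_, ?_⟩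
  · have := hx1 i hi
    have := hy1 i hi
    simp only [Pi.add_apply, Pi.smul_apply, smul_eq_mul]
    constructor <;> nlinarith
  · simp only [Pi.add_apply, Pi.smul_apply, smul_eq_mul, hx2 i hi, hy2 i hi]
    rw [← add_mul, hab, one_mul]
  · simp only [Pi.add_apply, Pi.smul_apply, smul_eq_mul, Finset.sum_add_distrib, ← Finset.mul_sum,
      hx3, hy3]
    rw [← add_mul, hab, one_mul]

theorem IsFacet.carrier_subset {F G : Hypersimplex m} (h : G.IsFacet F) :
    G.carrier ⊆ F.carrier := by
  obtain ⟨i, hi, hfree, hlo, hloi⟩ := h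
  rintro y ⟨h1, h2, h3⟩
  refine ⟨fun j hj => ?_, fun j hj => ?_, h3⟩
  · by_cases hji : j = i
    · subst hji
      rw [h2 j (by simp [hfree])]
      rcases hloi with e | e <;> rw [e] <;> constructor <;> push_cast <;> linarith
    · rw [← hlo j hji]; exact h1 j (by simp [hfree, hji, hj])
  · have hji : j ≠ i := by rintro rfl; exact hj hi
    rw [← hlo j hji]; exact h2 j (by simp [hfree, hj])

/-- Along the segment from the center to `y` all free coordinates undergo one increasing affine map,
so a threshold for `y` is carried to one for `x`. The coordinate frozen by the facet has relative
value `0` or `1`; its contribution to the two counts matches the change of level. -/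
theorem InSingular.mem_and_ambiguous {F : Hypersimplex m} {x : Fin 4 → ℝ} (h : InSingular F x) :
    x ∈ F.carrier ∧ F.Ambiguous x := by
  induction h with
  | segment F h => exact ⟨F.center_mem, F.center_ambiguous⟩
  | cone F G y x hG hy hx ih =>
    obtain ⟨ihc, θ, ih1, ih2⟩ := ih
    refine ⟨F.convex_carrier.segment_subset F.center_mem (hG.carrier_subset ihc) hx, ?_⟩
    obtain ⟨a, b, ha, hb, hab, rfl⟩ := hx
    rcases hb.eq_or_lt with rfl | hb
    · rw [add_zero] at hab
      subst hab
      simpa using F.center_ambiguous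
    obtain ⟨i, hi, hfree, hlo, hloi⟩ := hG
    obtain ⟨hy1, hy2, hy3⟩ := ihc
    set c := (F.level : ℝ) / F.free.card
    have hval : ∀ j ∈ F.free, (a • F.center + b • y) j - F.lo j = a * c + b * (y j - F.lo j) := by
      intro j hj
      have : F.center j = F.lo j + c := by linarith [F.center_sub hj]
      simp only [Pi.add_apply, Pi.smul_apply, smul_eq_mul, this]
      linear_combination (F.lo j : ℝ) * hab
    have e1 : ∀ j ∈ F.free, (a * c + b * θ < (a • F.center + b • y) j - F.lo j ↔
        θ < y j - F.lo j) := fun j hj => by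
      rw [hval j hj, add_lt_add_iff_left, mul_lt_mul_iff_right₀ hb]
    have e2 : ∀ j ∈ F.free, (a * c + b * θ ≤ (a • F.center + b • y) j - F.lo j ↔
        θ ≤ y j - F.lo j) := fun j hj => by
      rw [hval j hj, add_le_add_iff_left, mul_le_mul_iff_right₀ hb]
    refine ⟨a * c + b * θ, ?_⟩
    rw [Finset.filter_congr e1, Finset.filter_congr e2, card_filter_eq_erase hi,
      card_filter_eq_erase hi]
    have g1 : ∀ j ∈ F.free.erase i, (θ < y j - G.lo j ↔ θ < y j - F.lo j) := fun j hj => by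
      rw [hlo j (Finset.ne_of_mem_erase hj)]
    have g2 : ∀ j ∈ F.free.erase i, (θ ≤ y j - G.lo j ↔ θ ≤ y j - F.lo j) := fun j hj => by
      rw [hlo j (Finset.ne_of_mem_erase hj)]
    have hyi : y i = G.lo i := hy2 i (by simp [hfree])
    have hlt := G.level_lt
    rw [hfree] at ih1 ih2 hlt hy1
    rw [Finset.filter_congr g1] at ih1
    rw [Finset.filter_congr g2] at ih2
    rcases facet_cases hlo hloi with ⟨hl, hlev⟩ | ⟨hl, hlev⟩
    · rw [hlev] at ih1 ih2 hlt
      rw [if_neg]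
      · exact ⟨by omega, by omega⟩
      · rw [hyi, hl, sub_self]
        intro hθ
        rw [Finset.filter_true_of_mem] at ih1
        · omega
        · intro j hj
          have := (hy1 j hj).1
          rw [hl] at this
          linarith
    · have : y i - F.lo i = 1 := by rw [hyi, hl]; push_cast; ring
      rw [this]
      rw [if_pos (c := θ ≤ 1)]
      · refine ⟨?_, by omega⟩
        split_ifs <;> omega
      · by_contra! hθ
        rw [Finset.filter_false_of_mem] at ih2
        · simp at ih2
        · intro j hj
          have := (hy1 j hj).2
          rw [hlo j (Finset.ne_of_mem_erase hj)] at this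
          intro; linarith

theorem inSingular_center (F : Hypersimplex m) : InSingular F F.center := by
  induction hn : F.free.card generalizing F with
  | zero => have := F.level_lt; omega
  | succ n ih =>
    have h1 := F.level_lt
    have h2 := F.level_pos
    obtain ⟨i, hi⟩ : F.free.Nonempty := Finset.card_pos.mp (by omega)
    by_cases h : F.free.card = 2
    · exact .segment F h
    by_cases hl : F.level + 1 < F.free.card
    · refine .cone F _ _ _ (F.facetMin_isFacet i hi hl) (ih _ ?_) (left_mem_segment ..)
      simp [facetMin, Finset.card_erase_of_mem hi, hn]
    · refine .cone F _ _ _ (F.facetMax_isFacet i hi (by omega)) (ih _ ?_) (left_mem_segment ..)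
      simp [facetMax, Finset.card_erase_of_mem hi, hn]

theorem sum_free_sub (F : Hypersimplex m) {x : Fin 4 → ℝ} (hx : x ∈ F.carrier) :
    ∑ i ∈ F.free, (x i - F.lo i) = F.level := by
  have h1 : ∑ i ∈ F.free, (x i - F.lo i) = ∑ i, (x i - F.lo i) :=
    Finset.sum_subset (Finset.subset_univ _) fun i _ hi => by rw [hx.2.1 i hi, sub_self]
  have h2 : ((∑ i, F.lo i + F.level : ℕ) : ℝ) = m := by rw [F.sum_eq]
  push_cast at h2
  rw [h1, Finset.sum_sub_distrib, hx.2.2]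
  linarith

/-- If `θ ≤ 0`, each relative coordinate is at most the indicator of exceeding `θ`; the sum of the
coordinates is the level, so at least that many exceed `θ`. The bound `θ < 1` below is symmetric. -/
theorem Ambiguous.pos {F : Hypersimplex m} {x : Fin 4 → ℝ} (hx : x ∈ F.carrier) {θ : ℝ}
    (h : (F.free.filter fun i => θ < x i - F.lo i).card < F.level) : 0 < θ := by
  by_contra! H
  have h1 : (F.level : ℝ) ≤ (F.free.filter fun i => θ < x i - F.lo i).card := by
    rw [← F.sum_free_sub hx, Finset.card_filter]
    push_cast
    refine Finset.sum_le_sum fun i hi => ?_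
    split_ifs with hθ
    · linarith [(hx.1 i hi).2]
    · linarith
  exact absurd h (not_lt.mpr (by exact_mod_cast h1))

theorem Ambiguous.lt_one {F : Hypersimplex m} {x : Fin 4 → ℝ} (hx : x ∈ F.carrier) {θ : ℝ}
    (h : F.level < (F.free.filter fun i => θ ≤ x i - F.lo i).card) : θ < 1 := by
  by_contra! H
  have h1 : ((F.free.filter fun i => θ ≤ x i - F.lo i).card : ℝ) ≤ F.level := by
    rw [← F.sum_free_sub hx, Finset.card_filter]
    push_cast
    refine Finset.sum_le_sum fun i hi => ?_
    split_ifs with hθ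
    · linarith
    · linarith [(hx.1 i hi).1]
  exact absurd h (not_lt.mpr (by exact_mod_cast h1))

/-- An ambiguous point on the boundary is ambiguous in a facet. -/
theorem Ambiguous.exists_facet {F : Hypersimplex m} {y : Fin 4 → ℝ} (hy : y ∈ F.carrier)
    (h : F.Ambiguous y) {i : Fin 4} (hi : i ∈ F.free)
    (hyi : y i - F.lo i = 0 ∨ y i - F.lo i = 1) :
    ∃ G : Hypersimplex m, G.IsFacet F ∧ G.free = F.free.erase i ∧ y ∈ G.carrier ∧
      G.Ambiguous y := by
  obtain ⟨θ, h1, h2⟩ := h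
  have hpos := Ambiguous.pos hy h1
  have hone := Ambiguous.lt_one hy h2
  have hle := Finset.card_filter_le (F.free.erase i) fun j => θ ≤ y j - F.lo j
  rw [Finset.card_erase_of_mem hi] at hle
  have hcard := Finset.card_pos.mpr ⟨i, hi⟩
  rw [card_filter_eq_erase hi] at h1 h2
  rcases hyi with e | e
  · rw [e, if_neg (by linarith)] at h1 h2
    have hl : F.level + 1 < F.free.card := by omega
    refine ⟨_, F.facetMin_isFacet i hi hl, rfl, ⟨fun j hj => ?_, fun j hj => ?_, hy.2.2⟩,
      θ, h1, h2⟩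
    · exact hy.1 j (Finset.mem_of_mem_erase hj)
    · by_cases hji : j = i
      · subst hji; simp only [facetMin]; linarith
      · exact hy.2.1 j fun hj' => hj (Finset.mem_erase.mpr ⟨hji, hj'⟩)
  · rw [e, if_pos (by linarith)] at h1 h2
    have hl : 1 < F.level := by omega
    have hlo : ∀ j ≠ i, (F.facetMax i hi hl).lo j = F.lo j := fun j hj =>
      Function.update_of_ne hj _ _
    have hloi : (F.facetMax i hi hl).lo i = F.lo i + 1 := Function.update_self ..
    refine ⟨_, F.facetMax_isFacet i hi hl, rfl, ⟨fun j hj => ?_, fun j hj => ?_, hy.2.2⟩,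
      θ, ?_, ?_⟩
    · rw [hlo j (Finset.ne_of_mem_erase hj)]
      exact hy.1 j (Finset.mem_of_mem_erase hj)
    · by_cases hji : j = i
      · subst hji; rw [hloi]; push_cast; linarith
      · rw [hlo j hji]; exact hy.2.1 j fun hj' => hj (Finset.mem_erase.mpr ⟨hji, hj'⟩)
    · rw [Finset.filter_congr (q := fun j => θ < y j - F.lo j)]
      · simp only [facetMax]; omega
      · intro j hj; rw [hlo j (Finset.ne_of_mem_erase hj)]
    · rw [Finset.filter_congr (q := fun j => θ ≤ y j - F.lo j)]
      · simp only [facetMax]; omega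
      · intro j hj; rw [hlo j (Finset.ne_of_mem_erase hj)]

/-- Projecting a point of a hypersimplex to the boundary from the center. -/
theorem exists_boundary (F : Hypersimplex m) {x : Fin 4 → ℝ} (hx : x ∈ F.carrier)
    (hc : x ≠ F.center) : ∃ r : ℝ, 0 < r ∧ r ≤ 1 ∧ ∃ y ∈ F.carrier,
      (∀ j, x j = (1 - r) * F.center j + r * y j) ∧
      ∃ i ∈ F.free, y i - F.lo i = 0 ∨ y i - F.lo i = 1 := by
  set h := (F.level : ℝ) / F.free.card with hh
  have h0 : 0 < h := div_pos (by exact_mod_cast F.level_pos) F.card_free_pos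
  have h1 : h < 1 := by rw [hh, div_lt_one F.card_free_pos]; exact_mod_cast F.level_lt
  -- `R i` is the deviation of the coordinate `i` from the center, as a fraction of the room there
  -- is in that direction. The coordinate with the largest fraction is the first to reach the
  -- boundary, and that fraction is `r`.
  let R : Fin 4 → ℝ := fun i => max ((h - (x i - F.lo i)) / h) (((x i - F.lo i) - h) / (1 - h))
  have hne : F.free.Nonempty := Finset.card_pos.mp ((Nat.zero_le _).trans_lt F.level_lt)
  obtain ⟨i, hi, hmax⟩ := F.free.exists_max_image R hne
  have hcen : ∀ j ∈ F.free, F.center j = F.lo j + h := fun j hj => by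
    linarith [F.center_sub hj]
  have hR1 : R i ≤ 1 := by
    have := hx.1 i hi
    refine max_le ?_ ?_
    · rw [div_le_one h0]; linarith
    · rw [div_le_one (by linarith)]; linarith
  have hR0 : 0 < R i := by
    obtain ⟨j, hj⟩ := Function.ne_iff.mp hc
    have hjf : j ∈ F.free := by
      by_contra hjf
      exact hj (by rw [hx.2.1 j hjf, F.center_mem.2.1 j hjf])
    refine lt_of_lt_of_le ?_ (hmax j hjf)
    rw [hcen j hjf] at hj
    rcases lt_or_gt_of_ne hj with hj | hj
    · exact lt_max_of_lt_left (div_pos (by linarith) h0)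
    · exact lt_max_of_lt_right (div_pos (by linarith) (by linarith))
  have hy : ∀ j ∈ F.free, ∀ y : ℝ, x j = (1 - R i) * F.center j + R i * y →
      R i * (y - F.lo j) = R i * h + ((x j - F.lo j) - h) := by
    intro j hj y e
    rw [hcen j hj] at e
    rw [e]; ring
  refine ⟨R i, hR0, hR1, fun j => F.center j + (x j - F.center j) / R i, ⟨fun j hj => ?_,
    fun j hj => ?_, ?_⟩, fun j => by field_simp; ring, i, hi, ?_⟩
  · have e := hy j hj (F.center j + (x j - F.center j) / R i) (by field_simp; ring)
    set y := F.center j + (x j - F.center j) / R i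
    have b1 : (h - (x j - F.lo j)) / h ≤ R i := (le_max_left _ _).trans (hmax j hj)
    have b2 : ((x j - F.lo j) - h) / (1 - h) ≤ R i := (le_max_right _ _).trans (hmax j hj)
    rw [div_le_iff₀ h0] at b1
    rw [div_le_iff₀ (by linarith)] at b2
    constructor
    · have : 0 ≤ R i * (y - F.lo j) := by rw [e]; linarith
      linarith [nonneg_of_mul_nonneg_right this hR0]
    · have : R i * (y - F.lo j) ≤ R i * 1 := by rw [e]; linarith
      linarith [le_of_mul_le_mul_left this hR0]
  · simp only [hx.2.1 j hj, F.center_mem.2.1 j hj, sub_self, zero_div, add_zero]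
  · rw [Finset.sum_add_distrib, ← Finset.sum_div, Finset.sum_sub_distrib, hx.2.2, F.center_mem.2.2]
    simp
  · have e := hy i hi (F.center i + (x i - F.center i) / R i) (by field_simp; ring)
    set y := F.center i + (x i - F.center i) / R i
    rcases max_choice ((h - (x i - F.lo i)) / h) (((x i - F.lo i) - h) / (1 - h)) with hc | hc
    · left
      have : R i = (h - (x i - F.lo i)) / h := hc
      have : R i * h = h - (x i - F.lo i) := by rw [this]; field_simp
      have : R i * (y - F.lo i) = 0 := by rw [e]; linarith
      exact (mul_eq_zero.mp this).resolve_left hR0.ne'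
    · right
      have : R i = ((x i - F.lo i) - h) / (1 - h) := hc
      have : R i * (1 - h) = (x i - F.lo i) - h := by
        rw [this, div_mul_cancel₀]; linarith
      have : R i * (y - F.lo i) = R i * 1 := by rw [e]; linarith
      exact mul_left_cancel₀ hR0.ne' this

/-- Central projection to the boundary preserves the order of the relative coordinates, hence
ambiguity. The projected point is ambiguous in a facet, so induction on the dimension puts `x` on
the cone. -/
theorem Ambiguous.inSingular {F : Hypersimplex m} {x : Fin 4 → ℝ} (hx : x ∈ F.carrier)
    (h : F.Ambiguous x) : InSingular F x := by
  induction hn : F.free.card generalizing F x with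
  | zero => have := F.level_lt; omega
  | succ n ih =>
    by_cases hc : x = F.center
    · rw [hc]; exact F.inSingular_center
    obtain ⟨r, hr0, hr1, y, hy, hxy, i, hi, hyi⟩ := F.exists_boundary hx hc
    have hamb : F.Ambiguous y := by
      obtain ⟨θ, h1, h2⟩ := h
      set h := (F.level : ℝ) / F.free.card
      have hval : ∀ j ∈ F.free, x j - F.lo j = (1 - r) * h + r * (y j - F.lo j) := fun j hj => by
        have : F.center j = F.lo j + h := by linarith [F.center_sub hj]
        rw [hxy, this]; ring
      have hθ : θ = (1 - r) * h + r * ((θ - (1 - r) * h) / r) := by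
        rw [mul_div_cancel₀ _ hr0.ne']; ring
      refine ⟨(θ - (1 - r) * h) / r, ?_, ?_⟩
      · convert! h1 using 2
        refine Finset.filter_congr fun j hj => ?_
        rw [hval j hj, hθ, add_lt_add_iff_left, mul_lt_mul_iff_right₀ hr0, ← hθ]
      · convert! h2 using 2
        refine Finset.filter_congr fun j hj => ?_
        rw [hval j hj, hθ, add_le_add_iff_left, mul_le_mul_iff_right₀ hr0, ← hθ]
    obtain ⟨G, hG, hfree, hyG, hGa⟩ := hamb.exists_facet hy hi hyi
    refine .cone F G y x hG (ih hyG hGa (by rw [hfree, Finset.card_erase_of_mem hi, hn]; rfl))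
      ⟨1 - r, r, by linarith, hr0.le, by ring, ?_⟩
    ext j
    simp [hxy j]

/-- The chambers are cut out by the comparison of the coordinates that are large for the vertex with
those that are small. -/
theorem chamber_eq (F : Hypersimplex m) (hF : F.free = Finset.univ) {v : Fin 4 → ℕ}
    (hv : (fun j => (v j : ℝ)) ∈ F.carrier) :
    F.chamber v = {x ∈ F.carrier | ∀ i j, v i = F.lo i + 1 → v j = F.lo j →
      x j - F.lo j ≤ x i - F.lo i} := by
  have hlo : ∀ i, v i = F.lo i ∨ v i = F.lo i + 1 := fun i => by
    obtain ⟨h1, h2⟩ := hv.1 i (by simp [hF])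
    dsimp only at h1 h2
    have h1 : F.lo i ≤ v i := by exact_mod_cast h1
    have h2 : v i ≤ F.lo i + 1 := by exact_mod_cast h2
    omega
  have hcard : (Finset.univ.filter fun i => v i = F.lo i + 1).card = F.level := by
    have := F.sum_free_sub hv
    rw [hF] at this
    rw [Finset.card_filter]
    have : (((∑ i, if v i = F.lo i + 1 then 1 else 0 : ℕ)) : ℝ) = F.level := by
      rw [← this]
      push_cast
      refine Finset.sum_congr rfl fun i _ => ?_
      rcases hlo i with h | h <;> simp [h]
    exact_mod_cast this
  set O : Set (Fin 4 → ℝ) := {x | ∀ i j, v i = F.lo i + 1 → v j = F.lo j →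
    x j - F.lo j < x i - F.lo i} with hO
  set C : Set (Fin 4 → ℝ) := {x | ∀ i j, v i = F.lo i + 1 → v j = F.lo j →
    x j - F.lo j ≤ x i - F.lo i} with hC
  have hOo : IsOpen O := by
    simp only [hO, ofPred_forall]
    exact isOpen_iInter_of_finite fun i => isOpen_iInter_of_finite fun j =>
      isOpen_iInter_of_finite fun _ => isOpen_iInter_of_finite fun _ =>
        isOpen_lt (by fun_prop) (by fun_prop)
  have hCc : IsClosed C := by
    simp only [hC, ofPred_forall]
    exact isClosed_iInter fun i => isClosed_iInter fun j =>
      isClosed_iInter fun _ => isClosed_iInter fun _ => isClosed_le (by fun_prop) (by fun_prop)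
  have hOC : O ⊆ C := fun x hx i j hi hj => (hx i j hi hj).le
  have hmix : ∀ x ∈ C, ∀ y ∈ O, ∀ a b : ℝ, 0 ≤ a → 0 < b →
      a + b = 1 → a • x + b • y ∈ O := by
    intro x hx y hy a b ha hb hab i j hi hj
    have h1 := hx i j hi hj
    have h2 := hy i j hi hj
    simp only [Pi.add_apply, Pi.smul_apply, smul_eq_mul]
    have e : ∀ n, a * x n + b * y n - F.lo n = a * (x n - F.lo n) + b * (y n - F.lo n) := fun n => by
      linear_combination (F.lo n : ℝ) * hab
    rw [e, e]
    nlinarith [mul_le_mul_of_nonneg_left h1 ha, mul_lt_mul_of_pos_left h2 hb]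
  have hvO : (fun j => (v j : ℝ)) ∈ O := fun i j hi hj => by
    dsimp only; rw [hi, hj]; push_cast; linarith
  have hsub : F.carrier ∩ O ⊆ F.carrier \ {x | F.InSingular x} := by
    rintro x ⟨hx, hxO⟩
    refine ⟨hx, fun hs => ?_⟩
    obtain ⟨-, θ, h1, h2⟩ := InSingular.mem_and_ambiguous hs
    rw [hF] at h1 h2
    -- Either all coordinates large for `v` exceed the threshold, and then at least `level` of them
    -- do; or one does not, and then every small coordinate is strictly below the threshold, so at
    -- most `level` coordinates reach it.
    by_cases H : ∀ i, v i = F.lo i + 1 → θ < x i - F.lo i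
    · rw [← hcard] at h1
      exact absurd (Finset.card_le_card fun i hi => by simpa using H i (by simpa using hi))
        (not_le.mpr h1)
    · push Not at H
      obtain ⟨i, hi, hiθ⟩ := H
      rw [← hcard] at h2
      refine absurd (Finset.card_le_card fun j hj => ?_) (not_le.mpr h2)
      simp only [Finset.mem_filter, Finset.mem_univ, true_and] at hj ⊢
      refine (hlo j).resolve_left fun hj' => ?_
      linarith [hxO i j hi hj']
  have hcomp : connectedComponentIn (F.carrier \ {x | F.InSingular x}) (fun j => (v j : ℝ)) =
      F.carrier ∩ O := by
    apply Subset.antisymm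
    · refine subset_inter ((connectedComponentIn_subset _ _).trans sdiff_subset) ?_
      -- `O` and the complement of `C` are disjoint open sets. A point of `F` in neither has a large
      -- and a small coordinate that are equal while all comparisons hold weakly; their common value
      -- is then an ambiguous threshold, so the point is singular.
      refine isPreconnected_connectedComponentIn.subset_left_of_subset_union hOo hCc.isOpen_compl
        (disjoint_left.mpr fun x hx hx' => hx' (hOC hx)) ?_
        ⟨_, mem_connectedComponentIn (hsub ⟨hv, hvO⟩), hvO⟩
      refine (connectedComponentIn_subset _ _).trans ?_
      rintro x ⟨hx, hxs⟩
      by_contra H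
      simp only [mem_union, mem_compl_iff, not_or, not_not] at H
      obtain ⟨H1, H2⟩ := H
      simp only [hO, mem_ofPred_eq, not_forall, not_lt] at H1
      obtain ⟨i, j, hi, hj, hij⟩ := H1
      have hij : x i - F.lo i = x j - F.lo j := le_antisymm hij (H2 i j hi hj)
      refine hxs (Ambiguous.inSingular hx ⟨x i - F.lo i, ?_, ?_⟩) <;> rw [← hcard, hF]
      · refine Finset.card_lt_card ⟨fun n hn => ?_, fun hn => ?_⟩
        · simp only [Finset.mem_filter, Finset.mem_univ, true_and] at hn ⊢
          exact (hlo n).resolve_left fun hn' => by linarith [H2 i n hi hn']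
        · have := @hn i (by simpa using hi)
          simp at this
      · refine Finset.card_lt_card ⟨fun n hn => ?_, fun hn => ?_⟩
        · simp only [Finset.mem_filter, Finset.mem_univ, true_and] at hn ⊢
          rw [hij]; exact H2 n j hn hj
        · have := @hn j (by simpa using hij.le)
          simp [hj] at this
    · refine IsPreconnected.subset_connectedComponentIn ?_ ⟨hv, hvO⟩ hsub
      refine (F.convex_carrier.inter ?_).isPreconnected
      intro x hx y hy a b ha hb hab
      rcases hb.eq_or_lt with rfl | hb
      · rw [add_zero] at hab; subst hab; simpa using hx
      · exact hmix x (hOC hx) y hy a b ha hb hab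
  have hcar : IsClosed F.carrier := by
    have : F.carrier = {x : Fin 4 → ℝ | (∀ i, (F.lo i : ℝ) ≤ x i ∧ x i ≤ F.lo i + 1) ∧ ∑ i, x i = m} := by
      ext x; simp [carrier, hF]
    rw [this]
    simp only [ofPred_and, ofPred_forall]
    exact (isClosed_iInter fun i => (isClosed_le (by fun_prop) (by fun_prop)).inter
      (isClosed_le (by fun_prop) (by fun_prop))).inter (isClosed_eq (by fun_prop) (by fun_prop))
  rw [chamber, hcomp]
  apply Subset.antisymm
  · exact closure_minimal (inter_subset_inter_right _ hOC) (hcar.inter hCc)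
  · rintro x ⟨hx, hxC⟩
    -- Weak inequalities at `x` become strict on the way to `v`, so `x` is a limit of points of the
    -- component.
    have : openSegment ℝ x (fun j => (v j : ℝ)) ⊆ F.carrier ∩ O := by
      rintro y hy
      refine ⟨F.convex_carrier.openSegment_subset hx hv hy, ?_⟩
      obtain ⟨a, b, ha, hb, hab, rfl⟩ := hy
      exact hmix x hxC _ hvO a b ha.le hb hab
    exact closure_mono this (segment_subset_closure_openSegment (left_mem_segment ..))

end Hypersimplex

/-! ### Zig-zag domains, rectangles and black edges in terms of roundings -/

section

variable {m : ℕ} {x : Fin 4 → ℝ}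

theorem Hypersimplex.inSimplex (F : Hypersimplex m) (hx : x ∈ F.carrier) : InSimplex m x := by
  refine ⟨fun i => ?_, hx.2.2⟩
  have : (0 : ℝ) ≤ F.lo i := Nat.cast_nonneg _
  by_cases hi : i ∈ F.free
  · exact this.trans (hx.1 i hi).1
  · rw [hx.2.1 i hi]; exact this

/-- Relative coordinates lie in `[0, 1]`, so the Voronoi inequality for `(i, j)` is automatic unless
`i` is rounded up and `j` down, when it is the comparison defining the chamber. -/
theorem Hypersimplex.mem_chamber_iff (F : Hypersimplex m) (hF : F.free = Finset.univ)
    {v : Fin 4 → ℕ} (hv : (fun j => (v j : ℝ)) ∈ F.carrier) :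
    x ∈ F.chamber v ↔ x ∈ F.carrier ∧ IsRounding m x v := by
  rw [F.chamber_eq hF hv]
  have hlo : ∀ i, v i = F.lo i ∨ v i = F.lo i + 1 := fun i => by
    obtain ⟨h1, h2⟩ := hv.1 i (by simp [hF])
    dsimp only at h1 h2
    have h1 : F.lo i ≤ v i := by exact_mod_cast h1
    have h2 : v i ≤ F.lo i + 1 := by exact_mod_cast h2
    omega
  refine and_congr_right fun hx => ⟨fun h => ⟨?_, fun i j => ?_⟩,
    fun h i j hi hj => ?_⟩
  · have := hv.2.2
    dsimp only at this
    exact_mod_cast this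
  · have hi := hx.1 i (by simp [hF])
    have hj := hx.1 j (by simp [hF])
    rcases hlo i with ei | ei <;> rcases hlo j with ej | ej
    · rw [ei, ej]; linarith
    · rw [ei, ej]; push_cast; linarith
    · have := h i j ei ej
      rw [ei, ej]; push_cast; linarith
    · rw [ei, ej]; push_cast; linarith
  · have := h.2 i j
    rw [hi, hj] at this; push_cast at this; linarith

theorem IsRounding.exists_hypersimplex {v : Fin 4 → ℕ} (hm : 0 < m) (hx : InSimplex m x)
    (hv : IsRounding m x v) : ∃ F : Hypersimplex m, F.free = Finset.univ ∧ x ∈ F.carrier ∧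
      (fun j => (v j : ℝ)) ∈ F.carrier ∧ (∀ n, (v n : ℝ) < x n → F.lo n = v n) ∧
      ∀ n, x n < v n → F.lo n + 1 = v n := by
  obtain ⟨n₀, hn₀⟩ : ∃ n, 0 < v n := by
    by_contra! H
    have : ∑ n, v n = 0 := Finset.sum_eq_zero fun n _ => by have := H n; omega
    rw [hv.1] at this; omega
  have hs := hv.sum_sub hx
  -- The coordinates at which `v` is the upper end of the hypersimplex. The index `n₀` is added on
  -- equality only to keep the level positive when `x = v`; with a single such index the level also
  -- stays below four.
  let S : Finset (Fin 4) := Finset.univ.filter fun n => x n < v n ∨ x n = v n ∧ n = n₀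
  have hS : ∀ n, n ∈ S ↔ (x n < v n ∨ x n = v n ∧ n = n₀) := fun n => by simp [S]
  have hS1 : ∀ n ∈ S, 0 < v n := fun n hn => by
    rcases (hS n).mp hn with h | ⟨-, rfl⟩
    · exact_mod_cast (hx.1 n).trans_lt h
    · exact hn₀
  have hne : 0 < S.card := by
    rw [Finset.card_pos]
    by_contra H
    rw [Finset.not_nonempty_iff_eq_empty] at H
    have h0 : ∀ n, 0 ≤ x n - v n := fun n => by
      by_contra! h
      exact absurd ((hS n).mpr (Or.inl (by linarith))) (by simp [H])
    have := (Finset.sum_eq_zero_iff_of_nonneg (fun n _ => h0 n)).mp hs n₀ (Finset.mem_univ _)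
    exact absurd ((hS n₀).mpr (Or.inr ⟨by linarith, rfl⟩)) (by simp [H])
  have hlt : S.card < 4 := by
    refine (Finset.card_lt_iff_ne_univ S).mpr fun H => ?_
    have h0 : ∀ n, x n - v n ≤ 0 := fun n => by
      rcases (hS n).mp (by simp [H]) with h | h <;> linarith
    obtain ⟨n, hn⟩ := exists_ne n₀
    have := (Finset.sum_eq_zero_iff_of_nonpos (fun n _ => h0 n)).mp hs n (Finset.mem_univ _)
    rcases (hS n).mp (by simp [H]) with h | h
    · linarith
    · exact hn h.2
  have hval : ∀ n, v n = (if n ∈ S then v n - 1 else v n) + if n ∈ S then 1 else 0 := fun n => by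
    split_ifs with h
    · have := hS1 n h; omega
    · rfl
  have hd : ∀ n, -1 ≤ x n - v n ∧ x n - v n ≤ 1 := by
    intro n
    constructor
    · by_contra! H
      have := Finset.sum_lt_sum (s := Finset.univ) (f := fun n => x n - v n)
        (g := fun _ => (0 : ℝ)) (fun j _ => by linarith [hv.2 n j])
        ⟨n, Finset.mem_univ _, by linarith⟩
      simp only [Finset.sum_const_zero] at this
      linarith
    · by_contra! H
      have := Finset.sum_lt_sum (s := Finset.univ) (g := fun n => x n - v n)
        (f := fun _ => (0 : ℝ)) (fun j _ => by linarith [hv.2 j n])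
        ⟨n, Finset.mem_univ _, by linarith⟩
      simp only [Finset.sum_const_zero] at this
      linarith
  have hcast : ∀ n ∈ S, ((v n - 1 : ℕ) : ℝ) = v n - 1 := fun n hn => by
    push_cast [Nat.one_le_iff_ne_zero.mpr (hS1 n hn).ne']; ring
  refine ⟨⟨Finset.univ, fun n => if n ∈ S then v n - 1 else v n, S.card, hne, by simpa, ?_⟩, rfl,
    ⟨fun n _ => ?_, by simp, hx.2⟩, ⟨fun n _ => ?_, by simp, by dsimp only; exact_mod_cast hv.1⟩,
    fun n hn => ?_, fun n hn => ?_⟩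
  · rw [← hv.1, Finset.sum_congr rfl fun n _ => hval n, Finset.sum_add_distrib]
    simp
  · dsimp only
    have := hd n
    split_ifs with h
    · rw [hcast n h]
      rcases (hS n).mp h with h | h <;> constructor <;> linarith
    · rw [hS] at h; push Not at h
      constructor <;> linarith [h.1]
  · dsimp only
    split_ifs with h
    · rw [hcast n h]; constructor <;> linarith
    · constructor <;> linarith
  · dsimp only
    rw [if_neg]
    rw [hS]; push Not; exact ⟨hn.le, fun h => absurd h hn.ne'⟩
  · have : n ∈ S := (hS n).mpr (Or.inl hn)
    have := hS1 n this
    dsimp only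
    rw [if_pos ‹n ∈ S›]; omega

theorem mem_zigzagDomain_iff (hm : 0 < m) {i : Fin 4} {k : ℕ} :
    x ∈ zigzagDomain m i k ↔ InSimplex m x ∧ InSheet m x i k := by
  constructor
  · rintro ⟨F, v, hF, hv, hk, hx⟩
    rw [F.mem_chamber_iff hF hv] at hx
    exact ⟨F.inSimplex hx.1, v, hx.2, hk⟩
  · rintro ⟨hx, v, hv, hk⟩
    obtain ⟨F, hF, hxF, hvF, -, -⟩ := hv.exists_hypersimplex hm hx
    exact ⟨F, v, hF, hvF, hk, (F.mem_chamber_iff hF hvF).mpr ⟨hxF, hv⟩⟩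

/-- On a rectangle, opposite Voronoi inequalities for the two adjacent lattice points force equal
heights. Conversely, a tie gives a rounding `v` and its swap `w`; as the tie height lies strictly
between `0` and `1`, a hypersimplex chosen for `x` and `v` also has `w` as a vertex. -/
theorem onRectangle_iff (hm : 0 < m) {i j : Fin 4} {k l : ℕ} (hx : InSimplex m x) :
    OnRectangle m i k j l x ↔ i ≠ j ∧ x i - k = x j - l ∧ Ties m x (x i - k) := by
  constructor
  · rintro ⟨F, v, w, hF, hij, hv, hw, vi, wi, wj, vj, -, hxv, hxw⟩
    rw [F.mem_chamber_iff hF hv] at hxv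
    rw [F.mem_chamber_iff hF hw] at hxw
    have h1 := hxv.2.2 j i
    have h2 := hxw.2.2 i j
    rw [vi, vj] at h1
    rw [wi, wj] at h2
    push_cast at h1 h2
    exact ⟨hij, by linarith, v, hxv.2, ⟨i, by rw [vi]⟩, j, by rw [vj]; push_cast; linarith⟩
  · rintro ⟨hij, he, ht⟩
    obtain ⟨v, hv, vi, vj⟩ := ht.exists_isRounding hx hij he
    have hi : x i - v i = x i - k := by rw [vi]
    have hj : x j - v j = x i - k - 1 := by rw [vj]; push_cast; linarith
    obtain ⟨w, hw, wi, wj, wn⟩ := hv.swap hx hi hj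
    obtain ⟨hpos, hone⟩ := hv.pos_of_tie hx hi hj
    obtain ⟨F, hF, hxF, hvF, hlo, hhi⟩ := hv.exists_hypersimplex hm hx
    have li : F.lo i = v i := hlo i (by linarith)
    have lj : F.lo j + 1 = v j := hhi j (by linarith)
    have hwF : (fun n => (w n : ℝ)) ∈ F.carrier := by
      refine ⟨fun n _ => ?_, by simp [hF], by dsimp only; exact_mod_cast hw.1⟩
      dsimp only
      by_cases hni : n = i
      · subst hni; rw [wi, li]; constructor <;> push_cast <;> linarith
      by_cases hnj : n = j
      · subst hnj
        have : F.lo n = w n := by omega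
        rw [this]; constructor <;> linarith
      rw [wn n hni hnj]; exact hvF.1 n (by simp [hF])
    exact ⟨F, v, w, hF, hij, hvF, hwF, vi, by omega, by omega, vj,
      fun n h h' => (wn n h h').symm, (F.mem_chamber_iff hF hvF).mpr ⟨hxF, hv⟩,
      (F.mem_chamber_iff hF hwF).mpr ⟨hxF, hw⟩⟩

/-- The position, relative to a rounding `v`, of the points of the black edges: from the center of
an octahedron (`a = 1/2`) through that of a `•`-triangle (`a = 2/3`) to that of
a `•`-tetrahedron (`a = 3/4`). -/
def BlackAt (m : ℕ) (x : Fin 4 → ℝ) (a : ℝ) : Prop :=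
  1 / 2 ≤ a ∧ a ≤ 3 / 4 ∧ ∃ v : Fin 4 → ℕ, ∑ n, v n = m ∧ ∃ i n, i ≠ n ∧ x i - v i = a ∧
    x n - v n = 2 - 3 * a ∧ ∀ j, j ≠ i → j ≠ n → x j - v j = a - 1

theorem sum_ite_ne (l : Fin 4 → ℕ) {i n : Fin 4} (h : i ≠ n) (b : ℕ) :
    ∑ j, (if j = i then l j else if j = n then l j + b else l j + 1) = ∑ j, l j + 2 + b := by
  obtain ⟨p, q, h1, h2, h3, h4, h5, hS⟩ := exists_sum_eq_of_ne h
  have e1 := hS fun j => ((if j = i then l j else if j = n then l j + b else l j + 1 : ℕ) : ℝ)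
  have e2 := hS fun j => (l j : ℝ)
  simp only [if_true, h.symm, h1.symm, h2.symm, h3.symm, h4.symm, if_false] at e1
  have : ((∑ j, (if j = i then l j else if j = n then l j + b else l j + 1) : ℕ) : ℝ) =
      ((∑ j, l j + 2 + b : ℕ) : ℝ) := by
    push_cast at e1 e2 ⊢
    linarith
  exact_mod_cast this

theorem sum_sub_ite_ne {l : Fin 4 → ℕ} {i n : Fin 4} (h : i ≠ n) {b : ℕ} (hb : b ≤ l n)
    (hl : ∀ j, j ≠ i → j ≠ n → 1 ≤ l j) :
    ∑ j, (if j = i then l j else if j = n then l j - b else l j - 1) + 2 + b = ∑ j, l j := by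
  rw [← sum_ite_ne _ h b]
  refine Finset.sum_congr rfl fun j _ => ?_
  by_cases h1 : j = i
  · simp [h1]
  by_cases h2 : j = n
  · subst h2; simp [h1, hb]
  · simp [h1, h2, hl j h1 h2]

theorem mem_blackVertex_iff (hx : InSimplex m x) :
    (∃ F : Hypersimplex m, F.free = Finset.univ ∧ F.level = 3 ∧ x = F.center) ↔
      BlackAt m x (3 / 4) := by
  constructor
  · rintro ⟨F, hF, hl, rfl⟩
    have hc : ∀ n, F.center n = F.lo n + 3 / 4 := fun n => by simp [Hypersimplex.center, hF, hl]
    -- All relative coordinates are `3/4`, so any three of them may be rounded up. Here the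
    -- coordinate `0` is the one rounded down.
    refine ⟨by norm_num, le_rfl, fun j => if j = 0 then F.lo j else if j = 1 then F.lo j + 1 else
      F.lo j + 1, ?_, 0, 1, by decide, ?_, ?_, fun j h1 h2 => ?_⟩
    · rw [sum_ite_ne _ (by decide)]
      have := F.sum_eq
      omega
    · simp [hc]
    · simp only [hc, if_true, if_neg (show (1 : Fin 4) ≠ 0 by decide)]; push_cast; ring
    · simp only [hc, h1, h2, if_false]; push_cast; ring
  · rintro ⟨-, -, v, hv, i, n, hin, hi, hn, hj⟩
    have h1 : ∀ j, j ≠ i → 1 ≤ v j := fun j hji => by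
      have := hx.1 j
      have : (0 : ℝ) < v j := by
        by_cases hjn : j = n
        · subst hjn; linarith
        · linarith [hj j hji hjn]
      exact_mod_cast this
    have hsum := sum_sub_ite_ne hin (h1 n hin.symm) fun j hj _ => h1 j hj
    refine ⟨⟨Finset.univ, _, 3, by norm_num, by simp, hsum.trans hv⟩, rfl, rfl, ?_⟩
    ext j
    simp only [Hypersimplex.center, Finset.mem_univ, if_true, Finset.card_fin]
    by_cases h : j = i
    · subst h; simp only [if_true]; push_cast; linarith
    by_cases h' : j = n
    · subst h'; simp only [h, if_false, if_true]; push_cast [h1 j h]; linarith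
    · simp only [h, h', if_false]; push_cast [h1 j h]; linarith [hj j h h']

theorem mem_blackEdge_iff (hx : InSimplex m x) :
    (∃ F G : Hypersimplex m, F.free = Finset.univ ∧ G.IsFacet F ∧ G.level = 2 ∧
      x ∈ segment ℝ F.center G.center) ↔ ∃ a, BlackAt m x a := by
  constructor
  · rintro ⟨F, G, hF, ⟨n, hn, hfree, hlo, hlon⟩, hl, s, t, hs, ht, hst, rfl⟩
    have hcard : G.free.card = 3 := by rw [hfree, Finset.card_erase_of_mem hn, hF]; rfl
    have hF4 : F.free.card = 4 := by rw [hF]; rfl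
    have hcj : ∀ j ≠ n, G.center j = F.lo j + 2 / 3 := fun j hj => by
      simp only [Hypersimplex.center, hlo j hj, hl, hcard]
      rw [if_pos]
      · norm_num
      · rw [hfree, hF]; simp [hj]
    have hcn : G.center n = G.lo n := by simp [Hypersimplex.center, hfree]
    have hcF : ∀ j, F.center j = F.lo j + (F.level : ℝ) / 4 := fun j => by
      simp only [Hypersimplex.center, hF4]; rw [if_pos (by simp [hF])]; norm_num
    -- The facet freezes the coordinate `n`; the other three are equal along the segment, so the one
    -- to round down can be chosen at will.
    obtain ⟨i, hi⟩ := exists_ne n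
    have hs' : s = 1 - t := by linarith
    have ht1 : t ≤ 1 := by linarith
    have hsum := F.sum_eq
    rcases Hypersimplex.facet_cases hlo hlon with ⟨e, e'⟩ | ⟨e, e'⟩
    · refine ⟨1 / 2 + t / 6, by linarith, by linarith,
        fun j => if j = i then F.lo j else if j = n then F.lo j + 0 else F.lo j + 1, ?_, i, n, hi,
        ?_, ?_, fun j h1 h2 => ?_⟩
      · rw [sum_ite_ne _ hi]; omega
      · simp only [Pi.add_apply, Pi.smul_apply, smul_eq_mul, hcj i hi, hcF, ← e', hl, if_true]
        push_cast; rw [hs']; ring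
      · simp only [Pi.add_apply, Pi.smul_apply, smul_eq_mul, hcn, e, hcF, ← e', hl, if_true,
          if_neg hi.symm]
        push_cast; rw [hs']; ring
      · simp only [Pi.add_apply, Pi.smul_apply, smul_eq_mul, hcj j h2, hcF, ← e', hl, h1, h2,
          if_false]
        push_cast; rw [hs']; ring
    · refine ⟨3 / 4 - t / 12, by linarith, by linarith,
        fun j => if j = i then F.lo j else if j = n then F.lo j + 1 else F.lo j + 1, ?_, i, n, hi,
        ?_, ?_, fun j h1 h2 => ?_⟩
      · rw [sum_ite_ne _ hi]; omega
      · simp only [Pi.add_apply, Pi.smul_apply, smul_eq_mul, hcj i hi, hcF, ← e', hl, if_true]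
        push_cast; rw [hs']; ring
      · simp only [Pi.add_apply, Pi.smul_apply, smul_eq_mul, hcn, e, hcF, ← e', hl, if_true,
          if_neg hi.symm]
        push_cast; rw [hs']; ring
      · simp only [Pi.add_apply, Pi.smul_apply, smul_eq_mul, hcj j h2, hcF, ← e', hl, h1, h2,
          if_false]
        push_cast; rw [hs']; ring
  · rintro ⟨a, ha1, ha2, v, hv, i, n, hin, hi, hn, hj⟩
    have h1 : ∀ j, j ≠ i → j ≠ n → 1 ≤ v j := fun j hji hjn => by
      have := hx.1 j
      have : (0 : ℝ) < v j := by linarith [hj j hji hjn]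
      exact_mod_cast this
    -- The value `2/3` is the center of the triangle. Below it the point lies in the octahedron,
    -- with the coordinate `n` minimal on the facet; above it in the `•`-tetrahedron, with `n`
    -- maximal. The weights solve `a = (1 - t)/2 + 2t/3` and `a = 3(1 - t)/4 + 2t/3`.
    by_cases ha : a ≤ 2 / 3
    · have hsum := sum_sub_ite_ne hin (Nat.zero_le _) h1
      let F : Hypersimplex m := ⟨Finset.univ, _, 2, by norm_num, by simp, hsum.trans hv⟩
      refine ⟨F, F.facetMin n (Finset.mem_univ _) (by simp [F]), rfl, F.facetMin_isFacet _ _ _, rfl,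
        4 - 6 * a, 6 * a - 3, by linarith, by linarith, by ring, ?_⟩
      ext j
      simp only [Hypersimplex.center, Hypersimplex.facetMin, F, Finset.mem_univ, if_true,
        Finset.card_fin, Finset.card_erase_of_mem, Pi.add_apply, Pi.smul_apply, smul_eq_mul,
        Finset.mem_erase, and_true]
      by_cases h : j = i
      · subst h; simp only [if_true, hin, ne_eq, not_false_eq_true]; push_cast; linarith
      by_cases h' : j = n
      · subst h'; simp only [h, if_false, if_true, ne_eq, not_true_eq_false, Nat.sub_zero]
        push_cast; linarith
      · simp only [h, h', if_false, if_true, ne_eq, not_false_eq_true]; push_cast [h1 j h h']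
        linarith [hj j h h']
    · push Not at ha
      have hn1 : 1 ≤ v n := by
        have := hx.1 n
        have : (0 : ℝ) < v n := by linarith
        exact_mod_cast this
      have hsum := sum_sub_ite_ne hin hn1 h1
      let F : Hypersimplex m := ⟨Finset.univ, _, 3, by norm_num, by simp, hsum.trans hv⟩
      refine ⟨F, F.facetMax n (Finset.mem_univ _) (by simp [F]), rfl, F.facetMax_isFacet _ _ _, rfl,
        12 * a - 8, 9 - 12 * a, by linarith, by linarith, by ring, ?_⟩
      ext j
      simp only [Hypersimplex.center, Hypersimplex.facetMax, F, Finset.mem_univ, if_true,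
        Finset.card_fin, Finset.card_erase_of_mem, Pi.add_apply, Pi.smul_apply, smul_eq_mul,
        Finset.mem_erase, and_true, Function.update_apply]
      by_cases h : j = i
      · subst h; simp only [if_true, hin, ne_eq, not_false_eq_true, if_false]; push_cast; linarith
      by_cases h' : j = n
      · subst h'
        simp only [h, if_false, if_true, ne_eq, not_true_eq_false]; push_cast [hn1]; linarith
      · simp only [h, h', if_false, if_true, ne_eq, not_false_eq_true]; push_cast [h1 j h h']
        linarith [hj j h h']

end

/-! ### Finite closed quotients -/

section

variable {ι E Y Γ : Type*} [Finite ι] [TopologicalSpace E] [TopologicalSpace Y] [Finite Γ]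
  {S : ι → E → Prop} {q : (Σ i, {x // S i x}) → Y} {f : Γ → E → E} {R : ι → ι → Γ → E → Prop}

/-- In each piece, the saturation of a closed set is a finite union, over the target piece and the
gluing map, of the points where the gluing applies and lands in the set. `hR` says that
applicability is a closed condition. -/
theorem isClosedMap_of_gluing (hq : IsQuotientMap q) (hf : ∀ γ, Continuous (f γ))
    (hR : ∀ i x, S i x → ∀ j γ, ∀ᶠ y in 𝓝 x, S i y → R i j γ y → R i j γ x)
    (hS : ∀ i j γ x, S i x → R i j γ x → S j (f γ x))
    (h : ∀ i x j y, q ⟨i, x⟩ = q ⟨j, y⟩ ↔ ∃ γ, R i j γ x ∧ (y : E) = f γ x) :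
    IsClosedMap q := by
  intro C hC
  rw [← hq.isClosed_preimage, isClosed_sigma_iff]
  intro i
  have : Sigma.mk i ⁻¹' (q ⁻¹' (q '' C)) = ⋃ j, ⋃ γ, {x : {x // S i x} | R i j γ x ∧
      ∃ hx, (⟨j, f γ x, hx⟩ : Σ i, {x // S i x}) ∈ C} := by
    ext x
    simp only [mem_preimage, mem_image, mem_iUnion, mem_ofPred_eq]
    constructor
    · rintro ⟨⟨j, y⟩, hy, e⟩
      obtain ⟨γ, hγ, e⟩ := (h _ _ _ _).mp e.symm
      exact ⟨j, γ, hγ, e ▸ y.2, by convert! hy using 3; exact e.symm⟩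
    · rintro ⟨j, γ, hγ, hx, hC⟩
      exact ⟨_, hC, ((h _ _ _ _).mpr ⟨γ, hγ, rfl⟩).symm⟩
  rw [this]
  refine isClosed_iUnion_of_finite fun j => isClosed_iUnion_of_finite fun γ => ?_
  obtain ⟨D, hD, hDC⟩ := isClosed_induced_iff.mp (isClosed_sigma_iff.mp hC j)
  have hmem : ∀ y : {x // S j x}, (y : E) ∈ D ↔ y ∈ Sigma.mk j ⁻¹' C := fun y => by rw [← hDC]; rfl
  rw [← isOpen_compl_iff, isOpen_iff_mem_nhds]
  intro x hx
  by_cases hRx : R i j γ x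
  · have hfx : f γ x ∉ D := fun hfx =>
      hx ⟨hRx, hS _ _ _ _ x.2 hRx, (hmem ⟨f γ x, hS _ _ _ _ x.2 hRx⟩).mp hfx⟩
    have hc : Continuous fun y : {x // S i x} => f γ y := (hf γ).comp continuous_subtype_val
    filter_upwards [hc.continuousAt.preimage_mem_nhds (hD.isOpen_compl.mem_nhds hfx)]
    rintro y hy ⟨-, hs, hyC⟩
    exact hy ((hmem ⟨f γ y, hs⟩).mpr hyC)
  · filter_upwards [(continuous_subtype_val (p := S i)).continuousAt.eventually (hR i x x.2 j γ)]
    rintro y hy ⟨hRy, -⟩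
    exact hRx (hy y.2 hRy)

end

theorem finite_fiber_of_gluing {ι E Y Γ : Type*} [Finite ι] [Finite Γ] {S : ι → E → Prop}
    {q : (Σ i, {x // S i x}) → Y} {f : Γ → E → E} (h : ∀ i x j y, q ⟨i, x⟩ = q ⟨j, y⟩ → ∃ γ, (y : E) = f γ x)
    (z : Y) : (q ⁻¹' {z}).Finite := by
  by_cases hz : ∃ p, q p = z
  · obtain ⟨⟨i, x⟩, rfl⟩ := hz
    refine Finite.of_finite_image (f := fun p : Σ i, {x // S i x} => (p.1, (p.2 : E))) ?_ ?_
    · refine (Set.finite_range fun p : ι × Γ => (p.1, f p.2 (x : E))).subset ?_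
      rintro _ ⟨⟨j, y⟩, hy, rfl⟩
      obtain ⟨γ, e⟩ := h i x j y (Eq.symm hy)
      exact ⟨(j, γ), by simp [e]⟩
    · rintro ⟨j, y⟩ - ⟨j', y'⟩ - e
      simp only [Prod.mk.injEq] at e
      obtain ⟨rfl, e⟩ := e
      rw [Subtype.ext e]
  · convert! Set.finite_empty
    ext p
    simpa using fun e => hz ⟨p, e⟩

/-- Disjoint neighborhoods of two finite fibers exist upstairs; closedness of the map shrinks them
to saturated ones. -/
theorem IsClosedMap.t2Space_of_finite_fibers {X Y : Type*} [TopologicalSpace X]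
    [TopologicalSpace Y] [T2Space X] {f : X → Y} (hf : IsClosedMap f) (_ : Continuous f)
    (hs : Function.Surjective f) (hfin : ∀ y, (f ⁻¹' {y}).Finite) : T2Space Y := by
  refine ⟨fun a b hab => ?_⟩
  have hd : Disjoint (f ⁻¹' {a}) (f ⁻¹' {b}) :=
    disjoint_left.mpr fun x ha hb => hab ((mem_singleton_iff.mp ha).symm.trans hb)
  obtain ⟨U, V, hU, hV, hUa, hVb, hUV⟩ := SeparatedNhds.of_isCompact_isCompact
    (hfin a).isCompact (hfin b).isCompact hd
  refine ⟨(f '' Uᶜ)ᶜ, (f '' Vᶜ)ᶜ, (hf _ hU.isClosed_compl).isOpen_compl,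
    (hf _ hV.isClosed_compl).isOpen_compl, ?_, ?_, ?_⟩
  · rintro ⟨x, hx, rfl⟩; exact hx (hUa rfl)
  · rintro ⟨x, hx, rfl⟩; exact hx (hVb rfl)
  · rw [disjoint_left]
    intro y h1 h2
    obtain ⟨x, rfl⟩ := hs y
    have hxU : x ∈ U := by by_contra h; exact h1 ⟨x, h, rfl⟩
    have hxV : x ∈ V := by by_contra h; exact h2 ⟨x, h, rfl⟩
    exact disjoint_left.mp hUV hxU hxV

/-! ### Chains of face gluings -/

namespace IdealTriangulation

variable (τ : IdealTriangulation.{u}) {m : ℕ}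

instance : Finite τ.Tet := τ.finite

/-- A chain of gluings, starting at the tetrahedron `t` and valid at its point `x`, leads to the
tetrahedron `t'`, the vertices being renamed by `ρ`. -/
inductive Path (t : τ.Tet) (x : Fin 4 → ℝ) : τ.Tet → Equiv.Perm (Fin 4) → Prop
  | refl : Path t x t 1
  | step {t' : τ.Tet} {ρ : Equiv.Perm (Fin 4)} {j : Fin 4} {t'' : τ.Tet} {σ : Equiv.Perm (Fin 4)} :
      Path t x t' ρ → τ.glue t' j = some (t'', σ) → x (ρ.symm j) = 0 → Path t x t'' (σ * ρ)

variable {τ}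

namespace Path

variable {t t' t'' : τ.Tet} {x y : Fin 4 → ℝ} {ρ ρ' : Equiv.Perm (Fin 4)}

/-- Whether a chain is valid depends only on which coordinates vanish, so it can be transported
along deformations that keep those zeros. -/
theorem mono (h : τ.Path t x t' ρ) (hxy : ∀ n, x n = 0 → y n = 0) : τ.Path t y t' ρ := by
  induction h with
  | refl => exact .refl
  | step _ hg hj ih => exact .step ih hg (hxy _ hj)

theorem trans (h : τ.Path t x t' ρ) (h' : τ.Path t' (x ∘ ρ.symm) t'' ρ') :
    τ.Path t x t'' (ρ' * ρ) := by
  induction h' with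
  | refl => rwa [one_mul]
  | step _ hg hj ih => rw [mul_assoc]; exact .step ih hg hj

theorem symm (h : τ.Path t x t' ρ) : τ.Path t' (x ∘ ρ.symm) t ρ.symm := by
  induction h with
  | refl => exact .refl
  | @step t' ρ j t'' σ h hg hj ih =>
    have h1 : τ.Path t'' (x ∘ (σ * ρ).symm) t' (σ⁻¹ * 1) :=
      .step .refl (τ.glue_symm _ _ _ _ hg) (by
        change x (ρ.symm (σ.symm (σ j))) = 0
        rwa [Equiv.symm_apply_apply])
    rw [mul_one] at h1
    have h2 := h1.trans (t'' := t) (ρ' := ρ.symm) (by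
      convert! ih using 1
      ext n
      simp [Equiv.Perm.mul_def, Equiv.Perm.inv_def])
    convert! h2 using 1

theorem support_comp (ρ : Equiv.Perm (Fin 4)) (x : Fin 4 → ℝ) :
    Function.support (x ∘ ρ.symm) = ρ '' Function.support x := by
  ext n
  simp only [Function.mem_support, Function.comp_apply, mem_image]
  constructor
  · intro h; exact ⟨_, h, by simp⟩
  · rintro ⟨k, h, rfl⟩; simpa

theorem mem_iff (h : τ.Path t x t' ρ) :
    τ.mem t (Function.support x) ↔ τ.mem t' (Function.support (x ∘ ρ.symm)) := by
  induction h with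
  | refl => rfl
  | @step t' ρ j t'' σ h hg hj ih =>
    rw [ih, τ.mem_glue _ _ _ _ (Function.support (x ∘ ρ.symm)) hg (by simpa using hj),
      ← support_comp]
    rfl

theorem inTet (h : τ.Path t x t' ρ) (hx : τ.InTet m t x) : τ.InTet m t' (x ∘ ρ.symm) :=
  ⟨fun _ => hx.1 _, (Equiv.sum_comp ρ.symm x).trans hx.2.1, h.mem_iff.mp hx.2.2⟩

theorem of_glueVia {j : Fin 4} {σ : Equiv.Perm (Fin 4)} (h : τ.GlueVia t x j σ t' y) :
    τ.Path t x t' σ ∧ y = x ∘ σ.symm := by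
  refine ⟨by simpa using Path.step .refl h.1 h.2.1, ?_⟩
  ext n
  rw [Function.comp_apply, ← h.2.2, Equiv.apply_symm_apply]

theorem glueVia {j : Fin 4} {σ : Equiv.Perm (Fin 4)}
    (hg : τ.glue t' j = some (t'', σ)) (hj : x (ρ.symm j) = 0) :
    τ.GlueVia t' (x ∘ ρ.symm) j σ t'' (x ∘ (σ * ρ).symm) :=
  ⟨hg, hj, fun i => by simp [Equiv.Perm.mul_def]⟩

end Path

theorem eventually_path (x : Fin 4 → ℝ) : ∀ᶠ y in 𝓝 x, ∀ (t t' : τ.Tet) (ρ : Equiv.Perm (Fin 4)),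
    τ.Path t y t' ρ → τ.Path t x t' ρ := by
  have : ∀ n, ∀ᶠ y in 𝓝 x, y n = 0 → x n = 0 := fun n => by
    by_cases h : x n = 0
    · exact Eventually.of_forall fun _ _ => h
    · have hc : Continuous fun y : Fin 4 → ℝ => y n := continuous_apply n
      filter_upwards [hc.continuousAt.eventually_ne h] with y hy hy'
      exact absurd hy' hy
  filter_upwards [eventually_all.mpr this] with y hy t t' ρ h
  exact h.mono hy

theorem InTet.inSimplex {t : τ.Tet} {x : Fin 4 → ℝ} (h : τ.InTet m t x) : InSimplex m x :=
  ⟨h.1, h.2.1⟩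

/-! #### The threefold -/

theorem toSpace_eq_iff {p p' : τ.Point m} : τ.toSpace m p = τ.toSpace m p' ↔
    ∃ ρ, τ.Path p.1 p.2.1 p'.1 ρ ∧ p'.2.1 = p.2.1 ∘ ρ.symm := by
  constructor
  · intro h
    replace h := Quot.eqvGen_exact h
    induction h with
    | rel p p' h =>
      obtain ⟨j, σ, h⟩ := h
      exact ⟨σ, Path.of_glueVia h⟩
    | refl p => exact ⟨1, .refl, rfl⟩
    | symm p p' _ ih =>
      obtain ⟨ρ, h, e⟩ := ih
      refine ⟨ρ.symm, e ▸ h.symm, ?_⟩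
      rw [e]; ext n; simp
    | trans p p' p'' _ _ ih ih' =>
      obtain ⟨ρ, h, e⟩ := ih
      obtain ⟨ρ', h', e'⟩ := ih'
      rw [e] at h' e'
      exact ⟨ρ' * ρ, h.trans h', e'⟩
  · rintro ⟨ρ, h, e⟩
    obtain ⟨t, x, hx⟩ := p
    obtain ⟨t', x', hx'⟩ := p'
    dsimp only at h e
    subst e
    induction h with
    | refl => rfl
    | step h hg hj ih => exact (ih (h.inTet hx)).trans (Quot.sound ⟨_, _, Path.glueVia hg hj⟩)

theorem continuous_toSpace : Continuous (τ.toSpace m) := continuous_quot_mk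

theorem surjective_toSpace : Function.Surjective (τ.toSpace m) := Quot.mk_surjective

theorem isClosedMap_toSpace : IsClosedMap (τ.toSpace m) :=
  isClosedMap_of_gluing (f := fun (ρ : Equiv.Perm (Fin 4)) (x : Fin 4 → ℝ) => x ∘ ρ.symm)
    (R := fun t t' ρ x => τ.Path t x t' ρ) isQuotientMap_quot_mk (fun ρ => by fun_prop)
    (fun t x _ t' ρ => (eventually_path x).mono fun y hy _ => hy t t' ρ)
    (fun _ _ _ _ hx h => h.inTet hx) fun _ _ _ _ => toSpace_eq_iff

theorem finite_fiber_toSpace (z : τ.Space m) : (τ.toSpace m ⁻¹' {z}).Finite :=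
  finite_fiber_of_gluing (f := fun (ρ : Equiv.Perm (Fin 4)) (x : Fin 4 → ℝ) => x ∘ ρ.symm)
    (fun _ _ _ _ h => (toSpace_eq_iff.mp h).imp fun _ h => h.2) z

instance : T2Space (τ.Space m) :=
  isClosedMap_toSpace.t2Space_of_finite_fibers continuous_toSpace surjective_toSpace
    finite_fiber_toSpace

theorem isProperMap_toSpace : IsProperMap (τ.toSpace m) :=
  isProperMap_iff_isClosedMap_and_compact_fibers.mpr ⟨continuous_toSpace, isClosedMap_toSpace,
    fun z => (finite_fiber_toSpace z).isCompact⟩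

/-- A property holds near a point of the threefold if it holds near its preimages in the
tetrahedra. -/
theorem eventually_space {P : τ.Space m → Prop} {z : τ.Space m}
    (h : ∀ p, τ.toSpace m p = z → ∀ᶠ p' in 𝓝 p, P (τ.toSpace m p')) : ∀ᶠ z' in 𝓝 z, P z' := by
  filter_upwards [isClosedMap_toSpace.eventually_nhds_fiber z fun p hp => h p hp] with z' hz'
  obtain ⟨p, rfl⟩ := surjective_toSpace z'
  exact hz' p rfl

theorem eventually_point_iff {P : τ.Point m → Prop} {t : τ.Tet} {x} :
    (∀ᶠ p in 𝓝 (⟨t, x⟩ : τ.Point m), P p) ↔ ∀ᶠ y in 𝓝 x, P ⟨t, y⟩ := by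
  rw [Sigma.nhds_mk, eventually_map]

/-! #### Monodromy -/

/-- The nonzero coordinate at the corner guarantees that no face crossed by the chain is the one
opposite to the corner, as `CornerStep` requires. -/
theorem cornerEqv_iff {c c' : τ.Corner m} (hc : c.1.2.1 c.2 ≠ 0) : τ.CornerEqv m c c' ↔
    ∃ ρ, τ.Path c.1.1 c.1.2.1 c'.1.1 ρ ∧ c'.1.2.1 = c.1.2.1 ∘ ρ.symm ∧ c'.2 = ρ c.2 := by
  constructor
  · intro h
    have : ∃ ρ, τ.Path c.1.1 c.1.2.1 c'.1.1 ρ ∧ c'.1.2.1 = c.1.2.1 ∘ ρ.symm ∧ c'.2 = ρ c.2 := by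
      clear hc
      induction h with
      | rel c c' h =>
        obtain ⟨j, σ, h, -, e⟩ := h
        exact ⟨σ, (Path.of_glueVia h).1, (Path.of_glueVia h).2, e⟩
      | refl c => exact ⟨1, .refl, rfl, rfl⟩
      | symm c c' _ ih =>
        obtain ⟨ρ, h, e, e'⟩ := ih
        refine ⟨ρ.symm, e ▸ h.symm, ?_, ?_⟩
        · rw [e]; ext n; simp
        · rw [e']; simp
      | trans c c' c'' _ _ ih ih' =>
        obtain ⟨ρ, h, e, f⟩ := ih
        obtain ⟨ρ', h', e', f'⟩ := ih'
        rw [e] at h' e'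
        exact ⟨ρ' * ρ, h.trans h', e', by rw [f', f]; rfl⟩
    exact this
  · rintro ⟨ρ, h, e, e'⟩
    obtain ⟨⟨t, x, hx⟩, i⟩ := c
    obtain ⟨⟨t', x', hx'⟩, i'⟩ := c'
    dsimp only at h e e' hc
    subst e e'
    induction h with
    | refl => exact .refl _
    | @step t' ρ j t'' σ h hg hj ih =>
      refine .trans _ _ _ (ih (h.inTet hx)) (.rel _ _ ⟨_, _, Path.glueVia hg hj, ?_, rfl⟩)
      rintro rfl
      simp [hc] at hj

theorem Path.fixed {t : τ.Tet} {x : Fin 4 → ℝ} {ρ : Equiv.Perm (Fin 4)}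
    (h : τ.Path t x t ρ) (hx : τ.InTet m t x) (he : x ∘ ρ.symm = x) {n : Fin 4} (hn : x n ≠ 0) :
    ρ n = n := by
  have hxρ : ∀ k, x (ρ k) = x k := fun k => by
    conv_lhs => rw [← he]
    simp
  by_cases h3 : ∃ i, x i ≠ 0 ∧ i ≠ n
  swap
  · refine absurd hx.2.2 ?_
    have : Function.support x = {n} := by
      ext i
      simp only [Function.mem_support, mem_singleton_iff]
      push Not at h3
      exact ⟨h3 i, fun e => e ▸ hn⟩
    rw [this]
    exact τ.not_mem_vertex t n
  obtain ⟨i, hi, hin⟩ := h3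
  obtain ⟨p, q, h1, h2, h3, h4, h5, -⟩ := exists_sum_eq_of_ne hin
  have hall : ∀ k, k = i ∨ k = n ∨ k = p ∨ k = q := by
    intro k; simp only [ne_eq, Fin.ext_iff] at *; omega
  have key : (∃ r, x r = 0 ∧ ∀ k, x k = 0 → k = r) → ρ n = n := by
    rintro ⟨r, hr, hr'⟩
    -- With a single vanishing coordinate a second crossing undoes the first.
    have hpath : ∀ {t' : τ.Tet} {ρ : Equiv.Perm (Fin 4)}, τ.Path t x t' ρ →
        (t' = t ∧ ρ = 1) ∨ τ.glue t r = some (t', ρ) := by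
      intro t' ρ h
      induction h with
      | refl => exact Or.inl ⟨rfl, rfl⟩
      | @step t' ρ j t'' σ h hg hj ih =>
        have hjr : ρ r = j := by rw [← hr' _ hj]; simp
        rcases ih with ⟨rfl, rfl⟩ | ih
        · right
          rw [mul_one, ← hg, ← hjr]; rfl
        · left
          have := τ.glue_symm _ _ _ _ ih
          rw [hjr, hg] at this
          simp only [Option.some.injEq, Prod.mk.injEq] at this
          rw [this.1, this.2]; simp
    rcases hpath h with ⟨-, e⟩ | e
    · rw [e]; rfl
    · refine absurd ?_ (τ.glue_ne _ _ _ _ e)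
      rw [hr' (ρ r) ((hxρ r).trans hr)]
  by_cases hp : x p = 0 <;> by_cases hq : x q = 0
  · have hsupp : Function.support x = {n, i} := by
      ext k
      simp only [Function.mem_support, mem_insert_iff, mem_singleton_iff]
      rcases hall k with rfl | rfl | rfl | rfl
      · simp [hi]
      · simp [hn]
      · simp [hp, h1.symm, h3.symm]
      · simp [hq, h2.symm, h4.symm]
    have hedge : ∀ {t' : τ.Tet} {ρ : Equiv.Perm (Fin 4)}, τ.Path t x t' ρ →
        Relation.ReflTransGen τ.EdgeStep (t, n, i) (t', ρ n, ρ i) := by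
      intro t' ρ h
      induction h with
      | refl => exact .refl
      | @step t' ρ j t'' σ h hg hj ih =>
        refine ih.tail ⟨j, σ, hg, ?_, ?_, rfl, rfl⟩
        · rintro rfl; simp [hn] at hj
        · rintro rfl; simp [hi] at hj
    have hρn : ρ n = n ∨ ρ n = i := by
      have : ρ n ∈ Function.support x := by rw [Function.mem_support, hxρ]; exact hn
      rwa [hsupp] at this
    have hρi : ρ i = n ∨ ρ i = i := by
      have : ρ i ∈ Function.support x := by rw [Function.mem_support, hxρ]; exact hi
      rwa [hsupp] at this
    refine hρn.resolve_right fun e => ?_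
    have e' : ρ i = n := hρi.resolve_right fun e' => hin (ρ.injective (e'.trans e.symm))
    refine τ.edge_not_reversed t n i hin.symm (hsupp ▸ hx.2.2) ?_
    have := hedge h
    rwa [e, e'] at this
  · exact key ⟨p, hp, fun k hk => by
      rcases hall k with rfl | rfl | rfl | rfl <;> first | rfl | exact absurd hk ‹_›⟩
  · exact key ⟨q, hq, fun k hk => by
      rcases hall k with rfl | rfl | rfl | rfl <;> first | rfl | exact absurd hk ‹_›⟩
  · have hz : ∀ k, x k ≠ 0 := fun k => by rcases hall k with rfl | rfl | rfl | rfl <;> assumption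
    have : ∀ {t' : τ.Tet} {ρ : Equiv.Perm (Fin 4)}, τ.Path t x t' ρ → ρ = 1 := by
      intro t' ρ h
      induction h with
      | refl => rfl
      | step h hg hj ih => exact absurd hj (hz _)
    rw [this h]; rfl

end IdealTriangulation

namespace IdealTriangulation

variable {τ : IdealTriangulation.{u}} {m : ℕ}

/-! #### The spectral space -/

variable (τ m) in
def toSpectral (y : τ.SheetPoint m) : τ.SpectralSpace m := Quot.mk _ y

theorem sheetPoint_inSheet (hm : 0 < m) (y : τ.SheetPoint m) :
    InSheet m y.2.1 y.1.2.1 y.1.2.2 := ((mem_zigzagDomain_iff hm).mp y.2.2.2).2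

/-- Two indices of sheets, related by `ρ`, define the same point of the spectral space
over `x`. -/
def SameSheet (m : ℕ) (x : Fin 4 → ℝ) (ρ : Equiv.Perm (Fin 4)) (i : Fin 4) (k : ℕ) (j : Fin 4)
    (l : ℕ) : Prop :=
  (j = ρ i ∧ l = k) ∨ (x i - k = x (ρ.symm j) - l ∧ Ties m x (x i - k))

/-- The relation on the right is already an equivalence: gluings preserve heights and ties, so a
chain of face crossings and rectangle crossings collapses to one path together with one comparison
of heights. Conversely, all faces are crossed first and a rectangle, if needed, is crossed at the
end. -/
theorem toSpectral_eq_iff (hm : 0 < m) {y y' : τ.SheetPoint m} :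
    τ.toSpectral m y = τ.toSpectral m y' ↔ ∃ ρ, τ.Path y.1.1 y.2.1 y'.1.1 ρ ∧
      SameSheet m y.2.1 ρ y.1.2.1 y.1.2.2 y'.1.2.1 y'.1.2.2 ∧ y'.2.1 = y.2.1 ∘ ρ.symm := by
  constructor
  · intro h
    replace h := Quot.eqvGen_exact h
    induction h with
    | rel y y' h =>
      obtain ⟨⟨t, i, k⟩, x, hx⟩ := y
      obtain ⟨⟨t', i', k'⟩, x', hx'⟩ := y'
      rcases h with ⟨j, σ, h, e, e'⟩ | ⟨e, e', h⟩
      · exact ⟨σ, (Path.of_glueVia h).1, Or.inl ⟨e, by rw [e']⟩, (Path.of_glueVia h).2⟩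
      · dsimp only at e e' h
        subst e e'
        exact ⟨1, .refl, Or.inr ((onRectangle_iff hm hx.1.inSimplex).mp h).2, rfl⟩
    | refl y => exact ⟨1, .refl, Or.inl ⟨rfl, rfl⟩, rfl⟩
    | symm y y' _ ih =>
      obtain ⟨ρ, h, hs, e⟩ := ih
      refine ⟨ρ.symm, e ▸ h.symm, ?_, by rw [e]; ext n; simp⟩
      rcases hs with ⟨h1, h2⟩ | ⟨h1, h2⟩
      · left; rw [h1, h2]; simp
      · right
        rw [e]
        simp only [Function.comp_apply, Equiv.symm_symm, Equiv.symm_apply_apply]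
        exact ⟨h1.symm, h1 ▸ h2.comp _⟩
    | trans y y' y'' _ _ ih ih' =>
      obtain ⟨ρ, h, hs, e⟩ := ih
      obtain ⟨ρ', h', hs', e'⟩ := ih'
      rw [e] at h' e' hs'
      refine ⟨ρ' * ρ, h.trans h', ?_, e'⟩
      rcases hs with ⟨h1, h2⟩ | ⟨h1, h2⟩ <;> rcases hs' with ⟨h3, h4⟩ | ⟨h3, h4⟩
      · left; rw [h3, h1, h4, h2]; exact ⟨rfl, rfl⟩
      · right
        rw [h1, h2] at h3 h4
        simp only [Function.comp_apply, Equiv.symm_apply_apply] at h3 h4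
        refine ⟨h3, ?_⟩
        convert! h4.comp ρ using 1
        ext n; simp
      · right
        refine ⟨?_, h2⟩
        rw [h1, h3, h4, Equiv.Perm.mul_def, Equiv.symm_trans_apply, Equiv.symm_apply_apply]
      · right
        exact ⟨h1.trans h3, h2⟩
  · rintro ⟨ρ, h, hs, e⟩
    obtain ⟨⟨t, i, k⟩, x, hx, hz⟩ := y
    obtain ⟨⟨t', i', k'⟩, x', hx', hz'⟩ := y'
    dsimp only at h hs e
    subst e
    have hsheet : InSheet m x i k := ((mem_zigzagDomain_iff hm).mp hz).2
    have hd : ∀ {t' ρ}, τ.Path t x t' ρ → x ∘ ρ.symm ∈ zigzagDomain m (ρ i) k := fun h =>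
      (mem_zigzagDomain_iff hm).mpr ⟨(h.inTet hx).inSimplex,
        InSheet.comp _ (by rwa [Equiv.symm_apply_apply])⟩
    have hpath : τ.toSpectral m ⟨(t, i, k), x, hx, hz⟩ =
        τ.toSpectral m ⟨(t', ρ i, k), x ∘ ρ.symm, hx', hd h⟩ := by
      clear hs hz'
      induction h with
      | refl => rfl
      | step h hg hj ih =>
        exact (ih (h.inTet hx)).trans
          (Quot.sound (Or.inl ⟨_, _, Path.glueVia hg hj, rfl, rfl⟩))
    rw [hpath]
    rcases hs with ⟨h1, h2⟩ | ⟨h1, h2⟩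
    · obtain rfl := Fin.ext h2
      subst h1; rfl
    by_cases hi : ρ i = i'
    · subst hi
      rw [Equiv.symm_apply_apply] at h1
      have : (k : ℕ) = k' := by exact_mod_cast (by linarith : ((k : ℕ) : ℝ) = (k' : ℕ))
      obtain rfl := Fin.ext this
      rfl
    · refine Quot.sound (Or.inr ⟨rfl, rfl, (onRectangle_iff hm (h.inTet hx).inSimplex).mpr
        ⟨hi, ?_, ?_⟩⟩)
      · simpa using h1
      · simpa using h2.comp ρ.symm

theorem SameSheet.inSheet {x : Fin 4 → ℝ} {ρ : Equiv.Perm (Fin 4)} {i j : Fin 4} {k l : ℕ}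
    (h : SameSheet m x ρ i k j l) (hx : InSimplex m x) (hs : InSheet m x i k) :
    InSheet m (x ∘ ρ.symm) j l := by
  apply InSheet.comp
  rcases h with ⟨rfl, rfl⟩ | ⟨h1, h2⟩
  · rwa [Equiv.symm_apply_apply]
  · rw [h1] at h2; exact h2.inSheet hx

theorem eventually_sameSheet (x : Fin 4 → ℝ) (ρ : Equiv.Perm (Fin 4)) (i : Fin 4) (k : ℕ)
    (j : Fin 4) (l : ℕ) :
    ∀ᶠ y in 𝓝 x, InSimplex m y → SameSheet m y ρ i k j l → SameSheet m x ρ i k j l := by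
  have : ∀ᶠ y : Fin 4 → ℝ in 𝓝 x, y i - k = y (ρ.symm j) - l → x i - k = x (ρ.symm j) - l := by
    by_cases h : x i - k = x (ρ.symm j) - l
    · exact Eventually.of_forall fun _ _ => h
    · have hc : Continuous fun y : Fin 4 → ℝ => (y i - k) - (y (ρ.symm j) - l) := by fun_prop
      filter_upwards [hc.continuousAt.eventually_ne (sub_ne_zero.mpr h)] with y hy hy'
      exact absurd (sub_eq_zero.mpr hy') hy
  filter_upwards [this, eventually_ties m x i k] with y h1 h2 hy h
  exact h.imp id fun h => ⟨h1 h.1, h2 hy h.2⟩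

theorem continuous_toSpectral : Continuous (τ.toSpectral m) := continuous_quot_mk

theorem surjective_toSpectral : Function.Surjective (τ.toSpectral m) := Quot.mk_surjective

theorem isClosedMap_toSpectral (hm : 0 < m) : IsClosedMap (τ.toSpectral m) := by
  refine isClosedMap_of_gluing
    (f := fun (ρ : Equiv.Perm (Fin 4)) (x : Fin 4 → ℝ) => x ∘ ρ.symm)
    (R := fun c c' ρ x => τ.Path c.1 x c'.1 ρ ∧ SameSheet m x ρ c.2.1 c.2.2 c'.2.1 c'.2.2)
    isQuotientMap_quot_mk (fun ρ => by fun_prop) ?_ ?_ ?_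
  · intro c x _ c' ρ
    filter_upwards [eventually_path (τ := τ) x,
      eventually_sameSheet (m := m) x ρ c.2.1 c.2.2 c'.2.1 c'.2.2] with y h1 h2 hy h
    exact ⟨h1 _ _ _ h.1, h2 hy.1.inSimplex h.2⟩
  · intro c c' ρ x hx h
    rw [mem_zigzagDomain_iff hm] at hx ⊢
    exact ⟨h.1.inTet hx.1, (h.1.inTet hx.1).inSimplex, h.2.inSheet hx.2.1 hx.2.2⟩
  · intro c x c' x'
    exact (toSpectral_eq_iff hm (y := ⟨c, x⟩) (y' := ⟨c', x'⟩)).trans (by simp only [and_assoc])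

theorem finite_fiber_toSpectral (hm : 0 < m) (q : τ.SpectralSpace m) :
    (τ.toSpectral m ⁻¹' {q}).Finite :=
  finite_fiber_of_gluing (f := fun (ρ : Equiv.Perm (Fin 4)) (x : Fin 4 → ℝ) => x ∘ ρ.symm)
    (fun _ _ _ _ h => ((toSpectral_eq_iff hm).mp h).imp fun _ h => h.2.2) q

theorem t2Space_spectralSpace (hm : 0 < m) : T2Space (τ.SpectralSpace m) :=
  (isClosedMap_toSpectral hm).t2Space_of_finite_fibers continuous_toSpectral surjective_toSpectral
    (finite_fiber_toSpectral hm)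

variable (τ m) in
/-- Forgetting the sheet. -/
def sheetBase (y : τ.SheetPoint m) : τ.Point m := ⟨y.1.1, y.2.1, y.2.2.1⟩

theorem isClosed_setOf_mem_zigzagDomain (hm : 0 < m) (i : Fin 4) (k : ℕ) :
    IsClosed {x : Fin 4 → ℝ | x ∈ zigzagDomain m i k} := by
  simp only [mem_zigzagDomain_iff hm, InSimplex, ofPred_and, ofPred_forall]
  exact ((isClosed_iInter fun i => isClosed_le (by fun_prop) (by fun_prop)).inter
    (isClosed_eq (by fun_prop) (by fun_prop))).inter (isClosed_setOf_inSheet m i k)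

theorem continuous_sheetBase : Continuous (τ.sheetBase m) :=
  continuous_sigma fun c => (continuous_sigmaMk (σ := fun t => {x // τ.InTet m t x})
    (i := c.1)).comp (Continuous.subtype_mk
      (f := fun x : {x // τ.InTet m c.1 x ∧ x ∈ zigzagDomain m c.2.1 c.2.2} => (x : Fin 4 → ℝ))
      continuous_subtype_val fun x => x.2.1)

theorem isClosedMap_sheetBase (hm : 0 < m) : IsClosedMap (τ.sheetBase m) := by
  intro C hC
  have : τ.sheetBase m '' C = ⋃ c, Sigma.mk (β := fun t => {x // τ.InTet m t x}) c.1 ''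
      ((fun x => ⟨x.1, x.2.1⟩ : {x // τ.InTet m c.1 x ∧ x ∈ zigzagDomain m c.2.1 c.2.2} →
        {x // τ.InTet m c.1 x}) '' (Sigma.mk c ⁻¹' C)) := by
    ext p
    simp only [mem_image, mem_iUnion, mem_preimage]
    constructor
    · rintro ⟨⟨c, x⟩, h, rfl⟩; exact ⟨c, _, ⟨x, h, rfl⟩, rfl⟩
    · rintro ⟨c, _, ⟨x, h, rfl⟩, rfl⟩; exact ⟨_, h, rfl⟩
  rw [this]
  refine isClosed_iUnion_of_finite fun c => isClosedMap_sigmaMk _ ?_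
  obtain ⟨D, hD, hDC⟩ := isClosed_induced_iff.mp (isClosed_sigma_iff.mp hC c)
  rw [← hDC]
  have : (fun x => ⟨x.1, x.2.1⟩ : {x // τ.InTet m c.1 x ∧ x ∈ zigzagDomain m c.2.1 c.2.2} →
      {x // τ.InTet m c.1 x}) '' (Subtype.val ⁻¹' D) =
      Subtype.val ⁻¹' (D ∩ {x | x ∈ zigzagDomain m c.2.1 c.2.2}) := by
    ext x
    constructor
    · rintro ⟨y, h, rfl⟩; exact ⟨h, y.2.2⟩
    · rintro ⟨h, h'⟩; exact ⟨⟨x, x.2, h'⟩, h, rfl⟩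
  rw [this]
  exact (hD.inter (isClosed_setOf_mem_zigzagDomain hm _ _)).preimage continuous_subtype_val

theorem spectralMap_toSpectral (y : τ.SheetPoint m) :
    τ.spectralMap m (τ.toSpectral m y) = τ.toSpace m (τ.sheetBase m y) := rfl

theorem continuous_spectralMap : Continuous (τ.spectralMap m) :=
  continuous_quot_lift _ (continuous_toSpace.comp continuous_sheetBase)

theorem isClosedMap_spectralMap (hm : 0 < m) : IsClosedMap (τ.spectralMap m) := by
  intro C hC
  have : τ.spectralMap m '' C =
      (τ.toSpace m ∘ τ.sheetBase m) '' (τ.toSpectral m ⁻¹' C) := by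
    ext z
    constructor
    · rintro ⟨q, hq, rfl⟩
      obtain ⟨y, rfl⟩ := surjective_toSpectral q
      exact ⟨y, hq, rfl⟩
    · rintro ⟨y, hy, rfl⟩
      exact ⟨_, hy, rfl⟩
  rw [this]
  exact (isClosedMap_toSpace.comp (isClosedMap_sheetBase hm)) _
    (hC.preimage continuous_toSpectral)

/-! #### The sheets over a point -/

/-- The point over `p` of the sheet `(n, k)`. -/
def sheet (hm : 0 < m) (p : τ.Point m) (n : Fin 4) (k : ℕ) (h : InSheet m p.2.1 n k) :
    τ.SpectralSpace m :=
  τ.toSpectral m ⟨(p.1, n, ⟨k, h.lt⟩), p.2.1, p.2.2,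
    (mem_zigzagDomain_iff hm).mpr ⟨p.2.2.inSimplex, h⟩⟩

theorem spectralMap_sheet (hm : 0 < m) (p : τ.Point m) (n : Fin 4) (k : ℕ)
    (h : InSheet m p.2.1 n k) : τ.spectralMap m (sheet hm p n k h) = τ.toSpace m p := rfl

theorem toSpectral_eq_sheet (hm : 0 < m) (y : τ.SheetPoint m) : τ.toSpectral m y =
    sheet hm (τ.sheetBase m y) y.1.2.1 y.1.2.2 (sheetPoint_inSheet hm y) := rfl

/-- `Path.fixed` excludes identification of two sheets by monodromy: the corner of a sheet has a
positive coordinate. What remains are the ties. -/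
theorem sheet_eq_iff (hm : 0 < m) {p : τ.Point m} {n n' : Fin 4} {k k' : ℕ}
    {h : InSheet m p.2.1 n k} {h' : InSheet m p.2.1 n' k'} :
    sheet hm p n k h = sheet hm p n' k' h' ↔
      (n = n' ∧ k = k') ∨ (p.2.1 n - k = p.2.1 n' - k' ∧ Ties m p.2.1 (p.2.1 n - k)) := by
  rw [sheet, sheet, toSpectral_eq_iff hm]
  dsimp only
  constructor
  · rintro ⟨ρ, hρ, hs, e⟩
    rcases hs with ⟨h1, h2⟩ | ⟨h1, h2⟩
    · left
      rw [h1, hρ.fixed p.2.2 e.symm (h.pos p.2.2.inSimplex).ne']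
      exact ⟨rfl, h2.symm⟩
    · right
      rw [show p.2.1 n' = p.2.1 (ρ.symm n') from congrFun e n']
      exact ⟨h1, h2⟩
  · rintro (⟨rfl, rfl⟩ | ⟨h1, h2⟩)
    · exact ⟨1, .refl, Or.inl ⟨rfl, rfl⟩, rfl⟩
    · exact ⟨1, .refl, Or.inr ⟨h1, h2⟩, rfl⟩

theorem exists_sheet_eq (hm : 0 < m) {p p' : τ.Point m} (h : τ.toSpace m p = τ.toSpace m p') :
    ∃ ρ : Equiv.Perm (Fin 4), p'.2.1 = p.2.1 ∘ ρ.symm ∧ ∀ n k (h : InSheet m p.2.1 n k),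
      ∃ h', sheet hm p n k h = sheet hm p' (ρ n) k h' := by
  obtain ⟨ρ, hρ, e⟩ := toSpace_eq_iff.mp h
  refine ⟨ρ, e, fun n k h => ?_⟩
  have h' : InSheet m p'.2.1 (ρ n) k := by
    rw [e]; exact InSheet.comp _ (by rwa [Equiv.symm_apply_apply])
  exact ⟨h', (toSpectral_eq_iff hm).mpr ⟨ρ, hρ, Or.inl ⟨rfl, rfl⟩, e⟩⟩

/-- The points over `p` are those of the sheets of any rounding. -/
theorem exists_sheet_of_spectralMap_eq (hm : 0 < m) {p : τ.Point m} {v : Fin 4 → ℕ}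
    (hv : IsRounding m p.2.1 v) {q : τ.SpectralSpace m} (hq : τ.spectralMap m q = τ.toSpace m p) :
    ∃ n k, ∃ h : k < v n, q = sheet hm p n k ⟨v, hv, h⟩ := by
  obtain ⟨y, rfl⟩ := surjective_toSpectral q
  rw [spectralMap_toSpectral] at hq
  obtain ⟨ρ, -, h⟩ := exists_sheet_eq hm hq
  rw [toSpectral_eq_sheet hm]
  obtain ⟨h', e⟩ := h _ _ (sheetPoint_inSheet hm y)
  rw [e]
  clear e h
  generalize ρ y.1.2.1 = n at *
  generalize ((y.1.2.2 : Fin m) : ℕ) = k at *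
  rcases h'.of_isRounding hv with hk | ⟨hk, ht⟩
  · exact ⟨n, k, hk, rfl⟩
  -- The unit is not used by `v`, but it is tied, so it represents the same point as a used unit at
  -- the tie height, the last one at `s`.
  · obtain ⟨⟨r, hr⟩, ⟨s, hs⟩⟩ := hv.exists_tie ht
    have h1 := (ht.pos p.2.2.inSimplex).2
    have hvs : 0 < v s := by
      have := p.2.2.1 s
      have : (0 : ℝ) < v s := by linarith
      exact_mod_cast this
    refine ⟨s, v s - 1, by omega, (sheet_eq_iff hm).mpr (Or.inr ⟨?_, ht⟩)⟩
    push_cast [hvs]; linarith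

end IdealTriangulation

/-- A continuous closed map is a local homeomorphism at a point with a neighborhood, separated from
the rest of the fiber, that meets each nearby fiber in one point. -/
theorem IsClosedMap.isLocalHomeomorphOn_singleton {X Y : Type*} [TopologicalSpace X]
    [TopologicalSpace Y] {f : X → Y} (hf : IsClosedMap f) (hc : Continuous f) {p : X} {V V' : Set X}
    (hV : IsOpen V) (hV' : IsOpen V') (hd : Disjoint V V') (hp : p ∈ V)
    (hfib : f ⁻¹' {f p} ⊆ V ∪ V') (h : ∀ᶠ y in 𝓝 (f p), ∃! q, q ∈ V ∧ f q = y) :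
    IsLocalHomeomorphOn f {p} := by
  have h2 : ∀ᶠ y in 𝓝 (f p), ∀ q ∈ f ⁻¹' {y}, q ∈ V ∪ V' :=
    hf.eventually_nhds_fiber _ fun q hq => (hV.union hV').mem_nhds (hfib hq)
  obtain ⟨W, hW, hWo, hpW⟩ := mem_nhds_iff.mp (h.and h2)
  have huniq : ∀ q ∈ V, f q ∈ W → ∀ q' ∈ V, f q' = f q → q' = q := fun q hq hqW q' hq' e =>
    (hW hqW).1.unique ⟨hq', e⟩ ⟨hq, rfl⟩
  refine IsLocalHomeomorphOn.mk f {p} ?_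
  intro p' hp'
  rw [mem_singleton_iff.mp hp']
  have hU : IsOpen (V ∩ f ⁻¹' W) := hV.inter (hWo.preimage hc)
  have hopen : ∀ O ⊆ V ∩ f ⁻¹' W, IsOpen O → IsOpen (f '' O) := by
    intro O hO hOo
    -- Closedness gives openness: over `W` the fiber has one point in `V` and the others in `V'`, so
    -- missing `O` is the same as being hit from outside `O ∪ V'`.
    have : f '' O = W \ f '' (O ∪ V')ᶜ := by
      ext y
      constructor
      · rintro ⟨q, hq, rfl⟩
        refine ⟨(hO hq).2, ?_⟩
        rintro ⟨q', hq', e⟩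
        simp only [mem_compl_iff, mem_union, not_or] at hq'
        have hq'V : q' ∈ V := ((hW (hO hq).2).2 q' e).resolve_right hq'.2
        exact hq'.1 (huniq q (hO hq).1 (hO hq).2 q' hq'V e ▸ hq)
      · rintro ⟨hy, hy'⟩
        obtain ⟨q, ⟨hqV, rfl⟩, -⟩ := (hW hy).1
        by_contra hq
        refine hy' ⟨q, ?_, rfl⟩
        rintro (hqO | hqV')
        · exact hq ⟨q, hqO, rfl⟩
        · exact disjoint_left.mp hd hqV hqV'
    rw [this]
    exact hWo.sdiff (hf _ (hOo.union hV').isClosed_compl)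
  have hinj : InjOn f (V ∩ f ⁻¹' W) := fun q hq q' hq' e => (huniq q' hq'.1 hq'.2 q hq.1 e)
  have : Nonempty X := ⟨p⟩
  refine ⟨OpenPartialHomeomorph.ofContinuousOpenRestrict (hinj.toPartialEquiv f _)
    hc.continuousOn ?_ hU, ⟨hp, hpW⟩, fun _ _ => rfl⟩
  intro O hO
  obtain ⟨O', hO', rfl⟩ := isOpen_induced_iff.mp hO
  have : (V ∩ f ⁻¹' W).domRestrict f '' (Subtype.val ⁻¹' O') = f '' (V ∩ f ⁻¹' W ∩ O') := by
    rw [Set.domRestrict_eq, image_comp, Subtype.image_preimage_coe]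
  exact this ▸ hopen _ inter_subset_left (hU.inter hO')

/-! ### Counting sheets with multiplicity, and local degrees -/

namespace IdealTriangulation

variable {τ : IdealTriangulation.{u}} {m : ℕ}

open Classical in
/-- The indices of the sheets used by the rounding `v`, with the point over `p` in `V`. -/
def sheetIndices (hm : 0 < m) (V : Set (τ.SpectralSpace m)) (p : τ.Point m) (v : Fin 4 → ℕ) :
    Finset (Σ _ : Fin 4, ℕ) :=
  (Finset.univ.sigma fun n => Finset.range (v n)).filter fun s =>
    ∃ h : InSheet m p.2.1 s.1 s.2, sheet hm p s.1 s.2 h ∈ V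

theorem mem_sheetIndices {hm : 0 < m} {V : Set (τ.SpectralSpace m)} {p : τ.Point m}
    {v : Fin 4 → ℕ} {s : Σ _ : Fin 4, ℕ} : s ∈ sheetIndices hm V p v ↔
      s.2 < v s.1 ∧ ∃ h : InSheet m p.2.1 s.1 s.2, sheet hm p s.1 s.2 h ∈ V := by
  simp [sheetIndices]

open Classical in
theorem card_sheetIndices (hm : 0 < m) (V : Set (τ.SpectralSpace m)) (p : τ.Point m)
    (v : Fin 4 → ℕ) : ((sheetIndices hm V p v).card : ℤ) = ∑ n, ∑ k ∈ Finset.range (v n),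
      if ∃ h : InSheet m p.2.1 n k, sheet hm p n k h ∈ V then 1 else 0 := by
  rw [sheetIndices, Finset.card_filter, Finset.sum_sigma]
  push_cast
  rfl

/-- The count sums, over the used units, the indicator that the point of the unit is in `V`. Tied
units give the same point, so `IsRounding.sum_eq` makes the count independent of the rounding;
gluings only permute the units. -/
theorem card_sheetIndices_eq {hm : 0 < m} (V : Set (τ.SpectralSpace m)) {p p' : τ.Point m}
    (hp : τ.toSpace m p = τ.toSpace m p') {v v' : Fin 4 → ℕ} (hv : IsRounding m p.2.1 v)
    (hv' : IsRounding m p'.2.1 v') :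
    (sheetIndices hm V p v).card = (sheetIndices hm V p' v').card := by
  classical
  obtain ⟨ρ, e, hρ⟩ := exists_sheet_eq hm hp
  have hv'' : IsRounding m p'.2.1 (v ∘ ρ.symm) := e ▸ hv.comp ρ.symm
  zify
  rw [card_sheetIndices, card_sheetIndices]
  refine Eq.trans ?_ (hv''.sum_eq hv' _ ?_)
  · refine Eq.trans ?_ (Equiv.sum_comp ρ _)
    refine Finset.sum_congr rfl fun n _ => ?_
    refine Finset.sum_congr (by simp) fun k hk => ?_
    have h : InSheet m p.2.1 n k := ⟨v, hv, by simpa using hk⟩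
    obtain ⟨h', e⟩ := hρ n k h
    simp only [h, h', exists_true_left, e]
  · intro i k j l h ht
    have h1 := ht.inSheet p'.2.2.inSimplex
    have h2 : InSheet m p'.2.1 j l := (h ▸ ht).inSheet p'.2.2.inSimplex
    simp only [h1, h2, exists_true_left]
    rw [(sheet_eq_iff hm).mpr (Or.inr ⟨h, ht⟩)]

theorem card_sheetIndices_univ (hm : 0 < m) {p : τ.Point m} {v : Fin 4 → ℕ}
    (hv : IsRounding m p.2.1 v) : (sheetIndices hm univ p v).card = m := by
  classical
  zify
  rw [card_sheetIndices]
  refine Eq.trans ?_ (congrArg Nat.cast hv.1)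
  push_cast
  refine Finset.sum_congr rfl fun n _ => ?_
  exact (Finset.sum_congr rfl fun k hk =>
    if_pos ⟨⟨v, hv, Finset.mem_range.mp hk⟩, mem_univ _⟩).trans (by simp)

theorem card_sheetIndices_add_compl (hm : 0 < m) (V : Set (τ.SpectralSpace m)) {p : τ.Point m}
    {v : Fin 4 → ℕ} (hv : IsRounding m p.2.1 v) :
    (sheetIndices hm V p v).card + (sheetIndices hm Vᶜ p v).card = m := by
  classical
  refine Eq.trans ?_ (card_sheetIndices_univ hm hv)
  rw [← Finset.card_union_of_disjoint]
  · congr 1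
    ext s
    simp only [Finset.mem_union, mem_sheetIndices, mem_univ, exists_prop, and_true, mem_compl_iff]
    constructor
    · rintro (⟨h, h', -⟩ | ⟨h, h', -⟩) <;> exact ⟨h, h'⟩
    · rintro ⟨h, h'⟩
      by_cases hV : sheet hm p s.1 s.2 h' ∈ V
      · exact Or.inl ⟨h, h', hV⟩
      · exact Or.inr ⟨h, h', hV⟩
  · rw [Finset.disjoint_left]
    intro s h1 h2
    obtain ⟨-, h, h1⟩ := mem_sheetIndices.mp h1
    obtain ⟨-, h, h2⟩ := mem_sheetIndices.mp h2
    exact h2 h1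

/-- Different indices give different points in `V`. -/
def SheetsDistinct (hm : 0 < m) (V : Set (τ.SpectralSpace m)) (p : τ.Point m)
    (v : Fin 4 → ℕ) : Prop :=
  ∀ n k n' k', k < v n → k' < v n' → ∀ h h', sheet hm p n k h ∈ V →
    sheet hm p n k h = sheet hm p n' k' h' → n = n' ∧ k = k'

theorem SheetsDistinct.encard_eq {hm : 0 < m} {V : Set (τ.SpectralSpace m)} {p : τ.Point m}
    {v : Fin 4 → ℕ} (hv : IsRounding m p.2.1 v) (h : SheetsDistinct hm V p v) :
    (V ∩ τ.spectralMap m ⁻¹' {τ.toSpace m p}).encard = (sheetIndices hm V p v).card := by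
  let e : sheetIndices hm V p v → τ.SpectralSpace m := fun s =>
    sheet hm p s.1.1 s.1.2 (mem_sheetIndices.mp s.2).2.choose
  have he : Function.Injective e := by
    rintro ⟨⟨n, k⟩, hs⟩ ⟨⟨n', k'⟩, hs'⟩ hss
    obtain ⟨h1, h2, h3⟩ := mem_sheetIndices.mp hs
    obtain ⟨h1', h2', h3'⟩ := mem_sheetIndices.mp hs'
    obtain ⟨rfl, rfl⟩ := h n k n' k' h1 h1' _ _ h3 hss
    rfl
  have hr : V ∩ τ.spectralMap m ⁻¹' {τ.toSpace m p} = range e := by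
    ext q
    constructor
    · rintro ⟨hq, hq'⟩
      obtain ⟨n, k, hk, rfl⟩ := exists_sheet_of_spectralMap_eq hm hv hq'
      exact ⟨⟨⟨n, k⟩, mem_sheetIndices.mpr ⟨hk, _, hq⟩⟩, rfl⟩
    · rintro ⟨s, rfl⟩
      exact ⟨(mem_sheetIndices.mp s.2).2.choose_spec, rfl⟩
  rw [hr, ← image_univ, he.encard_image, encard_univ]
  simp [ENat.card_eq_coe_fintype_card]

theorem existsUnique_of_card_sheetIndices {hm : 0 < m} {V : Set (τ.SpectralSpace m)}
    {p : τ.Point m} {v : Fin 4 → ℕ} (hv : IsRounding m p.2.1 v)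
    (h : (sheetIndices hm V p v).card = 1) :
    ∃! q, q ∈ V ∧ τ.spectralMap m q = τ.toSpace m p := by
  have hd : SheetsDistinct hm V p v := by
    intro n k n' k' hk hk' h1 h1' h2 e
    obtain ⟨s, hs⟩ := Finset.card_eq_one.mp h
    have e1 : (⟨n, k⟩ : Σ _ : Fin 4, ℕ) ∈ sheetIndices hm V p v :=
      mem_sheetIndices.mpr ⟨hk, h1, h2⟩
    have e2 : (⟨n', k'⟩ : Σ _ : Fin 4, ℕ) ∈ sheetIndices hm V p v :=
      mem_sheetIndices.mpr ⟨hk', h1', e ▸ h2⟩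
    rw [hs, Finset.mem_singleton] at e1 e2
    have := e1.trans e2.symm
    simpa using this
  have := hd.encard_eq hv
  rw [h, Nat.cast_one, encard_eq_one] at this
  obtain ⟨q, hq⟩ := this
  have hq' : ∀ q', q' ∈ V ∧ τ.spectralMap m q' = τ.toSpace m p ↔ q' = q := fun q' => by
    have : q' ∈ V ∩ τ.spectralMap m ⁻¹' {τ.toSpace m p} ↔ q' ∈ ({q} : Set _) := by rw [hq]
    exact this
  exact ⟨q, (hq' q).mpr rfl, fun q' h => (hq' q').mp h⟩

/-- The number of the points in `V` over a point, with multiplicities, is locally constant. -/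
theorem eventually_card_sheetIndices {hm : 0 < m} {V V' : Set (τ.SpectralSpace m)} (hV : IsOpen V)
    (hV' : IsOpen V') (hd : Disjoint V V') {p : τ.Point m} {v : Fin 4 → ℕ}
    (hv : IsRounding m p.2.1 v)
    (hfib : τ.spectralMap m ⁻¹' {τ.toSpace m p} ⊆ V ∪ V') :
    ∀ᶠ z in 𝓝 (τ.toSpace m p), ∃ p' v', τ.toSpace m p' = z ∧ IsRounding m p'.2.1 v' ∧
      (sheetIndices hm V p' v').card = (sheetIndices hm V p v).card := by
  refine eventually_space fun p₁ hp₁ => ?_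
  obtain ⟨t, x⟩ := p₁
  rw [eventually_point_iff]
  have key : ∀ n : Fin 4, ∀ k : Fin m, ∀ᶠ y : {x // τ.InTet m t x} in 𝓝 x,
      InSheet m x n k → ∀ h : InSheet m y n k,
        (sheet hm ⟨t, y⟩ n k h ∈ V ↔ ∃ h, sheet hm ⟨t, x⟩ n k h ∈ V) := by
    intro n k
    by_cases hx : InSheet m x n k
    swap
    · exact Eventually.of_forall fun y h => absurd h hx
    have hx' : (x : Fin 4 → ℝ) ∈ zigzagDomain m n k :=
      (mem_zigzagDomain_iff hm).mpr ⟨x.2.inSimplex, hx⟩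
    let f : {x // τ.InTet m t x ∧ x ∈ zigzagDomain m n k} → τ.SpectralSpace m :=
      fun y => τ.toSpectral m ⟨(t, n, k), y⟩
    have hf : Continuous f := continuous_toSpectral.comp continuous_sigmaMk
    have hmem : f ⟨x, x.2, hx'⟩ ∈ V ∪ V' := hfib (by
      rw [mem_preimage, mem_singleton_iff, ← hp₁]; rfl)
    have hloc : ∀ O : Set (τ.SpectralSpace m), IsOpen O → f ⟨x, x.2, hx'⟩ ∈ O →
        ∀ᶠ y : {x // τ.InTet m t x} in 𝓝 x, ∀ h : InSheet m y n k,
          sheet hm ⟨t, y⟩ n k h ∈ O := by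
      intro O hO hxO
      have := hf.continuousAt.preimage_mem_nhds (hO.mem_nhds hxO)
      obtain ⟨u, hu, hsub⟩ := (mem_nhds_induced _ _ _).mp this
      filter_upwards [continuous_subtype_val.continuousAt.preimage_mem_nhds hu] with y hy h
      exact @hsub ⟨y, y.2, (mem_zigzagDomain_iff hm).mpr ⟨y.2.inSimplex, h⟩⟩ hy
    rcases hmem with hmem | hmem
    · filter_upwards [hloc V hV hmem] with y hy _ h
      exact iff_of_true (hy h) ⟨hx, hmem⟩
    · filter_upwards [hloc V' hV' hmem] with y hy _ h
      refine iff_of_false (fun h' => disjoint_left.mp hd h' (hy h)) ?_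
      rintro ⟨h', h''⟩
      exact disjoint_left.mp hd h'' hmem
  filter_upwards [eventually_all.mpr fun n => eventually_all.mpr (key n),
    continuous_subtype_val.continuousAt.eventually (eventually_isRounding m (x : Fin 4 → ℝ))]
    with y h1 h2
  -- A rounding of the nearby `y` is also one of `x`, so both counts may be made with `v'` and
  -- compared unit by unit. A unit cannot pass from `V` to `V'` nearby.
  obtain ⟨v', hv'⟩ := exists_isRounding y.2.inSimplex
  have hv'' : IsRounding m x v' := h2 v' hv'
  refine ⟨⟨t, y⟩, v', rfl, hv', ?_⟩
  rw [card_sheetIndices_eq V hp₁.symm hv hv'']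
  congr 1
  ext ⟨n, k⟩
  rw [mem_sheetIndices, mem_sheetIndices]
  refine and_congr_right fun hk => ?_
  dsimp only at hk
  have hkm : k < m := hk.trans_le (hv'.le_total n)
  have := h1 n ⟨k, hkm⟩ ⟨v', hv'', hk⟩ ⟨v', hv', hk⟩
  rw [← this]
  exact ⟨fun h => h.choose_spec, fun h => ⟨_, h⟩⟩

theorem finite_fiber_spectralMap (hm : 0 < m) (z : τ.Space m) :
    (τ.spectralMap m ⁻¹' {z}).Finite := by
  obtain ⟨p, rfl⟩ := surjective_toSpace z
  obtain ⟨v, hv⟩ := exists_isRounding p.2.2.inSimplex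
  refine (Set.finite_range fun s : sheetIndices hm univ p v =>
    sheet hm p s.1.1 s.1.2 (mem_sheetIndices.mp s.2).2.choose).subset fun q hq => ?_
  obtain ⟨n, k, hk, rfl⟩ := exists_sheet_of_spectralMap_eq hm hv hq
  exact ⟨⟨⟨n, k⟩, mem_sheetIndices.mpr ⟨hk, ⟨v, hv, hk⟩, mem_univ _⟩⟩, rfl⟩

theorem isProperMap_spectralMap (hm : 0 < m) : IsProperMap (τ.spectralMap m) :=
  isProperMap_iff_isClosedMap_and_compact_fibers.mpr ⟨continuous_spectralMap,
    isClosedMap_spectralMap hm, fun z => (finite_fiber_spectralMap hm z).isCompact⟩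

theorem exists_separation (hm : 0 < m) (q : τ.SpectralSpace m) {U : Set (τ.SpectralSpace m)}
    (hU : U ∈ 𝓝 q) : ∃ V V', IsOpen V ∧ IsOpen V' ∧ Disjoint V V' ∧ q ∈ V ∧ V ⊆ U ∧
      τ.spectralMap m ⁻¹' {τ.spectralMap m q} ⊆ V ∪ V' ∧
      ∀ q' ∈ V, τ.spectralMap m q' = τ.spectralMap m q → q' = q := by
  have := t2Space_spectralSpace (τ := τ) hm
  obtain ⟨V, V', hV, hV', h1, h2, h3⟩ := SeparatedNhds.of_isCompact_isCompact
    (isCompact_singleton (x := q))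
    ((finite_fiber_spectralMap hm (τ.spectralMap m q)).sdiff (t := {q})).isCompact
    (disjoint_left.mpr fun _ h h' => h'.2 h)
  refine ⟨V ∩ interior U, V', hV.inter isOpen_interior, hV', h3.mono_left inter_subset_left,
    ⟨h1 rfl, mem_interior_iff_mem_nhds.mpr hU⟩, inter_subset_right.trans interior_subset,
    fun q' hq' => ?_, fun q' hq' e => ?_⟩
  · by_cases h : q' = q
    · subst h; exact Or.inl ⟨h1 rfl, mem_interior_iff_mem_nhds.mpr hU⟩
    · exact Or.inr (h2 ⟨hq', h⟩)
  · by_contra h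
    exact disjoint_left.mp h3 hq'.1 (h2 ⟨e, h⟩)

theorem card_sheetIndices_congr {hm : 0 < m} {V V' : Set (τ.SpectralSpace m)} {p : τ.Point m}
    {v : Fin 4 → ℕ} (h : ∀ q, τ.spectralMap m q = τ.toSpace m p → (q ∈ V ↔ q ∈ V')) :
    (sheetIndices hm V p v).card = (sheetIndices hm V' p v).card := by
  congr 1
  ext s
  rw [mem_sheetIndices, mem_sheetIndices]
  exact and_congr_right fun _ => exists_congr fun h' => h _ rfl

/-- A point carrying one unit keeps multiplicity one nearby, so a neighborhood of it meets each
nearby fiber exactly once. -/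
theorem isLocalHomeomorphOn_of_card_eq_one {hm : 0 < m} {q : τ.SpectralSpace m} {p : τ.Point m}
    (hq : τ.spectralMap m q = τ.toSpace m p) {v : Fin 4 → ℕ} (hv : IsRounding m p.2.1 v)
    (h : (sheetIndices hm {q} p v).card = 1) : IsLocalHomeomorphOn (τ.spectralMap m) {q} := by
  obtain ⟨V, V', hV, hV', hd, hqV, -, hfib, huniq⟩ := exists_separation hm q univ_mem
  refine (isClosedMap_spectralMap hm).isLocalHomeomorphOn_singleton continuous_spectralMap hV hV'
    hd hqV hfib ?_
  rw [hq] at hfib huniq ⊢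
  have hcard : (sheetIndices hm V p v).card = 1 := by
    rw [← h]
    exact card_sheetIndices_congr fun q' hq' =>
      ⟨fun h => huniq q' h hq', fun h => by rw [mem_singleton_iff.mp h]; exact hqV⟩
  filter_upwards [eventually_card_sheetIndices hV hV' hd hv hfib]
  rintro z ⟨p', v', rfl, hv', e⟩
  exact existsUnique_of_card_sheetIndices hv' (e.trans hcard)

/-- The count with multiplicity near `q` is constantly `d`; off `B` distinct units give distinct
points, so there it is the number of points. -/
theorem hasRamificationDegree_of_card_eq {hm : 0 < m} {q : τ.SpectralSpace m} {p : τ.Point m}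
    (hq : τ.spectralMap m q = τ.toSpace m p) {v : Fin 4 → ℕ} (hv : IsRounding m p.2.1 v) {d : ℕ}
    (h : (sheetIndices hm {q} p v).card = d) {B : Set (τ.Space m)}
    (hB : ∀ p v, τ.toSpace m p ∉ B → IsRounding m p.2.1 v → SheetsDistinct hm univ p v) :
    HasRamificationDegree (τ.spectralMap m) B q d := by
  intro U hU
  obtain ⟨V, V', hV, hV', hd, hqV, hVU, hfib, huniq⟩ := exists_separation hm q hU
  rw [hq] at hfib huniq
  have hcard : (sheetIndices hm V p v).card = d := by
    rw [← h]
    exact card_sheetIndices_congr fun q' hq' =>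
      ⟨fun h => huniq q' h hq', fun h => by rw [mem_singleton_iff.mp h]; exact hqV⟩
  refine ⟨V, hV.mem_nhds hqV, hVU, _,
    hq ▸ eventually_card_sheetIndices (hm := hm) hV hV' hd hv hfib, ?_⟩
  rintro z ⟨⟨p', v', rfl, hv', e⟩, hz⟩
  rw [← hcard, ← e]
  refine SheetsDistinct.encard_eq hv' fun n k n' k' hk hk' h h' _ => ?_
  exact hB p' v' hz hv' n k n' k' hk hk' h h' (mem_univ _)

end IdealTriangulation

/-! ### The ramification locus -/

theorem eventually_int_eq (a : ℝ) : ∀ᶠ y : ℝ in 𝓝 a, ∀ k : ℤ, y = k → y = a := by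
  have h : a ∈ Ioo ((⌈a⌉ : ℝ) - 1) (⌊a⌋ + 1) :=
    ⟨by linarith [Int.ceil_lt_add_one a], Int.lt_floor_add_one a⟩
  filter_upwards [isOpen_Ioo.mem_nhds h] with y hy k hk
  have h1 : ⌈a⌉ - 1 < k := by exact_mod_cast hk ▸ hy.1
  have h2 : k < ⌊a⌋ + 1 := by exact_mod_cast hk ▸ hy.2
  have h3 : (⌈a⌉ : ℝ) ≤ k := by exact_mod_cast (by omega : ⌈a⌉ ≤ k)
  have h4 : (k : ℝ) ≤ ⌊a⌋ := by exact_mod_cast (by omega : k ≤ ⌊a⌋)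
  linarith [Int.le_ceil a, Int.floor_le a]

/-- The two coordinates other than `i` and `n` have the same fractional part. This crude necessary
condition suffices for the density of the complement. -/
theorem BlackAt.exists_int {m : ℕ} {x : Fin 4 → ℝ} {a : ℝ} (h : BlackAt m x a) :
    ∃ n n' : Fin 4, n ≠ n' ∧ ∃ k : ℤ, x n - x n' = k := by
  obtain ⟨-, -, v, -, i, n, hin, -, -, hj⟩ := h
  obtain ⟨p, q, h1, h2, h3, h4, h5, -⟩ := exists_sum_eq_of_ne hin
  refine ⟨p, q, h5, (v p : ℤ) - v q, ?_⟩
  have := hj p h1.symm h3.symm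
  have := hj q h2.symm h4.symm
  push_cast
  linarith

/-- The bounds on `a` say that the fourth difference `2 - 3a` lies in `[a - 1, a]`, so `v` is a
rounding. The filtered set counts the used units at the tie height; `n` joins the other two exactly
when `2 - 3a = a - 1`. -/
theorem BlackAt.isRounding {m : ℕ} {x : Fin 4 → ℝ} {a : ℝ} (h : BlackAt m x a) :
    ∃ v, IsRounding m x v ∧ Ties m x a ∧
      (Finset.univ.filter fun j => x j - v j = a - 1).card = if a = 3 / 4 then 3 else 2 := by
  obtain ⟨h1, h2, v, hv, i, n, hin, hi, hn, hj⟩ := h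
  obtain ⟨p, q, e1, e2, e3, e4, e5, -⟩ := exists_sum_eq_of_ne hin
  have hr : IsRounding m x v := by
    refine ⟨hv, rounds_of_mem_Icc (a := a) fun j => ?_⟩
    by_cases hji : j = i
    · subst hji; constructor <;> linarith
    by_cases hjn : j = n
    · subst hjn; constructor <;> linarith
    · have := hj j hji hjn; constructor <;> linarith
  refine ⟨v, hr, ⟨v, hr, ⟨i, hi⟩, p, hj p e1.symm e3.symm⟩, ?_⟩
  have hi' : ¬ (x i - v i = a - 1) := by intro h; linarith
  split_ifs with ha
  · have : (Finset.univ.filter fun j => x j - v j = a - 1) = Finset.univ.erase i := by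
      ext j
      simp only [Finset.mem_filter, Finset.mem_univ, true_and, Finset.mem_erase, and_true]
      constructor
      · rintro h rfl; exact hi' h
      · intro hji
        by_cases hjn : j = n
        · subst hjn; linarith
        · exact hj j hji hjn
    rw [this, Finset.card_erase_of_mem (Finset.mem_univ _)]; rfl
  · have hn' : ¬ (x n - v n = a - 1) := by intro h; exact ha (by linarith)
    have : (Finset.univ.filter fun j => x j - v j = a - 1) = (Finset.univ.erase i).erase n := by
      ext j
      simp only [Finset.mem_filter, Finset.mem_univ, true_and, Finset.mem_erase, and_true]
      constructor
      · intro h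
        exact ⟨by rintro rfl; exact hn' h, by rintro rfl; exact hi' h⟩
      · rintro ⟨hjn, hji⟩; exact hj j hji hjn
    rw [this, Finset.card_erase_of_mem (by simp [hin.symm]),
      Finset.card_erase_of_mem (Finset.mem_univ _)]; rfl

namespace IdealTriangulation

variable {τ : IdealTriangulation.{u}} {m : ℕ}

theorem mem_blackVertices_iff {z : τ.Space m} :
    z ∈ τ.blackVertices m ↔ ∃ p, τ.toSpace m p = z ∧ BlackAt m p.2.1 (3 / 4) := by
  constructor
  · rintro ⟨p, F, h1, h2, h3, h4⟩
    exact ⟨p, h4, (mem_blackVertex_iff p.2.2.inSimplex).mp ⟨F, h1, h2, h3⟩⟩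
  · rintro ⟨p, h4, h⟩
    obtain ⟨F, h1, h2, h3⟩ := (mem_blackVertex_iff p.2.2.inSimplex).mpr h
    exact ⟨p, F, h1, h2, h3, h4⟩

theorem mem_blackEdges_iff {z : τ.Space m} :
    z ∈ τ.blackEdges m ↔ ∃ p, τ.toSpace m p = z ∧ ∃ a, BlackAt m p.2.1 a := by
  constructor
  · rintro ⟨p, F, G, h1, h2, h3, h4, h5⟩
    exact ⟨p, h5, (mem_blackEdge_iff p.2.2.inSimplex).mp ⟨F, G, h1, h2, h3, h4⟩⟩
  · rintro ⟨p, h5, h⟩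
    obtain ⟨F, G, h1, h2, h3, h4⟩ := (mem_blackEdge_iff p.2.2.inSimplex).mpr h
    exact ⟨p, F, G, h1, h2, h3, h4, h5⟩

variable (τ m) in
/-- The ramification locus. -/
def blackLocus : Set (τ.Space m) := τ.blackEdges m ∪ τ.blackVertices m

theorem BlackAt.mem_blackLocus {p : τ.Point m} {a : ℝ} (h : BlackAt m p.2.1 a) :
    τ.toSpace m p ∈ τ.blackLocus m := Or.inl (mem_blackEdges_iff.mpr ⟨p, rfl, a, h⟩)

/-- Two of the units used by a rounding coincide on the black edges only. -/
theorem sheetsDistinct_of_notMem (hm : 0 < m) (p : τ.Point m) (v : Fin 4 → ℕ)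
    (hp : τ.toSpace m p ∉ τ.blackLocus m) (hv : IsRounding m p.2.1 v) :
    SheetsDistinct hm univ p v := by
  intro n k n' k' hk hk' h h' _ e
  rcases (sheet_eq_iff hm).mp e with e | ⟨e, ht⟩
  · exact e
  by_contra hne
  obtain ⟨⟨i, hi⟩, ⟨j, hj⟩⟩ := hv.exists_tie ht
  have hk1 := (hv.eq_or_eq_of_tie hi hj rfl).resolve_left (by omega)
  have hk1' := (hv.eq_or_eq_of_tie hi hj e.symm).resolve_left (by omega)
  set a := p.2.1 n - k with ha
  have hn : p.2.1 n - v n = a - 1 := by rw [hk1]; push_cast; linarith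
  have hn' : p.2.1 n' - v n' = a - 1 := by rw [hk1']; push_cast; linarith
  by_cases hnn : n = n'
  · subst hnn
    exact hne ⟨rfl, by omega⟩
  have hin : i ≠ n := by rintro rfl; linarith
  have hin' : i ≠ n' := by rintro rfl; linarith
  obtain ⟨r, hri, hrn, hrn', hS⟩ : ∃ r, r ≠ i ∧ r ≠ n ∧ r ≠ n' ∧
      ∀ j, j ≠ i → j ≠ r → j = n ∨ j = n' := by
    have : ∀ i n n' : Fin 4, i ≠ n → i ≠ n' → n ≠ n' → ∃ r, r ≠ i ∧ r ≠ n ∧ r ≠ n' ∧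
        ∀ j, j ≠ i → j ≠ r → j = n ∨ j = n' := by decide
    exact this i n n' hin hin' hnn
  obtain ⟨r', r'', h1, h2, h3, h4, h5, hS'⟩ := exists_sum_eq_of_ne hri.symm
  have e1 := hS r' h1.symm h3.symm
  have e2 := hS r'' h2.symm h4.symm
  have hsum := hv.sum_sub p.2.2.inSimplex
  have d1 : p.2.1 r' - v r' = a - 1 := by rcases e1 with e | e <;> rw [e] <;> assumption
  have d2 : p.2.1 r'' - v r'' = a - 1 := by rcases e2 with e | e <;> rw [e] <;> assumption
  -- With one difference equal to `a` and two equal to `a - 1`, the zero sum makes the fourth `2 -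
  -- 3a`; its membership in `[a - 1, a]` is `1/2 ≤ a ≤ 3/4`.
  rw [hS', d1, d2, hi] at hsum
  have hr := hv.mem_Icc hi hj r
  refine hp (BlackAt.mem_blackLocus (a := a) ⟨by linarith, by linarith, v, hv.1, i, r, hri.symm, hi,
    by linarith, fun l hl hl' => ?_⟩)
  rcases hS l hl hl' with e | e <;> rw [e] <;> assumption

theorem SheetsDistinct.mono {hm : 0 < m} {V V' : Set (τ.SpectralSpace m)} {p : τ.Point m}
    {v : Fin 4 → ℕ} (h : SheetsDistinct hm V p v) (hV : V' ⊆ V) : SheetsDistinct hm V' p v :=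
  fun n k n' k' h1 h2 h3 h4 h5 => h n k n' k' h1 h2 h3 h4 (hV h5)

theorem isLocalHomeomorphOn_of_sheetsDistinct {hm : 0 < m} {q : τ.SpectralSpace m} {p : τ.Point m}
    (hq : τ.spectralMap m q = τ.toSpace m p) {v : Fin 4 → ℕ} (hv : IsRounding m p.2.1 v)
    (h : SheetsDistinct hm {q} p v) : IsLocalHomeomorphOn (τ.spectralMap m) {q} := by
  refine isLocalHomeomorphOn_of_card_eq_one (hm := hm) hq hv ?_
  have := h.encard_eq hv
  rw [inter_eq_left.mpr (by rintro _ rfl; exact hq), encard_singleton] at this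
  exact_mod_cast this.symm

theorem encard_fiber_of_notMem (hm : 0 < m) {z : τ.Space m} (hz : z ∉ τ.blackLocus m) :
    (τ.spectralMap m ⁻¹' {z}).encard = m := by
  obtain ⟨p, rfl⟩ := surjective_toSpace z
  obtain ⟨v, hv⟩ := exists_isRounding p.2.2.inSimplex
  have := (sheetsDistinct_of_notMem hm p v hz hv).encard_eq hv
  rwa [univ_inter, card_sheetIndices_univ hm hv] at this

theorem isCoveringMapOn_spectralMap (hm : 0 < m) :
    IsCoveringMapOn (τ.spectralMap m) (τ.blackLocus m)ᶜ := by
  have := t2Space_spectralSpace (τ := τ) hm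
  have hloc : IsLocalHomeomorphOn (τ.spectralMap m) (τ.spectralMap m ⁻¹' (τ.blackLocus m)ᶜ) := by
    intro q hq
    obtain ⟨p, hp⟩ := surjective_toSpace (τ.spectralMap m q)
    obtain ⟨v, hv⟩ := exists_isRounding p.2.2.inSimplex
    exact isLocalHomeomorphOn_of_sheetsDistinct hp.symm hv
      ((sheetsDistinct_of_notMem hm p v (hp ▸ hq) hv).mono (subset_univ _)) q rfl
  exact (isClosedMap_spectralMap hm).isCoveringMapOn_of_isLocalHomeomorphOn
    (fun z _ => finite_fiber_spectralMap hm z) hloc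

/-- The ramification over a point of the black edges. -/
theorem isRamifiedOver_of_blackAt (hm : 0 < m) {p : τ.Point m} {a : ℝ} (h : BlackAt m p.2.1 a) :
    IsRamifiedOver (τ.spectralMap m) (τ.blackLocus m) m (if a = 3 / 4 then 3 else 2)
      (τ.toSpace m p) := by
  obtain ⟨v, hv, ht, hcard⟩ := h.isRounding
  generalize hd : (if a = 3 / 4 then 3 else 2) = d at hcard ⊢
  have hd0 : 0 < d := by rw [← hd]; split_ifs <;> norm_num
  obtain ⟨j, hj⟩ := Finset.card_pos.mp (hcard ▸ hd0)
  simp only [Finset.mem_filter, Finset.mem_univ, true_and] at hj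
  have ha1 := (ht.pos p.2.2.inSimplex).2
  have hpos : ∀ j, p.2.1 j - v j = a - 1 → 0 < v j := fun j hj => by
    have := p.2.2.1 j
    have : (0 : ℝ) < v j := by linarith
    exact_mod_cast this
  -- Used units are at least as high as the tie, so one exactly at the tie height is the last used
  -- unit at its index.
  have hval : ∀ n k, k < v n → (p.2.1 n - k = a ↔ p.2.1 n - v n = a - 1 ∧ k = v n - 1) := by
    intro n k hk
    constructor
    · intro h
      obtain ⟨⟨i, hi⟩, ⟨i', hi'⟩⟩ := hv.exists_tie ht
      have := (hv.eq_or_eq_of_tie hi hi' h).resolve_left (by omega)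
      refine ⟨?_, by omega⟩
      rw [this]; push_cast; linarith
    · rintro ⟨h, rfl⟩
      push_cast [hpos n h]; linarith
  have hin : InSheet m p.2.1 j (v j - 1) := ⟨v, hv, by have := hpos j hj; omega⟩
  have hja : p.2.1 j - (v j - 1 : ℕ) = a := (hval j _ (by have := hpos j hj; omega)).mpr ⟨hj, rfl⟩
  set q := sheet hm p j (v j - 1) hin with hq
  have hmem : ∀ n k (hk : k < v n) (h : InSheet m p.2.1 n k),
      sheet hm p n k h = q ↔ p.2.1 n - k = a := by
    intro n k hk h
    rw [hq, sheet_eq_iff, hja]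
    constructor
    · rintro (⟨rfl, rfl⟩ | ⟨h, -⟩)
      · exact hja
      · exact h
    · intro h; exact Or.inr ⟨h, h ▸ ht⟩
  have hcq : (sheetIndices hm {q} p v).card = d := by
    rw [← hcard]
    symm
    refine Finset.card_bij (fun j _ => ⟨j, v j - 1⟩) ?_ ?_ ?_
    · intro n hn
      simp only [Finset.mem_filter, Finset.mem_univ, true_and] at hn
      have := hpos n hn
      have hlt : v n - 1 < v n := by omega
      rw [mem_sheetIndices]
      exact ⟨hlt, ⟨v, hv, hlt⟩, (hmem _ _ hlt _).mpr ((hval _ _ hlt).mpr ⟨hn, rfl⟩)⟩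
    · intro n _ n' _ e
      simp only [Sigma.mk.injEq] at e
      exact e.1
    · rintro ⟨n, k⟩ hs
      obtain ⟨hk, h, hs⟩ := mem_sheetIndices.mp hs
      obtain ⟨h1, h2⟩ := (hval n k hk).mp ((hmem n k hk h).mp hs)
      refine ⟨n, by simpa using h1, by rw [h2]⟩
  -- There is only one tie height and all used units at that height meet at `q`, so no two units
  -- coincide elsewhere.
  have hdist : SheetsDistinct hm {q}ᶜ p v := by
    intro n k n' k' hk hk' h h' hnq e
    refine ((sheet_eq_iff hm).mp e).resolve_right ?_
    rintro ⟨-, ht'⟩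
    exact hnq ((hmem n k hk h).mpr (hv.ties_unique ht' ht))
  refine ⟨⟨q, rfl, hasRamificationDegree_of_card_eq (hm := hm) rfl hv hcq fun p v =>
    sheetsDistinct_of_notMem hm p v, fun q' hq' hne => ?_⟩, ?_⟩
  · exact isLocalHomeomorphOn_of_sheetsDistinct hq' hv
      (hdist.mono (by simpa using Ne.symm hne))
  · have h1 := hdist.encard_eq hv
    have h2 := card_sheetIndices_add_compl hm {q} hv
    rw [hcq] at h2
    have h3 : τ.spectralMap m ⁻¹' {τ.toSpace m p} =
        insert q ({q}ᶜ ∩ τ.spectralMap m ⁻¹' {τ.toSpace m p}) := by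
      ext q'
      by_cases h : q' = q
      · subst h; simp [q, spectralMap_sheet]
      · simp [h]
    rw [h3, encard_insert_of_notMem (by simp), h1]
    refine Eq.trans ?_ (congrArg (fun n : ℕ => (n : ℕ∞) + 1) h2)
    push_cast
    ring

theorem isRamifiedOver_of_mem_blackVertices (hm : 0 < m) {z : τ.Space m}
    (hz : z ∈ τ.blackVertices m) : IsRamifiedOver (τ.spectralMap m) (τ.blackLocus m) m 3 z := by
  obtain ⟨p, rfl, h⟩ := mem_blackVertices_iff.mp hz
  simpa using isRamifiedOver_of_blackAt hm h

theorem isRamifiedOver_of_mem_blackEdges (hm : 0 < m) {z : τ.Space m}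
    (hz : z ∈ τ.blackEdges m \ τ.blackVertices m) :
    IsRamifiedOver (τ.spectralMap m) (τ.blackLocus m) m 2 z := by
  obtain ⟨p, rfl, a, h⟩ := mem_blackEdges_iff.mp hz.1
  have := isRamifiedOver_of_blackAt hm h
  rwa [if_neg] at this
  rintro rfl
  exact hz.2 (mem_blackVertices_iff.mpr ⟨p, rfl, h⟩)

open Classical in
-- Push `x` slightly towards an interior point `c` with no integral difference of coordinates. Near
-- `x` a difference can be an integer only by being equal to that of `x`; along the segment this
-- forces it to equal that of `c`, which is not an integer.
theorem dense_compl_blackLocus (hm : 2 ≤ m) : Dense (τ.blackLocus m)ᶜ := by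
  intro z
  obtain ⟨⟨t, x, hx⟩, rfl⟩ := surjective_toSpace z
  have hm' : (2 : ℝ) ≤ m := by exact_mod_cast hm
  -- Offsets with zero sum and pairwise differences strictly between zero and one in absolute value,
  -- small enough for `m / 4 ≥ 1/2` to keep `c` positive.
  let e : Fin 4 → ℝ := ![-3 / 10, -1 / 10, 1 / 10, 3 / 10]
  let c : Fin 4 → ℝ := fun n => m / 4 + e n
  have hcpos : ∀ n, 0 < c n := by
    intro n; fin_cases n <;> simp [c, e] <;> linarith
  have hcsum : ∑ n, c n = m := by simp [Fin.sum_univ_four, c, e]; ring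
  have hcint : ∀ n n', n ≠ n' → ∀ k : ℤ, c n - c n' ≠ k := by
    intro n n' hnn k hk
    have h1 : c n - c n' = e n - e n' := by simp [c]
    have h2 : e n - e n' ≠ 0 ∧ |e n - e n'| < 1 := by
      fin_cases n <;> fin_cases n' <;> first | exact absurd rfl hnn | skip
      all_goals simp [e]; norm_num [abs_lt]
    rw [← h1, hk] at h2
    have h3 : |k| < 1 := by exact_mod_cast h2.2
    have h4 : k ≠ 0 := by exact_mod_cast h2.1
    exact h4 (Int.abs_lt_one_iff.mp h3)
  let y : ℝ → Fin 4 → ℝ := fun ε n => x n + ε * (c n - x n)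
  have hy : ∀ ε, 0 < ε → ε < 1 → τ.InTet m t (y ε) := by
    intro ε h0 h1
    have hpos : ∀ n, 0 < y ε n := fun n => by
      have := hx.1 n; have := hcpos n
      simp only [y]; nlinarith
    refine ⟨fun n => (hpos n).le, ?_, ?_⟩
    · simp only [y, Finset.sum_add_distrib, ← Finset.mul_sum, Finset.sum_sub_distrib, hcsum, hx.2.1]
      ring
    · have : Function.support (y ε) = univ := by
        ext n; simpa using (hpos n).ne'
      rw [this]; exact τ.mem_univ t
  have hyint : ∀ᶠ ε in 𝓝[>] (0 : ℝ), ∀ n n', n ≠ n' → ∀ k : ℤ, y ε n - y ε n' ≠ k := by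
    have h1 : ∀ n n', ∀ᶠ ε in 𝓝 (0 : ℝ), ∀ k : ℤ, y ε n - y ε n' = k → y ε n - y ε n' = x n - x n' :=
      fun n n' => by
        have hc : Continuous fun ε => y ε n - y ε n' := by fun_prop
        have h0 : y 0 n - y 0 n' = x n - x n' := by simp [y]
        have ht := hc.tendsto 0
        rw [h0] at ht
        exact ht.eventually (eventually_int_eq _)
    filter_upwards [nhdsWithin_le_nhds (eventually_all.mpr fun n => eventually_all.mpr (h1 n)),
      self_mem_nhdsWithin] with ε h1 h0 n n' hnn k hk
    have h2 := h1 n n' k hk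
    refine hcint n n' hnn k ?_
    rw [← hk, h2]
    have h0 : (0 : ℝ) < ε := h0
    have : ε * ((c n - c n') - (x n - x n')) = 0 := by simp only [y] at h2; linarith
    rcases mul_eq_zero.mp this with h | h <;> linarith
  rw [mem_closure_iff_frequently]
  let f : ℝ → τ.Point m := fun ε => if h : τ.InTet m t (y ε) then ⟨t, y ε, h⟩ else ⟨t, x, hx⟩
  have hf : Tendsto f (𝓝[>] 0) (𝓝 ⟨t, x, hx⟩) := by
    rw [Sigma.nhds_mk]
    have h1 : Tendsto (fun ε => (if h : τ.InTet m t (y ε) then ⟨y ε, h⟩ else ⟨x, hx⟩ :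
        {x // τ.InTet m t x})) (𝓝[>] 0) (𝓝 ⟨x, hx⟩) := by
      rw [tendsto_subtype_rng]
      have hc : Continuous y := by fun_prop
      have h0 : y 0 = x := by ext n; simp [y]
      have := (hc.tendsto 0).mono_left (nhdsWithin_le_nhds (s := Ioi 0))
      rw [h0] at this
      refine this.congr' ?_
      filter_upwards [Ioo_mem_nhdsGT one_pos] with ε hε
      rw [dif_pos (hy ε hε.1 hε.2)]
    refine (tendsto_map.comp h1).congr fun ε => ?_
    simp only [f, Function.comp_apply]
    split_ifs <;> rfl
  refine ((continuous_toSpace.tendsto _).comp hf).frequently (Eventually.frequently ?_)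
  filter_upwards [Ioo_mem_nhdsGT one_pos, hyint] with ε hε hint hB
  have hfε : f ε = ⟨t, y ε, hy ε hε.1 hε.2⟩ := dif_pos _
  have : ∃ p, τ.toSpace m p = τ.toSpace m (f ε) ∧ ∃ a, BlackAt m p.2.1 a := by
    rcases hB with hB | hB
    · exact mem_blackEdges_iff.mp hB
    · obtain ⟨p, h, h'⟩ := mem_blackVertices_iff.mp hB
      exact ⟨p, h, _, h'⟩
  obtain ⟨p, h, a, ha⟩ := this
  rw [hfε] at h
  obtain ⟨ρ, -, e⟩ := toSpace_eq_iff.mp h.symm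
  obtain ⟨n, n', hnn, k, hk⟩ := ha.exists_int
  rw [e] at hk
  exact hint _ _ (fun h => hnn (ρ.symm.injective h)) k hk

end IdealTriangulation

/-! ### The colored domains -/

section

variable {r : ℝ}

theorem isHalf_of_eq {n : ℤ} (h0 : 0 ≤ r) (h : r = n + 1 / 2) : IsHalf r := by
  have : (-1 : ℤ) < n := by
    have : (-1 : ℝ) < n := by linarith
    exact_mod_cast this
  refine ⟨n.toNat, ?_⟩
  have h2 : ((n.toNat : ℤ) : ℝ) = n := by rw [Int.toNat_of_nonneg (by omega)]
  rw [Int.cast_natCast] at h2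
  rw [h2, h]

theorem IsHalf.pos (h : IsHalf r) : 0 < r := by
  obtain ⟨k, rfl⟩ := h; positivity

theorem abs_sub_round_lt (h0 : 0 ≤ r) (h : ¬ IsHalf r) : |r - round r| < 1 / 2 := by
  refine (abs_sub_round r).lt_of_ne fun e => h ?_
  rcases (abs_eq (by norm_num)).mp e with e | e
  · exact isHalf_of_eq (n := round r) h0 (by linarith)
  · exact isHalf_of_eq (n := round r - 1) h0 (by push_cast; linarith)

theorem round_eq_of_abs_sub_lt {n : ℤ} (h : |r - n| < 1 / 2) : round r = n := by
  rw [abs_lt] at h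
  exact round_eq_iff.mpr ⟨by linarith, by linarith⟩

theorem not_isHalf_of_abs_sub_lt {n : ℤ} (h : |r - n| < 1 / 2) : ¬ IsHalf r := by
  rintro ⟨k, rfl⟩
  rw [abs_lt] at h
  have h1 : (-1 : ℝ) < k - n := by linarith
  have h2 : (k - n : ℝ) < 0 := by linarith
  have h1 : (-1 : ℤ) < k - n := by exact_mod_cast h1
  have h2 : (k - n : ℤ) < 0 := by exact_mod_cast h2
  omega

/-- The sum of the integers nearest to the coordinates. -/
def roundSum (x : Fin 4 → ℝ) : ℤ := ∑ i, round (x i)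

theorem roundSum_comp (x : Fin 4 → ℝ) (ρ : Equiv.Perm (Fin 4)) :
    roundSum (x ∘ ρ) = roundSum x := Equiv.sum_comp ρ fun i => round (x i)

theorem sum_eq_add_sum_erase (i : Fin 4) (f : Fin 4 → ℝ) :
    ∑ j, f j = f i + ∑ j ∈ Finset.univ.erase i, f j :=
  (Finset.add_sum_erase _ f (Finset.mem_univ i)).symm

theorem abs_sum_erase_lt {i : Fin 4} {f : Fin 4 → ℝ} (h : ∀ j ≠ i, |f j| < 1 / 2) :
    |∑ j ∈ Finset.univ.erase i, f j| < 3 / 2 := by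
  have hc : (Finset.univ.erase i).card = 3 := by
    rw [Finset.card_erase_of_mem (Finset.mem_univ i)]; rfl
  have hne : (Finset.univ.erase i).Nonempty := Finset.card_pos.mp (by omega)
  refine (Finset.abs_sum_le_sum_abs _ _).trans_lt ?_
  refine (Finset.sum_lt_sum_of_nonempty hne fun j hj =>
    h j (Finset.ne_of_mem_erase hj)).trans_le ?_
  rw [Finset.sum_const, hc]; norm_num

/-- Four rounding errors below `1/2` add up to less than two. The value `m` will be that of the
mixed domains, `m - 1` and `m + 1` those of the two kinds of colored ones. -/
theorem roundSum_cases {m : ℕ} {x : Fin 4 → ℝ} (hx : InSimplex m x) (h : ∀ i, ¬ IsHalf (x i)) :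
    roundSum x = m - 1 ∨ roundSum x = m ∨ roundSum x = m + 1 := by
  have h1 : ∀ j, |x j - round (x j)| < 1 / 2 := fun j => abs_sub_round_lt (hx.1 j) (h j)
  have h2 := abs_lt.mp (abs_sum_erase_lt (i := 0) (f := fun j => x j - round (x j)) fun j _ => h1 j)
  have h3 := abs_lt.mp (h1 0)
  have h4 := sum_eq_add_sum_erase 0 fun j => x j - round (x j)
  rw [Finset.sum_sub_distrib, hx.2, ← Int.cast_sum, ← roundSum] at h4
  have h5 : (m - 2 : ℝ) < roundSum x := by linarith
  have h6 : (roundSum x : ℝ) < m + 2 := by linarith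
  have h5 : (m - 2 : ℤ) < roundSum x := by exact_mod_cast h5
  have h6 : roundSum x < m + 2 := by exact_mod_cast h6
  omega

theorem eventually_subtype_abs_iff {S : (Fin 4 → ℝ) → Prop} {x : {x // S x}}
    {P : {x // S x} → Prop} : (∀ᶠ y in 𝓝 x, P y) ↔
      ∃ ε > 0, ∀ y (hy : S y), (∀ j, |y j - x.1 j| < ε) → P ⟨y, hy⟩ := by
  rw [Metric.eventually_nhds_iff]
  refine exists_congr fun ε => and_congr_right fun hε => ?_
  simp only [Subtype.forall, Subtype.dist_eq, dist_pi_lt_iff hε, Real.dist_eq]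

end

namespace IdealTriangulation

variable {τ : IdealTriangulation.{u}} {m : ℕ}

theorem inTet_of_pos {t : τ.Tet} {x : Fin 4 → ℝ} (h : ∀ i, 0 < x i) (hs : ∑ i, x i = m) :
    τ.InTet m t x := by
  refine ⟨fun i => (h i).le, hs, ?_⟩
  have : Function.support x = univ := by ext i; simpa using (h i).ne'
  rw [this]; exact τ.mem_univ t

theorem Path.eq_of_ne_zero {t t' : τ.Tet} {x : Fin 4 → ℝ} {ρ : Equiv.Perm (Fin 4)}
    (h : τ.Path t x t' ρ) (hx : ∀ i, x i ≠ 0) : t' = t ∧ ρ = 1 := by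
  induction h with
  | refl => exact ⟨rfl, rfl⟩
  | step _ _ hj _ => exact absurd hj (hx _)

theorem eq_of_toSpace_eq {p p' : τ.Point m} (hp : ∀ i, 0 < p.2.1 i)
    (h : τ.toSpace m p = τ.toSpace m p') : p' = p := by
  obtain ⟨ρ, h, e⟩ := toSpace_eq_iff.mp h
  obtain ⟨t, x, hx⟩ := p
  obtain ⟨t', x', hx'⟩ := p'
  obtain ⟨h1, rfl⟩ := h.eq_of_ne_zero fun i => (hp i).ne'
  dsimp only at h1 e
  subst h1
  have : x' = x := e
  subst this
  rfl

theorem mem_diagram_iff {p : τ.Point m} :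
    τ.toSpace m p ∈ τ.diagram m ↔ ∃ i, IsHalf (p.2.1 i) := by
  constructor
  · rintro ⟨p', h, i, hi⟩
    obtain ⟨ρ, -, e⟩ := toSpace_eq_iff.mp h
    exact ⟨ρ i, by rw [e]; simpa⟩
  · rintro ⟨i, hi⟩
    exact ⟨p, rfl, i, hi⟩

theorem notMem_diagram_iff {p : τ.Point m} :
    τ.toSpace m p ∉ τ.diagram m ↔ ∀ i, ¬ IsHalf (p.2.1 i) := by
  rw [mem_diagram_iff, not_exists]

theorem roundSum_eq {p p' : τ.Point m} (h : τ.toSpace m p = τ.toSpace m p') :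
    roundSum p'.2.1 = roundSum p.2.1 := by
  obtain ⟨ρ, -, e⟩ := toSpace_eq_iff.mp h
  rw [e]; exact roundSum_comp _ _

theorem domain_subset {z : τ.Space m} : τ.domain m z ⊆ (τ.diagram m)ᶜ :=
  connectedComponentIn_subset _ _

theorem mem_domain_self {z : τ.Space m} (h : z ∉ τ.diagram m) : z ∈ τ.domain m z :=
  mem_connectedComponentIn h

/-- Off the planes the nearest integers are locally constant, and gluings only permute the
coordinates; so the sum is constant on connected sets avoiding the diagram. -/
theorem roundSum_eq_of_mem_domain {p p' : τ.Point m} (hp : τ.toSpace m p ∉ τ.diagram m)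
    (h : τ.toSpace m p' ∈ τ.domain m (τ.toSpace m p)) : roundSum p'.2.1 = roundSum p.2.1 := by
  let s : τ.Space m → τ.Point m := Function.surjInv surjective_toSpace
  have hs : ∀ z, τ.toSpace m (s z) = z := Function.surjInv_eq surjective_toSpace
  have hc : ContinuousOn (fun z => roundSum (s z).2.1) (τ.domain m (τ.toSpace m p)) := by
    intro z hz
    refine ContinuousAt.continuousWithinAt ?_
    refine (tendsto_const_nhds (x := roundSum (s z).2.1)).congr' (eventually_space ?_)
    rintro ⟨t, x⟩ rfl
    rw [eventually_point_iff]
    have hx := notMem_diagram_iff.mp (domain_subset hz)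
    have h1 : ∀ i, ∀ᶠ y : {x // τ.InTet m t x} in 𝓝 x, round (y.1 i) = round (x.1 i) := by
      intro i
      have hc : Continuous fun y : {x // τ.InTet m t x} => |y.1 i - round (x.1 i)| :=
        (((continuous_apply i).comp continuous_subtype_val).sub continuous_const).abs
      filter_upwards [hc.continuousAt.eventually_lt continuousAt_const
        (abs_sub_round_lt (x.2.1 i) (hx i))] with y hy
      exact round_eq_of_abs_sub_lt hy
    filter_upwards [eventually_all.mpr h1] with y hy
    rw [roundSum_eq (hs (τ.toSpace m ⟨t, x⟩)).symm, roundSum_eq (hs (τ.toSpace m ⟨t, y⟩)).symm]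
    exact Finset.sum_congr rfl fun i _ => (hy i).symm
  have := isPreconnected_connectedComponentIn.constant hc h (mem_domain_self hp)
  rwa [roundSum_eq (hs (τ.toSpace m p)).symm, roundSum_eq (hs (τ.toSpace m p')).symm] at this

theorem mem_domain_of_convex {t : τ.Tet} {K : Set (Fin 4 → ℝ)} (hK : Convex ℝ K)
    (hin : ∀ y ∈ K, τ.InTet m t y) (hoff : ∀ y ∈ K, ∀ i, ¬ IsHalf (y i)) {z : τ.Space m}
    {x y : {x // τ.InTet m t x}} (hx : x.1 ∈ K) (hy : y.1 ∈ K)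
    (h : τ.toSpace m ⟨t, x⟩ ∈ τ.domain m z) : τ.toSpace m ⟨t, y⟩ ∈ τ.domain m z := by
  have : PreconnectedSpace K := Subtype.preconnectedSpace hK.isPreconnected
  let f : K → τ.Space m := fun y => τ.toSpace m ⟨t, y, hin y y.2⟩
  have hf : Continuous f := continuous_toSpace.comp ((continuous_sigmaMk
    (σ := fun t => {x // τ.InTet m t x}) (i := t)).comp
      (Continuous.subtype_mk continuous_subtype_val _))
  rw [domain, connectedComponentIn_eq h]
  refine (isPreconnected_range hf).subset_connectedComponentIn (mem_range_self ⟨x.1, hx⟩) ?_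
    (mem_range_self ⟨y.1, hy⟩)
  rintro _ ⟨y, rfl⟩
  exact notMem_diagram_iff.mpr (hoff y y.2)

theorem exists_near_of_mem_closure {p : τ.Point m} (hp : ∀ i, 0 < p.2.1 i) {C : Set (τ.Space m)}
    (h : τ.toSpace m p ∈ closure C) {ε : ℝ} (hε : 0 < ε) :
    ∃ y, ∃ hy : τ.InTet m p.1 y, (∀ j, |y j - p.2.1 j| < ε) ∧ τ.toSpace m ⟨p.1, y, hy⟩ ∈ C := by
  by_contra! H
  have : ∀ᶠ z in 𝓝 (τ.toSpace m p), z ∉ C := by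
    refine eventually_space fun p' hp' => ?_
    obtain rfl := eq_of_toSpace_eq hp hp'.symm
    obtain ⟨t, x⟩ := p'
    rw [eventually_point_iff, eventually_subtype_abs_iff]
    exact ⟨ε, hε, H⟩
  exact mem_closure_iff_frequently.mp h this

/-- `q` is a corner of the cube of half-width `1/2` about the nearest integers to `p`. The segment
from `p` to `q` is inside the open cube, hence off the planes, until its very end. -/
theorem isVertexOf_of_abs_le {p : τ.Point m} (hp : τ.toSpace m p ∉ τ.diagram m) {q : Fin 4 → ℝ}
    (hq : ∀ j, IsHalf (q j)) (hs : ∑ j, q j = m) (h : ∀ j, |q j - round (p.2.1 j)| ≤ 1 / 2) :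
    ∃ q, τ.IsVertexOf m (τ.domain m (τ.toSpace m p)) q := by
  obtain ⟨t, x, hx⟩ := p
  have hqt : τ.InTet m t q := inTet_of_pos (fun j => (hq j).pos) hs
  refine ⟨⟨t, q, hqt⟩, hq, ?_⟩
  have hoff := notMem_diagram_iff.mp hp
  dsimp only at h hoff
  let y : ℝ → Fin 4 → ℝ := fun s j => x j + s * (q j - x j)
  have hpos : ∀ s, 0 < s → s < 1 → ∀ j, 0 < y s j := by
    intro s h0 h1 j
    have := hx.1 j
    have := (hq j).pos
    simp only [y]; nlinarith
  have hy : ∀ s, 0 ≤ s → s < 1 → τ.InTet m t (y s) := by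
    intro s h0 h1
    rcases h0.eq_or_lt with rfl | h0
    · have : y 0 = x := by ext j; simp [y]
      rwa [this]
    · refine inTet_of_pos (hpos s h0 h1) ?_
      simp only [y, Finset.sum_add_distrib, ← Finset.mul_sum, Finset.sum_sub_distrib, hs, hx.2.1]
      ring
  have hyr : ∀ s, 0 ≤ s → s < 1 → ∀ j, |y s j - round (x j)| < 1 / 2 := by
    intro s h0 h1 j
    have h2 := abs_lt.mp (abs_sub_round_lt (hx.1 j) (hoff j))
    have h3 := abs_le.mp (h j)
    have e : y s j - round (x j) = (1 - s) * (x j - round (x j)) + s * (q j - round (x j)) := by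
      simp only [y]; ring
    rw [e, abs_lt]
    constructor <;> nlinarith
  have hconv : Convex ℝ (y '' Ico 0 1) := by
    have : y = AffineMap.lineMap x q := by
      ext s j
      simp [y, AffineMap.lineMap_apply]; ring
    rw [this]
    exact (convex_Ico 0 1).affine_image _
  have hmem : ∀ s (hs : s ∈ Ico (0 : ℝ) 1), τ.toSpace m ⟨t, y s, hy s hs.1 hs.2⟩ ∈
      τ.domain m (τ.toSpace m ⟨t, x, hx⟩) := by
    intro s hs
    refine mem_domain_of_convex hconv ?_ ?_ (x := ⟨x, hx⟩) ⟨0, by simp, by ext j; simp [y]⟩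
      (mem_image_of_mem _ hs) (mem_domain_self hp)
    · rintro _ ⟨s, hs, rfl⟩; exact hy s hs.1 hs.2
    · rintro _ ⟨s, hs, rfl⟩ j; exact not_isHalf_of_abs_sub_lt (hyr s hs.1 hs.2 j)
  rw [mem_closure_iff_frequently]
  intro H
  have hc := continuous_toSpace.continuousAt.eventually H
  rw [eventually_point_iff, eventually_subtype_abs_iff] at hc
  obtain ⟨ε, hε, hc⟩ := hc
  have hyc : Continuous y := by fun_prop
  have hy1 : y 1 = q := by ext j; simp [y]
  have h1 : ∀ᶠ s in 𝓝[<] (1 : ℝ), ∀ j, |y s j - q j| < ε := by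
    refine nhdsWithin_le_nhds (eventually_all.mpr fun j => ?_)
    have : Continuous fun s => |y s j - q j| := by fun_prop
    exact this.continuousAt.eventually_lt continuousAt_const (by simpa [hy1])
  obtain ⟨s, hs1, hs2⟩ := (h1.and (Ico_mem_nhdsLT (zero_lt_one' ℝ))).exists
  exact hc _ (hy s hs2.1 hs2.2) hs1 (hmem s hs2)

theorem exists_isVertexOf (hm : 2 ≤ m) {p : τ.Point m} (hp : τ.toSpace m p ∉ τ.diagram m)
    (h : roundSum p.2.1 ≠ m) : ∃ q, τ.IsVertexOf m (τ.domain m (τ.toSpace m p)) q := by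
  have hx := p.2.2.inSimplex
  have hoff := notMem_diagram_iff.mp hp
  have hrd : ∀ j, |p.2.1 j - round (p.2.1 j)| < 1 / 2 := fun j =>
    abs_sub_round_lt (hx.1 j) (hoff j)
  have h0 : ∀ j, 0 ≤ round (p.2.1 j) := fun j => by
    have := (abs_lt.mp (hrd j)).2
    have := hx.1 j
    have : (-1 : ℝ) < round (p.2.1 j) := by linarith
    have : (-1 : ℤ) < round (p.2.1 j) := by exact_mod_cast this
    omega
  set a : Fin 4 → ℤ := fun j => round (p.2.1 j) with ha
  have hsum : ∑ j, a j = roundSum p.2.1 := rfl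
  -- The quadruple point shifts every nearest integer by `σ / 2`, except the one at `i`, shifted by
  -- `-σ / 2`; the total shift `σ` corrects the sum `m - σ` to `m`. The other conditions keep
  -- downward shifts nonnegative.
  have key : ∀ (i : Fin 4) (σ : ℝ), (σ = 1 ∨ σ = -1) → (∀ j, j ≠ i → σ = -1 → 1 ≤ a j) →
      (σ = 1 → 1 ≤ a i) → (roundSum p.2.1 : ℝ) = m - σ →
      ∃ q, τ.IsVertexOf m (τ.domain m (τ.toSpace m p)) q := by
    intro i σ hσ h1 h2 h3
    refine isVertexOf_of_abs_le hp (q := fun j => if j = i then a j - σ / 2 else a j + σ / 2)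
      (fun j => ?_) ?_ fun j => ?_
    · have h0j : (0 : ℝ) ≤ a j := by exact_mod_cast h0 j
      by_cases hj : j = i
      · subst hj
        rw [if_pos rfl]
        rcases hσ with rfl | rfl
        · have := h2 rfl
          have : (1 : ℝ) ≤ a j := by exact_mod_cast this
          exact isHalf_of_eq (n := a j - 1) (by linarith) (by push_cast; ring)
        · exact isHalf_of_eq (n := a j) (by linarith) (by ring)
      · rw [if_neg hj]
        rcases hσ with rfl | rfl
        · exact isHalf_of_eq (n := a j) (by linarith) (by ring)
        · have := h1 j hj rfl
          have : (1 : ℝ) ≤ a j := by exact_mod_cast this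
          exact isHalf_of_eq (n := a j - 1) (by linarith) (by push_cast; ring)
    · have : ∀ j, (if j = i then a j - σ / 2 else a j + σ / 2 : ℝ) =
          a j + (σ / 2 - if j = i then σ else 0) := fun j => by split_ifs <;> ring
      simp_rw [this, Finset.sum_add_distrib, Finset.sum_sub_distrib]
      rw [← Int.cast_sum, hsum, h3]
      simp
      ring
    · split_ifs <;> rcases hσ with rfl | rfl <;> simp [ha, abs_le] <;> norm_num
  rcases roundSum_cases hx hoff with e | e | e
  · obtain ⟨i, hi⟩ : ∃ i, 1 ≤ a i := by
      by_contra! H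
      have : ∑ j, a j ≤ 0 := Finset.sum_nonpos fun j _ => by have := H j; omega
      omega
    exact key i 1 (Or.inl rfl) (by norm_num) (fun _ => hi) (by rw [e]; push_cast; ring)
  · exact absurd e h
  · obtain ⟨i, hi⟩ : ∃ i, ∀ j, j ≠ i → 1 ≤ a j := by
      -- Otherwise two nearest integers vanish. Their rounding errors are then nonnegative, and the
      -- other two are greater than `-1/2` each, while the four must sum to `-1`.
      by_contra! H
      obtain ⟨i, -, hi⟩ := H 0
      obtain ⟨j, hji, hj⟩ := H i
      obtain ⟨r, s, -, -, -, -, -, hS⟩ := exists_sum_eq_of_ne hji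
      have h1 := hS fun n => p.2.1 n - a n
      rw [Finset.sum_sub_distrib, hx.2, ← Int.cast_sum, hsum, e] at h1
      have hi0 : a i = 0 := by have := h0 i; simp only [ha] at hi ⊢; omega
      have hj0 : a j = 0 := by have := h0 j; simp only [ha] at hj ⊢; omega
      rw [hi0, hj0] at h1
      have h2 := (abs_lt.mp (hrd r)).1
      have h3 := (abs_lt.mp (hrd s)).1
      have h4 := hx.1 i
      have h5 := hx.1 j
      push_cast at h1
      simp only [ha] at h1
      linarith
    exact key i (-1) (Or.inr rfl) (fun j hj _ => hi j hj) (by norm_num) (by rw [e]; push_cast; ring)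


/-- Near `p` the plane separates just two half-balls. If `b` is the rounded sum on the side of
smaller `xᵢ`, it is `b + 1` on the other side, and since three rounding errors add up to less than
`3/2`, `b` is `m - 1` or `m`. The side occupied by the domain decides the coorientation and
restricts its invariant. -/
theorem face_cases {z₀ : τ.Point m} (hz₀ : τ.toSpace m z₀ ∉ τ.diagram m) {p : τ.Point m}
    (hp : ∀ j, 0 < p.2.1 j) {i : Fin 4}
    (h : τ.IsFacePoint m (τ.domain m (τ.toSpace m z₀)) p i) :
    (τ.CoorientedIn m (τ.domain m (τ.toSpace m z₀)) p i ∧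
      (roundSum z₀.2.1 = m ∨ roundSum z₀.2.1 = m - 1)) ∨
    (τ.CoorientedOut m (τ.domain m (τ.toSpace m z₀)) p i ∧
      (roundSum z₀.2.1 = m ∨ roundSum z₀.2.1 = m + 1)) := by
  obtain ⟨hcl, ⟨k, hk⟩, hoff⟩ := h
  set C := τ.domain m (τ.toSpace m z₀) with hC
  have hx := p.2.2.inSimplex
  have hrd : ∀ j ≠ i, |p.2.1 j - round (p.2.1 j)| < 1 / 2 := fun j hj =>
    abs_sub_round_lt (hx.1 j) (hoff j hj)
  obtain ⟨ε, hε, hε'⟩ : ∃ ε > 0, ∀ y : Fin 4 → ℝ, (∀ j, |y j - p.2.1 j| < ε) →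
      (∀ j, 0 < y j) ∧ (∀ j ≠ i, |y j - round (p.2.1 j)| < 1 / 2) ∧ |y i - p.2.1 i| < 1 := by
    have h1 : ∀ᶠ y : Fin 4 → ℝ in 𝓝 p.2.1, (∀ j, 0 < y j) ∧ (∀ j, j ≠ i → |y j - round (p.2.1 j)| < 1 / 2) ∧
        |y i - p.2.1 i| < 1 := by
      refine (eventually_all.mpr fun j => ?_).and ((eventually_all.mpr fun j => ?_).and ?_)
      · exact (continuous_apply j).continuousAt.eventually (lt_mem_nhds (hp j))
      · by_cases hj : j = i
        · exact Eventually.of_forall fun _ h => absurd hj h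
        have hc : Continuous fun y : Fin 4 → ℝ => |y j - round (p.2.1 j)| := by fun_prop
        filter_upwards [hc.continuousAt.eventually_lt continuousAt_const (hrd j hj)] with y hy _
        exact hy
      · have hc : Continuous fun y : Fin 4 → ℝ => |y i - p.2.1 i| := by fun_prop
        exact hc.continuousAt.eventually_lt continuousAt_const (by simp)
    obtain ⟨ε, hε, h⟩ := Metric.eventually_nhds_iff.mp h1
    exact ⟨ε, hε, fun y hy => h ((dist_pi_lt_iff hε).mpr hy)⟩
  let K : Set (Fin 4 → ℝ) := {y | (∀ j, |y j - p.2.1 j| < ε) ∧ ∑ j, y j = m}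
  have hKc : Convex ℝ K := by
    intro y hy w hw a b ha hb hab
    refine ⟨fun j => ?_, ?_⟩
    · have h1 := abs_lt.mp (hy.1 j)
      have h2 := abs_lt.mp (hw.1 j)
      have e : (a • y + b • w) j - p.2.1 j = a * (y j - p.2.1 j) + b * (w j - p.2.1 j) := by
        simp only [Pi.add_apply, Pi.smul_apply, smul_eq_mul]
        linear_combination (p.2.1 j) * hab
      rw [e, abs_lt]
      rcases ha.eq_or_lt with rfl | ha
      · rw [zero_add] at hab; subst hab; constructor <;> linarith
      · constructor <;> nlinarith
    · simp only [Pi.add_apply, Pi.smul_apply, smul_eq_mul, Finset.sum_add_distrib,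
        ← Finset.mul_sum, hy.2, hw.2]
      rw [← add_mul, hab, one_mul]
  have hKin : ∀ y ∈ K, τ.InTet m p.1 y := fun y hy => inTet_of_pos (hε' y hy.1).1 hy.2
  set b : ℤ := k + ∑ j ∈ Finset.univ.erase i, round (p.2.1 j) with hb
  have hbm : b = m ∨ b = m - 1 := by
    have h1 := abs_lt.mp (abs_sum_erase_lt (f := fun j => p.2.1 j - round (p.2.1 j)) hrd)
    have h2 := sum_eq_add_sum_erase i p.2.1
    rw [hx.2, hk] at h2
    rw [Finset.sum_sub_distrib, ← Int.cast_sum] at h1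
    have h3 : (b : ℝ) = k + ((∑ j ∈ Finset.univ.erase i, round (p.2.1 j) : ℤ) : ℝ) := by
      rw [hb]; push_cast; ring
    have h4 : (m - 2 : ℝ) < b := by linarith
    have h5 : (b : ℝ) < m + 1 := by linarith
    have h4 : (m - 2 : ℤ) < b := by exact_mod_cast h4
    have h5 : b < m + 1 := by exact_mod_cast h5
    omega
  have hlow : ∀ y ∈ K, y i < p.2.1 i → |y i - (k : ℤ)| < 1 / 2 := fun y hy hyi => by
    have := abs_lt.mp (hε' y hy.1).2.2
    rw [Int.cast_natCast, abs_lt]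
    constructor <;> linarith
  have hhigh : ∀ y ∈ K, p.2.1 i < y i → |y i - (k + 1 : ℤ)| < 1 / 2 := fun y hy hyi => by
    have := abs_lt.mp (hε' y hy.1).2.2
    push_cast
    rw [abs_lt]
    constructor <;> linarith
  have hsum : ∀ y ∈ K, ∀ n : ℤ, |y i - n| < 1 / 2 → (∀ j, ¬ IsHalf (y j)) ∧
      roundSum y = b + (n - k) := by
    intro y hy n hn
    have h1 := (hε' y hy.1).2.1
    refine ⟨fun j => ?_, ?_⟩
    · by_cases hj : j = i
      · subst hj; exact not_isHalf_of_abs_sub_lt hn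
      · exact not_isHalf_of_abs_sub_lt (h1 j hj)
    · rw [roundSum, ← Finset.add_sum_erase _ _ (Finset.mem_univ i), round_eq_of_abs_sub_lt hn, hb,
        Finset.sum_congr rfl fun j hj => round_eq_of_abs_sub_lt (h1 j (Finset.ne_of_mem_erase hj))]
      ring
  obtain ⟨y, hyt, hy, hyC⟩ := exists_near_of_mem_closure hp hcl hε
  have hyK : y ∈ K := ⟨hy, hyt.2.1⟩
  have hyr := roundSum_eq_of_mem_domain hz₀ hyC
  dsimp only at hyr
  rcases lt_trichotomy (y i) (p.2.1 i) with hyi | hyi | hyi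
  · left
    refine ⟨?_, ?_⟩
    · rw [CoorientedIn, eventually_subtype_abs_iff]
      refine ⟨ε, hε, fun w hw hwε hwi => ?_⟩
      refine mem_domain_of_convex (K := K ∩ {w | w i < p.2.1 i})
        (hKc.inter (convex_halfSpace_lt (LinearMap.isLinear (LinearMap.proj i)) _))
        (fun y hy => hKin y hy.1) (fun y hy => (hsum y hy.1 k (hlow y hy.1 hy.2)).1)
        (x := ⟨y, hyt⟩) ⟨hyK, hyi⟩ ⟨⟨hwε, hw.2.1⟩, hwi⟩ hyC
    · rw [(hsum y hyK k (hlow y hyK hyi)).2] at hyr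
      omega
  · exact absurd ⟨k, hyi.trans hk⟩ (notMem_diagram_iff.mp (domain_subset hyC) i)
  · right
    refine ⟨?_, ?_⟩
    · rw [CoorientedOut, eventually_subtype_abs_iff]
      refine ⟨ε, hε, fun w hw hwε hwi => ?_⟩
      refine mem_domain_of_convex (K := K ∩ {w | p.2.1 i < w i})
        (hKc.inter (convex_halfSpace_gt (LinearMap.isLinear (LinearMap.proj i)) _))
        (fun y hy => hKin y hy.1) (fun y hy => (hsum y hy.1 (k + 1) (hhigh y hy.1 hy.2)).1)
        (x := ⟨y, hyt⟩) ⟨hyK, hyi⟩ ⟨⟨hwε, hw.2.1⟩, hwi⟩ hyC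
    · rw [(hsum y hyK (k + 1) (hhigh y hyK hyi)).2] at hyr
      omega

theorem consistentAt_of_ne {z₀ : τ.Point m} (hz₀ : τ.toSpace m z₀ ∉ τ.diagram m)
    (h : roundSum z₀.2.1 ≠ m) {q : τ.Point m} (hq : ∀ i, IsHalf (q.2.1 i)) :
    τ.ConsistentAt m (τ.domain m (τ.toSpace m z₀)) q := by
  have hpos : ∀ᶠ p : τ.Point m in 𝓝 q, ∀ j, 0 < p.2.1 j := by
    obtain ⟨t, x⟩ := q
    rw [eventually_point_iff]
    refine eventually_all.mpr fun j => ?_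
    exact ((continuous_apply j).comp continuous_subtype_val).continuousAt.eventually
      (lt_mem_nhds (hq j).pos)
  rcases roundSum_cases z₀.2.2.inSimplex (notMem_diagram_iff.mp hz₀) with e | e | e
  · left
    filter_upwards [hpos] with p hp i hi
    rcases face_cases hz₀ hp hi with h | h
    · exact h.1
    · omega
  · exact absurd e h
  · right
    filter_upwards [hpos] with p hp i hi
    rcases face_cases hz₀ hp hi with h | h
    · omega
    · exact h.1


/-- The sign `σ` treats both coorientations at once. When the rounded sum is `m`, exactly two
coordinates `i`, `l` of a point `y` of the domain near `q` deviate from `q` with sign `σ`. Sliding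
weight between them brings `i` to its plane while `l` keeps its sign: a face with the domain on the
side `σ`. Consistency would put the other side in the domain too, but there the rounded sum has
changed. -/
theorem not_consistentAt_aux {z₀ : τ.Point m} (hz₀ : τ.toSpace m z₀ ∉ τ.diagram m)
    (h : roundSum z₀.2.1 = m) {q : τ.Point m} (hq : ∀ i, IsHalf (q.2.1 i))
    (hcl : τ.toSpace m q ∈ closure (τ.domain m (τ.toSpace m z₀))) {σ : ℝ} (hσ : σ = 1 ∨ σ = -1)
    (H : ∀ᶠ p : τ.Point m in 𝓝 q, ∀ i, τ.IsFacePoint m (τ.domain m (τ.toSpace m z₀)) p i →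
      ∀ᶠ y in 𝓝 p.2, σ * y.1 i < σ * p.2.1 i →
        τ.toSpace m ⟨p.1, y⟩ ∈ τ.domain m (τ.toSpace m z₀)) : False := by
  obtain ⟨t, q, hqt⟩ := q
  rw [eventually_point_iff, eventually_subtype_abs_iff] at H
  obtain ⟨ε, hε, H⟩ := H
  have hσ2 : σ * σ = 1 := by rcases hσ with rfl | rfl <;> norm_num
  have habs : ∀ r, |σ * r| = |r| := fun r => by
    rw [abs_mul]; rcases hσ with rfl | rfl <;> simp
  -- The bound `ε / 2` keeps the face point within `ε` of `q`, since the coordinate `l` there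
  -- collects two deviations; `1/8` leaves room for three while staying within `1/2` of `q`.
  obtain ⟨y, hyt, hy, hyC⟩ := exists_near_of_mem_closure (fun j => (hq j).pos) hcl
    (lt_min (by positivity : 0 < ε / 2) (by norm_num : (0 : ℝ) < 1 / 8))
  dsimp only at hq hy hyC
  have hy1 : ∀ j, |y j - q j| < 1 / 8 := fun j => (hy j).trans_le (min_le_right _ _)
  have hy2 : ∀ j, |y j - q j| < ε / 2 := fun j => (hy j).trans_le (min_le_left _ _)
  have hy0 : ∀ j, y j ≠ q j := fun j e =>
    notMem_diagram_iff.mp (domain_subset hyC) j (by dsimp only; rw [e]; exact hq j)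
  have hq2 : ∀ j, 1 / 2 ≤ q j := fun j => by
    obtain ⟨k, hk⟩ := hq j
    rw [hk]
    have : (0 : ℝ) ≤ k := k.cast_nonneg
    linarith
  have hside : ∀ (j : Fin 4) (r s : ℝ), (s = 1 ∨ s = -1) → 0 < s * (r - q j) → |r - q j| < 1 →
      (round r : ℝ) = q j + s / 2 := by
    intro j r s hs h0 h1
    obtain ⟨k, hk⟩ := hq j
    rw [abs_lt] at h1
    rcases hs with rfl | rfl
    · rw [round_eq_of_abs_sub_lt (n := k + 1)]
      · push_cast; linarith
      · push_cast; rw [abs_lt]; constructor <;> linarith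
    · rw [round_eq_of_abs_sub_lt (n := k)]
      · push_cast; linarith
      · push_cast; rw [abs_lt]; constructor <;> linarith
  have hnear : ∀ (j : Fin 4) (r : ℝ), r ≠ q j → |r - q j| < 1 → ¬ IsHalf r := by
    rintro j r h0 h1 ⟨k', rfl⟩
    obtain ⟨k, hk⟩ := hq j
    rw [hk, abs_lt] at h1
    have h2 : (-1 : ℝ) < k' - k := by linarith
    have h3 : (k' - k : ℝ) < 1 := by linarith
    have h2 : (-1 : ℤ) < k' - k := by exact_mod_cast h2
    have h3 : (k' - k : ℤ) < 1 := by exact_mod_cast h3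
    have : k' = k := by omega
    exact h0 (by rw [hk, this])
  -- two of the four coordinates of `y - q` have the sign `σ`
  have hround : ∀ j, (round (y j) : ℝ) =
      q j + σ * ((if 0 < σ * (y j - q j) then 1 else 0) - 1 / 2) := by
    intro j
    split_ifs with hj
    · rw [hside j _ σ hσ hj ((hy1 j).trans (by norm_num))]; ring
    · have h1 : σ * (y j - q j) ≠ 0 := mul_ne_zero (by rintro rfl; norm_num at hσ2)
        (sub_ne_zero.mpr (hy0 j))
      rw [hside j _ (-σ) (by rcases hσ with rfl | rfl <;> norm_num)
        (by push Not at hj; have := lt_of_le_of_ne hj h1; linarith)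
        ((hy1 j).trans (by norm_num))]; ring
  have hyr : roundSum y = m := (roundSum_eq_of_mem_domain hz₀ hyC).trans h
  have hcard : (Finset.univ.filter fun j => 0 < σ * (y j - q j)).card = 2 := by
    have h1 : (∑ j, (round (y j) : ℝ)) = m := by
      rw [← Int.cast_sum]; exact_mod_cast congrArg (Int.cast : ℤ → ℝ) hyr
    simp_rw [hround] at h1
    rw [Finset.sum_add_distrib, hqt.2.1, ← Finset.mul_sum, Finset.sum_sub_distrib,
      Finset.sum_boole] at h1
    simp only [Finset.sum_const, Finset.card_univ, Fintype.card_fin] at h1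
    have h2 : ((Finset.univ.filter fun j => 0 < σ * (y j - q j)).card : ℝ) = 2 := by
      have h3 : σ * σ * ((Finset.univ.filter fun j => 0 < σ * (y j - q j)).card - 4 * (1 / 2)) =
        0 := by
        rw [mul_assoc]
        rw [nsmul_eq_mul] at h1
        push_cast at h1
        rw [show σ * (((Finset.univ.filter fun j => 0 < σ * (y j - q j)).card : ℝ) -
          4 * (1 / 2)) = 0 by linarith, mul_zero]
      rw [hσ2] at h3
      linarith
    exact_mod_cast h2
  obtain ⟨i, l, hil, hset⟩ := Finset.card_eq_two.mp hcard
  have hi : 0 < σ * (y i - q i) := by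
    have : i ∈ Finset.univ.filter fun j => 0 < σ * (y j - q j) := by rw [hset]; simp
    simpa using this
  have hl : 0 < σ * (y l - q l) := by
    have : l ∈ Finset.univ.filter fun j => 0 < σ * (y j - q j) := by rw [hset]; simp
    simpa using this
  obtain ⟨r₁, r₂, hr1, hr2, hr3, hr4, hr5, hS⟩ := exists_sum_eq_of_ne hil
  -- moving from `y` in the direction of `e i - e l`
  let w : ℝ → Fin 4 → ℝ := fun s j => if j = i then q i + s else if j = l then
    y l + (y i - q i) - s else y j
  have wi : ∀ s, w s i = q i + s := fun s => by simp [w]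
  have wl : ∀ s, w s l = y l + (y i - q i) - s := fun s => by simp [w, hil.symm]
  have wj : ∀ s j, j ≠ i → j ≠ l → w s j = y j := fun s j h1 h2 => by simp [w, h1, h2]
  have hwsum : ∀ s, ∑ j, w s j = m := fun s => by
    rw [hS, wi, wl, wj s r₁ hr1.symm hr3.symm, wj s r₂ hr2.symm hr4.symm]
    have := hS y
    rw [hyt.2.1] at this
    linarith
  have hyi := abs_lt.mp (hy1 i)
  have hyl := abs_lt.mp (hy1 l)
  have hwnear : ∀ s, |s| ≤ 1 / 8 → ∀ j, |w s j - q j| < 1 / 2 := by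
    intro s hs j
    rw [abs_le] at hs
    by_cases hji : j = i
    · rw [hji, wi, abs_lt]; constructor <;> linarith
    by_cases hjl : j = l
    · rw [hjl, wl, abs_lt]; constructor <;> linarith
    · rw [wj s j hji hjl]; exact (hy1 j).trans (by norm_num)
  have hwt : ∀ s, |s| ≤ 1 / 8 → τ.InTet m t (w s) := fun s hs => inTet_of_pos
    (fun j => by have := (abs_lt.mp (hwnear s hs j)).1; linarith [hq2 j]) (hwsum s)
  have hclose : ∀ s s', (∀ j, |w s j - w s' j| ≤ |s - s'|) := by
    intro s s' j
    by_cases hji : j = i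
    · rw [hji, wi, wi]; simp
    by_cases hjl : j = l
    · rw [hjl, wl, wl, abs_le]
      constructor <;> linarith [le_abs_self (s - s'), neg_abs_le (s - s')]
    · rw [wj s j hji hjl, wj s' j hji hjl]; simp
  have hwy : w (y i - q i) = y := by
    ext j
    by_cases hji : j = i
    · rw [hji, wi]; ring
    by_cases hjl : j = l
    · rw [hjl, wl]; ring
    · exact wj _ j hji hjl
  -- the points on the side of `y`
  let K : Set (Fin 4 → ℝ) := w '' {s | 0 < σ * s ∧ |s| ≤ |y i - q i|}
  have hKbd : ∀ s, |s| ≤ |y i - q i| → |s| ≤ 1 / 8 := fun s hs => hs.trans (hy1 i).le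
  have hwl : ∀ s, |s| ≤ |y i - q i| → 0 < σ * (w s l - q l) := by
    intro s hs
    rw [wl]
    have h1 : σ * s ≤ σ * (y i - q i) := by
      calc σ * s ≤ |σ * s| := le_abs_self _
        _ ≤ |y i - q i| := by rw [habs]; exact hs
        _ = σ * (y i - q i) := by rw [← habs, abs_of_pos hi]
    linarith
  have hKconv : Convex ℝ K := by
    have h1 : w = AffineMap.lineMap (w 0) (w 1) := by
      ext s j
      simp only [AffineMap.lineMap_apply, vsub_eq_sub, vadd_eq_add, Pi.add_apply, Pi.smul_apply,
        Pi.sub_apply, smul_eq_mul]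
      by_cases hji : j = i
      · rw [hji, wi, wi, wi]; ring
      by_cases hjl : j = l
      · rw [hjl, wl, wl, wl]; ring
      · rw [wj s j hji hjl, wj 1 j hji hjl, wj 0 j hji hjl]; ring
    have h2 : Convex ℝ {s : ℝ | 0 < σ * s ∧ |s| ≤ |y i - q i|} := by
      have e : {s : ℝ | 0 < σ * s ∧ |s| ≤ |y i - q i|} =
          {s | 0 < σ * s} ∩ Icc (-|y i - q i|) |y i - q i| := by
        ext s; simp [abs_le]
      rw [e]
      exact (convex_halfSpace_gt (LinearMap.isLinear (LinearMap.mulLeft ℝ σ)) 0).inter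
        (convex_Icc _ _)
    simp only [K]
    rw [h1]
    exact h2.affine_image _
  have hoff : ∀ s, |s| ≤ |y i - q i| → ∀ j, j ≠ i → ¬ IsHalf (w s j) := by
    intro s hs j hji
    refine hnear j _ ?_ ((hwnear s (hKbd s hs) j).trans (by norm_num))
    by_cases hjl : j = l
    · subst hjl
      intro e
      have := hwl s hs
      rw [e, sub_self, mul_zero] at this
      exact lt_irrefl _ this
    · rw [wj s j hji hjl]; exact hy0 j
  have hKC : ∀ s (hs : 0 < σ * s ∧ |s| ≤ |y i - q i|),
      τ.toSpace m ⟨t, w s, hwt s (hKbd s hs.2)⟩ ∈ τ.domain m (τ.toSpace m z₀) := by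
    intro s hs
    refine mem_domain_of_convex hKconv ?_ ?_ (x := ⟨y, hyt⟩) ⟨y i - q i, ⟨hi, le_rfl⟩, hwy⟩
      (mem_image_of_mem _ hs) hyC
    · rintro _ ⟨s, hs, rfl⟩; exact hwt s (hKbd s hs.2)
    · rintro _ ⟨s, hs, rfl⟩ j
      by_cases hji : j = i
      · subst hji
        refine hnear j _ ?_ ((hwnear s (hKbd s hs.2) j).trans (by norm_num))
        rw [wi]
        intro e
        have : s = 0 := by linarith
        have h1 : 0 < σ * s := hs.1
        rw [this, mul_zero] at h1
        exact lt_irrefl _ h1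
      · exact hoff s hs.2 j hji
  have h00 : |(0 : ℝ)| ≤ |y i - q i| := by simp
  have hd0 : 0 < |y i - q i| := abs_pos.mpr (sub_ne_zero.mpr (hy0 i))
  have hface : τ.IsFacePoint m (τ.domain m (τ.toSpace m z₀)) ⟨t, w 0, hwt 0 (by norm_num)⟩ i := by
    refine ⟨?_, ?_, fun j hj => hoff 0 h00 j hj⟩
    · rw [mem_closure_iff_frequently]
      intro Hc
      have hc := continuous_toSpace.continuousAt.eventually Hc
      rw [eventually_point_iff, eventually_subtype_abs_iff] at hc
      obtain ⟨η, hη, hc⟩ := hc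
      set s := σ * min (η / 2) |y i - q i| with hs
      have hmin : 0 < min (η / 2) |y i - q i| := lt_min (by positivity) hd0
      have hsabs : |s| = min (η / 2) |y i - q i| := by rw [hs, habs, abs_of_pos hmin]
      have hs1 : 0 < σ * s ∧ |s| ≤ |y i - q i| :=
        ⟨by rw [hs, ← mul_assoc, hσ2, one_mul]; exact hmin, hsabs.trans_le (min_le_right _ _)⟩
      refine hc _ (hwt s (hKbd s hs1.2)) (fun j => ?_) (hKC s hs1)
      refine (hclose s 0 j).trans_lt ?_
      rw [sub_zero, hsabs]
      exact (min_le_left _ _).trans_lt (by linarith)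
    · dsimp only
      rw [wi, add_zero]; exact hq i
  have hev := H (w 0) (hwt 0 (by norm_num)) (fun j => ?_) i hface
  · rw [eventually_subtype_abs_iff] at hev
    obtain ⟨η, hη, hev⟩ := hev
    set s := -σ * min (η / 2) |y i - q i| with hs
    have hmin : 0 < min (η / 2) |y i - q i| := lt_min (by positivity) hd0
    have hsabs : |s| = min (η / 2) |y i - q i| := by
      rw [hs, neg_mul, abs_neg, habs, abs_of_pos hmin]
    have hs1 : |s| ≤ |y i - q i| := hsabs.trans_le (min_le_right _ _)
    have hσs : σ * s < 0 := by rw [hs]; nlinarith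
    have hC := hev (w s) (hwt s (hKbd s hs1)) (fun j => ?_) ?_
    · have hr := (roundSum_eq_of_mem_domain hz₀ hC).trans h
      dsimp only at hr
      have e1 : (∑ j, (round (w s j) : ℝ)) = m := by
        rw [← Int.cast_sum]; exact_mod_cast congrArg (Int.cast : ℤ → ℝ) hr
      have e2 : (∑ j, (round (y j) : ℝ)) = m := by
        rw [← Int.cast_sum]; exact_mod_cast congrArg (Int.cast : ℤ → ℝ) hyr
      have hwi : (round (w s i) : ℝ) = q i + -σ / 2 := by
        refine hside i _ (-σ) (by rcases hσ with rfl | rfl <;> norm_num) ?_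
          ((hwnear s (hKbd s hs1) i).trans (by norm_num))
        rw [wi]; linarith
      have hwl' : (round (w s l) : ℝ) = q l + σ / 2 := hside l _ σ hσ (hwl s hs1)
        ((hwnear s (hKbd s hs1) l).trans (by norm_num))
      rw [hS, hwi, hwl', wj s r₁ hr1.symm hr3.symm, wj s r₂ hr2.symm hr4.symm] at e1
      rw [hS, hside i _ σ hσ hi ((hy1 i).trans (by norm_num)),
        hside l _ σ hσ hl ((hy1 l).trans (by norm_num))] at e2
      have : σ = 0 := by linarith
      rw [this] at hσ2
      norm_num at hσ2
    · refine (hclose s 0 j).trans_lt ?_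
      rw [sub_zero, hsabs]
      exact (min_le_left _ _).trans_lt (by linarith)
    · dsimp only
      rw [wi, wi]
      linarith
  · by_cases hji : j = i
    · rw [hji, wi]; simpa using hε
    by_cases hjl : j = l
    · rw [hjl, wl]
      have h1 := abs_lt.mp (hy2 i)
      have h2 := abs_lt.mp (hy2 l)
      rw [abs_lt]; constructor <;> linarith
    · rw [wj 0 j hji hjl]; exact (hy2 j).trans (by linarith)

theorem not_consistentAt_of_eq {z₀ : τ.Point m} (hz₀ : τ.toSpace m z₀ ∉ τ.diagram m)
    (h : roundSum z₀.2.1 = m) {q : τ.Point m}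
    (hq : τ.IsVertexOf m (τ.domain m (τ.toSpace m z₀)) q) :
    ¬ τ.ConsistentAt m (τ.domain m (τ.toSpace m z₀)) q := by
  rintro (H | H)
  · refine not_consistentAt_aux hz₀ h hq.1 hq.2 (Or.inl rfl) (H.mono fun p hp i hi => ?_)
    simpa only [one_mul, CoorientedIn] using hp i hi
  · refine not_consistentAt_aux hz₀ h hq.1 hq.2 (Or.inr rfl) (H.mono fun p hp i hi => ?_)
    simpa only [neg_one_mul, neg_lt_neg_iff, CoorientedOut] using hp i hi

theorem isColored_domain_iff (hm : 2 ≤ m) {p : τ.Point m} (hp : τ.toSpace m p ∉ τ.diagram m) :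
    τ.IsColored m (τ.domain m (τ.toSpace m p)) ↔ roundSum p.2.1 ≠ m := by
  constructor
  · rintro ⟨⟨q, hq⟩, hc⟩ h
    exact not_consistentAt_of_eq hp h hq (hc q hq)
  · intro h
    exact ⟨exists_isVertexOf hm hp h, fun q hq => consistentAt_of_ne hp h hq.1⟩

end IdealTriangulation

/-! ### The flat parts of the sheets -/

section

variable {m : ℕ} {x : Fin 4 → ℝ}

/-- The region between the plane `xᵢ = k + 1/2` and its zig-zag surface. -/
def InFlat (m : ℕ) (x : Fin 4 → ℝ) (i : Fin 4) (k : ℕ) : Prop :=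
  (InSheet m x i k ∧ x i ≤ k + 1 / 2) ∨ (OffSheet m x i k ∧ k + 1 / 2 ≤ x i)

theorem InFlat.lt (hx : InSimplex m x) {i : Fin 4} {k : ℕ} (h : InFlat m x i k) : k < m := by
  rcases h with h | h
  · exact h.1.lt
  · have h1 : x i ≤ ∑ j, x j := Finset.single_le_sum (fun j _ => hx.1 j) (Finset.mem_univ i)
    rw [hx.2] at h1
    have : (k : ℝ) < m := by linarith
    exact_mod_cast this

theorem InFlat.of_isRounding {i : Fin 4} {k : ℕ} (h : InFlat m x i k) {v : Fin 4 → ℕ}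
    (hv : IsRounding m x v) : Ties m x (x i - k) ∨ (k < v i ∧ x i ≤ k + 1 / 2) ∨
      (v i ≤ k ∧ k + 1 / 2 ≤ x i) := by
  rcases h with ⟨h, h'⟩ | ⟨h, h'⟩
  · rcases h.of_isRounding hv with h | h
    · exact Or.inr (Or.inl ⟨h, h'⟩)
    · exact Or.inl h.2
  · rcases h.of_isRounding hv with h | h
    · exact Or.inr (Or.inr ⟨h, h'⟩)
    · exact Or.inl h.2

/-- Each of the other three differences is within one of that at `i`, and all four sum to zero, so
four times the latter is at most three in absolute value. -/
theorem IsRounding.abs_le {v : Fin 4 → ℕ} (hx : InSimplex m x) (hv : IsRounding m x v)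
    (i : Fin 4) : |x i - v i| ≤ 3 / 4 := by
  obtain ⟨j, hj⟩ := exists_ne i
  obtain ⟨p, q, -, -, -, -, -, hS⟩ := exists_sum_eq_of_ne hj
  have h := hv.sum_sub hx
  rw [hS] at h
  rw [_root_.abs_le]
  constructor <;> linarith [hv.2 i j, hv.2 i p, hv.2 i q, hv.2 j i, hv.2 p i, hv.2 q i]

/-- Different flat parts meet along the rectangles. -/
theorem InFlat.eq_or_tie (hx : InSimplex m x) {i j : Fin 4} {k l : ℕ} (h : InFlat m x i k)
    (h' : InFlat m x j l) : (i = j ∧ k = l) ∨ (x i - k = x j - l ∧ Ties m x (x i - k)) := by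
  obtain ⟨v, hv⟩ := exists_isRounding hx
  have hs := hv.sum_sub hx
  -- a tie and a flat coordinate
  have key : ∀ (a : ℝ) (j : Fin 4) (l : ℕ), Ties m x a →
      ((l < v j ∧ x j ≤ l + 1 / 2) ∨ (v j ≤ l ∧ l + 1 / 2 ≤ x j)) → x j - l = a := by
    intro a j l ht h
    obtain ⟨⟨p, hp⟩, ⟨q, hq⟩⟩ := hv.exists_tie ht
    have hI := hv.mem_Icc hp hq
    have hab := _root_.abs_le.mp (hv.abs_le hx j)
    have hpq : p ≠ q := by rintro rfl; linarith
    obtain ⟨r, s, h1, h2, h3, h4, h5, hS⟩ := exists_sum_eq_of_ne hpq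
    rw [hS, hp, hq] at hs
    have hj : j = p ∨ j = q ∨ j = r ∨ j = s := by
      revert j; simp only [ne_eq, Fin.ext_iff] at *; intro j; intros; omega
    rcases h with ⟨h6, h7⟩ | ⟨h6, h7⟩
    · have hl : v j = l + 1 := by
        have h8 : (v j : ℝ) < l + 2 := by linarith
        have h8 : v j < l + 2 := by exact_mod_cast h8
        omega
      have hl' : (v j : ℝ) = l + 1 := by rw [hl]; push_cast; ring
      have := hI r; have := hI s; have := hI j
      rcases hj with e | e | e | e <;> subst e <;> linarith
    · have hl : v j = l := by
        have h8 : (l : ℝ) < v j + 1 := by linarith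
        have h8 : l < v j + 1 := by exact_mod_cast h8
        omega
      have hl' : (v j : ℝ) = l := by rw [hl]
      have := hI r; have := hI s; have := hI j
      rcases hj with e | e | e | e <;> subst e <;> linarith
  rcases h.of_isRounding hv with h1 | h1 <;> rcases h'.of_isRounding hv with h2 | h2
  · exact Or.inr ⟨hv.ties_unique h1 h2, h1⟩
  · exact Or.inr ⟨(key _ j l h1 h2).symm, h1⟩
  · have := key _ i k h2 h1
    exact Or.inr ⟨this, this ▸ h2⟩
  · have habi := _root_.abs_le.mp (hv.abs_le hx i)
    have habj := _root_.abs_le.mp (hv.abs_le hx j)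
    have hfl : ∀ (j : Fin 4) (l : ℕ), |x j - v j| ≤ 3 / 4 →
        ((l < v j ∧ x j ≤ l + 1 / 2) ∨ (v j ≤ l ∧ l + 1 / 2 ≤ x j)) →
        (v j = l + 1 ∧ x j - v j ≤ - 1 / 2) ∨ (v j = l ∧ 1 / 2 ≤ x j - v j) := by
      intro j l hab h
      rw [_root_.abs_le] at hab
      rcases h with ⟨h6, h7⟩ | ⟨h6, h7⟩
      · have hl : v j = l + 1 := by
          have h8 : (v j : ℝ) < l + 2 := by linarith
          have h8 : v j < l + 2 := by exact_mod_cast h8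
          omega
        exact Or.inl ⟨hl, by rw [hl]; push_cast; linarith⟩
      · have hl : v j = l := by
          have h8 : (l : ℝ) < v j + 1 := by linarith
          have h8 : l < v j + 1 := by exact_mod_cast h8
          omega
        exact Or.inr ⟨hl, by rw [hl]; linarith⟩
    have h1 := hfl i k (hv.abs_le hx i) h1
    have h2 := hfl j l (hv.abs_le hx j) h2
    by_cases hij : i = j
    · subst hij
      rcases h1 with h1 | h1 <;> rcases h2 with h2 | h2
      · exact Or.inl ⟨rfl, by omega⟩
      · linarith
      · linarith
      · exact Or.inl ⟨rfl, by omega⟩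
    -- Both deviations are at least `1/2` in absolute value. With opposite signs they saturate a
    -- Voronoi inequality; with equal signs the zero sum pushes the other two to the opposite
    -- extreme and saturates theirs.
    right
    obtain ⟨r, s, h3, h4, h5, h6, h7, hS⟩ := exists_sum_eq_of_ne hij
    rw [hS] at hs
    have := hv.2 i r; have := hv.2 i s; have := hv.2 j r; have := hv.2 j s
    have := hv.2 r i; have := hv.2 s i; have := hv.2 r j; have := hv.2 s j
    have := hv.2 i j; have := hv.2 j i
    rcases h1 with ⟨e1, h1⟩ | ⟨e1, h1⟩ <;> rcases h2 with ⟨e2, h2⟩ | ⟨e2, h2⟩ <;>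
      have e1' := congrArg (Nat.cast : ℕ → ℝ) e1 <;> have e2' := congrArg (Nat.cast : ℕ → ℝ) e2 <;>
      push_cast at e1' e2'
    · exact ⟨by linarith, v, hv, ⟨r, by linarith⟩, i, by linarith⟩
    · exact ⟨by linarith, v, hv, ⟨j, by linarith⟩, i, by linarith⟩
    · exact ⟨by linarith, v, hv, ⟨i, by linarith⟩, j, by linarith⟩
    · exact ⟨by linarith, v, hv, ⟨i, by linarith⟩, r, by linarith⟩

/-- On a plane there is nothing to do: one of the two sides of the zig-zag surface contains the
point. Off the planes, a rounding has total `m` and so is not made of nearest integers; at a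
coordinate where it is off by at least `1/2`, the plane and the zig-zag surface disagree. -/
theorem exists_inFlat (hx : InSimplex m x) (h : (∃ i, IsHalf (x i)) ∨ roundSum x ≠ m) :
    ∃ i k, InFlat m x i k := by
  by_cases h0 : ∃ i, IsHalf (x i)
  · obtain ⟨i, k, hk⟩ := h0
    refine ⟨i, k, ?_⟩
    rcases inSheet_or_offSheet hx i k with h | h
    · exact Or.inl ⟨h, hk.le⟩
    · exact Or.inr ⟨h, hk.ge⟩
  replace h := h.resolve_left h0
  obtain ⟨v, hv⟩ := exists_isRounding hx
  obtain ⟨i, hi⟩ : ∃ i, 1 / 2 ≤ |x i - v i| := by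
    by_contra! H
    refine h ?_
    have : ∀ i, round (x i) = v i := fun i => round_eq_of_abs_sub_lt (by exact_mod_cast H i)
    rw [roundSum, Finset.sum_congr rfl fun i _ => this i]
    exact_mod_cast hv.1
  rcases le_abs.mp hi with hi | hi
  · exact ⟨i, v i, Or.inr ⟨⟨v, hv, le_rfl⟩, by linarith⟩⟩
  · have h1 : 0 < v i := by
      have := hx.1 i
      have : (0 : ℝ) < v i := by linarith
      exact_mod_cast this
    exact ⟨i, v i - 1, Or.inl ⟨⟨v, hv, by omega⟩, by push_cast [h1]; linarith⟩⟩

/-- If the nearest integers sum to `m`, they form a rounding with all deviations below `1/2`. Such a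
rounding has no tie, and every unit is on the same side of its plane and of its zig-zag surface. -/
theorem InFlat.roundSum_ne (hx : InSimplex m x) {i : Fin 4} {k : ℕ} (h : InFlat m x i k)
    (hoff : ∀ i, ¬ IsHalf (x i)) : roundSum x ≠ m := by
  intro e
  have hr : ∀ i, |x i - round (x i)| < 1 / 2 := fun i => abs_sub_round_lt (hx.1 i) (hoff i)
  have h0 : ∀ i, 0 ≤ round (x i) := fun i => by
    have := (abs_lt.mp (hr i)).2
    have := hx.1 i
    have : (-1 : ℝ) < round (x i) := by linarith
    have : (-1 : ℤ) < round (x i) := by exact_mod_cast this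
    omega
  have hc : ∀ i, (((round (x i)).toNat : ℕ) : ℤ) = round (x i) := fun i => Int.toNat_of_nonneg (h0 i)
  have hd : ∀ i, |x i - ((round (x i)).toNat : ℕ)| < 1 / 2 := fun i => by
    have := hr i
    rw [← hc i] at this
    exact_mod_cast this
  have hv : IsRounding m x fun i => (round (x i)).toNat := by
    refine ⟨?_, fun i j => ?_⟩
    · zify
      rw [Finset.sum_congr rfl fun i _ => hc i]
      exact e
    · have := abs_lt.mp (hd i); have := abs_lt.mp (hd j)
      linarith
  rcases h.of_isRounding hv with h | ⟨h, h'⟩ | ⟨h, h'⟩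
  · obtain ⟨⟨p, hp⟩, ⟨q, hq⟩⟩ := hv.exists_tie h
    have := abs_lt.mp (hd p); have := abs_lt.mp (hd q)
    linarith
  · have := abs_lt.mp (hd i)
    have : (k : ℝ) + 1 ≤ ((round (x i)).toNat : ℕ) := by exact_mod_cast h
    linarith
  · have := abs_lt.mp (hd i)
    have : (((round (x i)).toNat : ℕ) : ℝ) ≤ k := by exact_mod_cast h
    linarith

end

/-! ### Functions with the same sign near a common zero -/

section

variable {E : Type*} [NormedAddCommGroup E] [NormedSpace ℝ E]

/-- The kernel of `f` lies in that of `g`: otherwise one could move along it from a vector with `f`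
positive until `g` is negative. -/
theorem exists_pos_mul_eq_of_forall {f g : E →L[ℝ] ℝ} (hf : f ≠ 0) (hg : g ≠ 0)
    (h : ∀ w, 0 < f w → 0 ≤ g w) : ∃ r : ℝ, 0 < r ∧ ∀ w, g w = r * f w := by
  obtain ⟨w₀, hw₀⟩ : ∃ w, 0 < f w := by
    obtain ⟨w, hw⟩ : ∃ w, f w ≠ 0 := by
      by_contra! H; exact hf (ContinuousLinearMap.ext H)
    rcases lt_or_gt_of_ne hw with h | h
    · exact ⟨-w, by simpa⟩
    · exact ⟨w, h⟩
  have hker : ∀ w, f w = 0 → g w = 0 := by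
    intro w hw
    by_contra hgw
    have h1 := h (w₀ + (-(g w₀ + 1) / g w) • w) (by simpa [hw])
    rw [map_add, map_smul, smul_eq_mul, div_mul_cancel₀ _ hgw] at h1
    linarith
  have heq : ∀ w, g w = g w₀ / f w₀ * f w := by
    intro w
    have h1 := hker (w - (f w / f w₀) • w₀) (by
      rw [map_sub, map_smul, smul_eq_mul, div_mul_cancel₀ _ hw₀.ne', sub_self])
    rw [map_sub, map_smul, smul_eq_mul] at h1
    field_simp at h1 ⊢
    linarith
  refine ⟨g w₀ / f w₀, lt_of_le_of_ne (div_nonneg (h _ hw₀) hw₀.le) fun e => hg ?_, heq⟩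
  ext w
  rw [heq, ← e]; simp

/-- Strict differentiability within a convex set. -/
theorem ContDiffWithinAt.exists_ball_norm_sub_le {R : Set E} (hR : Convex ℝ R) {e : E}
    (he : e ∈ R) {F : E → ℝ} (hF : ContDiffWithinAt ℝ 1 F R e) (hu : UniqueDiffWithinAt ℝ R e)
    {ε : ℝ} (hε : 0 < ε) : ∃ δ > 0, ∀ x ∈ R ∩ Metric.ball e δ, ∀ y ∈ R ∩ Metric.ball e δ,
      ‖F y - F x - fderivWithin ℝ F R e (y - x)‖ ≤ ε * ‖y - x‖ := by
  rw [show (1 : ℕ∞ω) = 0 + 1 by rw [zero_add],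
    contDiffWithinAt_succ_iff_hasFDerivWithinAt' (by simp)] at hF
  obtain ⟨u, hu1, hu2, -, f', hf', hc⟩ := hF
  rw [insert_eq_of_mem he] at hu1 hu2
  have hfe : fderivWithin ℝ F R e = f' e :=
    (hf' e (mem_of_mem_nhdsWithin he hu1)).fderivWithin hu
  have h1 : ∀ᶠ x in 𝓝[R] e, ‖f' x - f' e‖ ≤ ε := by
    have : ContinuousWithinAt (fun x => ‖f' x - f' e‖) R e :=
      (hc.continuousWithinAt.sub continuousWithinAt_const).norm
    have h2 : ‖f' e - f' e‖ < ε := by simpa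
    exact (this.eventually (gt_mem_nhds h2)).mono fun x hx => hx.le
  obtain ⟨δ, hδ, hsub⟩ := Metric.mem_nhdsWithin_iff.mp (Filter.inter_mem hu1 h1)
  refine ⟨δ, hδ, fun x hx y hy => ?_⟩
  rw [hfe]
  have hsub' : R ∩ Metric.ball e δ ⊆ Metric.ball e δ ∩ R := by rw [inter_comm]
  exact (hR.inter (convex_ball e δ)).norm_image_sub_le_of_norm_hasFDerivWithin_le'
    (fun z hz => (hf' z (hsub (hsub' hz)).1).mono inter_subset_left)
    (fun z hz => (hsub (hsub' hz)).2) hx hy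

/-- If the derivatives had opposite signs on `w`, a small step along `w` from a common zero would
make `F` positive and `G` negative. At a boundary point `e` the step may leave `R`, so it is taken
from a zero `z` in the interior near `e`, found by the intermediate value theorem; strict
differentiability at `e` controls the increments from `z`. -/
theorem exists_pos_mul_fderivWithin_eq {R : Set E} (hR : Convex ℝ R) (hRi : (interior R).Nonempty)
    {e : E} (he : e ∈ R) {F G : E → ℝ} (hF : ContDiffWithinAt ℝ 1 F R e)
    (hG : ContDiffWithinAt ℝ 1 G R e)
    (hs : ∀ᶠ y in 𝓝[R] e, SignType.sign (F y) = SignType.sign (G y))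
    (hpos : ∃ᶠ y in 𝓝[R] e, 0 < F y) (hneg : ∃ᶠ y in 𝓝[R] e, F y < 0)
    (hF0 : fderivWithin ℝ F R e ≠ 0) (hG0 : fderivWithin ℝ G R e ≠ 0) :
    ∃ r : ℝ, 0 < r ∧ ∀ w, fderivWithin ℝ G R e w = r * fderivWithin ℝ F R e w := by
  refine exists_pos_mul_eq_of_forall hF0 hG0 fun w hw => ?_
  by_contra! hgw
  have hu : UniqueDiffWithinAt ℝ R e := uniqueDiffOn_convex hR hRi e he
  set a := fderivWithin ℝ F R e w with ha
  set b := fderivWithin ℝ G R e w with hb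
  obtain ⟨ε, hε, hεa, hεb⟩ : ∃ ε > 0, ε * ‖w‖ < a ∧ ε * ‖w‖ < -b := by
    have h0 : 0 < min a (-b) := lt_min hw (by linarith)
    have h1 : 0 < ‖w‖ + 1 := by positivity
    refine ⟨min a (-b) / (‖w‖ + 1), by positivity, ?_, ?_⟩
    · refine lt_of_lt_of_le ?_ (min_le_left a (-b))
      rw [div_mul_eq_mul_div, div_lt_iff₀ h1]
      nlinarith
    · refine lt_of_lt_of_le ?_ (min_le_right a (-b))
      rw [div_mul_eq_mul_div, div_lt_iff₀ h1]
      nlinarith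
  obtain ⟨δ₁, hδ₁, hF1⟩ := hF.exists_ball_norm_sub_le hR he hu hε
  obtain ⟨δ₂, hδ₂, hG1⟩ := hG.exists_ball_norm_sub_le hR he hu hε
  obtain ⟨δ₃, hδ₃, hs1⟩ := Metric.mem_nhdsWithin_iff.mp hs
  set δ := min δ₁ (min δ₂ δ₃) with hδ
  have hδ0 : 0 < δ := by positivity
  have hb1 : Metric.ball e δ ⊆ Metric.ball e δ₁ := Metric.ball_subset_ball (min_le_left _ _)
  have hb2 : Metric.ball e δ ⊆ Metric.ball e δ₂ :=
    Metric.ball_subset_ball ((min_le_right _ _).trans (min_le_left _ _))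
  have hb3 : Metric.ball e δ ⊆ Metric.ball e δ₃ :=
    Metric.ball_subset_ball ((min_le_right _ _).trans (min_le_right _ _))
  have hcont : ContinuousOn F (R ∩ Metric.ball e δ) := by
    have hL : LipschitzOnWith (‖fderivWithin ℝ F R e‖₊ + ⟨ε, hε.le⟩) F (R ∩ Metric.ball e δ) := by
      refine LipschitzOnWith.of_dist_le_mul fun x hx y hy => ?_
      rw [dist_eq_norm, dist_eq_norm]
      have h1 := hF1 y ⟨hy.1, hb1 hy.2⟩ x ⟨hx.1, hb1 hx.2⟩
      have h2 := (fderivWithin ℝ F R e).le_opNorm (x - y)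
      have h3 := norm_add_le (F x - F y - fderivWithin ℝ F R e (x - y))
        (fderivWithin ℝ F R e (x - y))
      rw [sub_add_cancel] at h3
      change _ ≤ (‖fderivWithin ℝ F R e‖ + ε) * _
      linarith
    exact hL.continuousOn
  have hint : ∀ P : Set ℝ, IsOpen P → (∃ᶠ y in 𝓝[R] e, F y ∈ P) →
      ∃ y ∈ interior R ∩ Metric.ball e δ, F y ∈ P := by
    intro P hP hf
    obtain ⟨y, hyP, hyb, hyR⟩ := (hf.and_eventually (Filter.inter_mem
      (mem_nhdsWithin_of_mem_nhds (Metric.ball_mem_nhds e hδ0)) self_mem_nhdsWithin)).exists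
    have h1 := (hcont y ⟨hyR, hyb⟩).preimage_mem_nhdsWithin (hP.mem_nhds hyP)
    obtain ⟨O, hO, hyO, hsub⟩ := mem_nhdsWithin.mp h1
    have hcl : y ∈ closure (interior R) := by
      rw [hR.closure_interior_eq_closure_of_nonempty_interior hRi]; exact subset_closure hyR
    obtain ⟨z, ⟨hzO, hzb⟩, hzR⟩ := mem_closure_iff.mp hcl (O ∩ Metric.ball e δ)
      (hO.inter Metric.isOpen_ball) ⟨hyO, hyb⟩
    exact ⟨z, ⟨hzR, hzb⟩, hsub ⟨hzO, interior_subset hzR, hzb⟩⟩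
  obtain ⟨y₁, hy₁, hp⟩ := hint (Ioi 0) isOpen_Ioi hpos
  obtain ⟨y₂, hy₂, hn⟩ := hint (Iio 0) isOpen_Iio hneg
  obtain ⟨z, hz, hz0⟩ := (hR.interior.inter (convex_ball e δ)).isPreconnected.intermediate_value
    hy₂ hy₁ (hcont.mono (inter_subset_inter_left _ interior_subset)) ⟨hn.le, hp.le⟩
  have hGz : G z = 0 := by
    have := hs1 ⟨hb3 hz.2, interior_subset hz.1⟩
    rw [mem_ofPred_eq, hz0, sign_zero] at this
    exact sign_eq_zero_iff.mp this.symm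
  have hopen : IsOpen (interior R ∩ Metric.ball e δ) := isOpen_interior.inter Metric.isOpen_ball
  have hline : ∀ᶠ t in 𝓝[>] (0 : ℝ), z + t • w ∈ interior R ∩ Metric.ball e δ := by
    have hc : Continuous fun t : ℝ => z + t • w := by fun_prop
    have : z + (0 : ℝ) • w ∈ interior R ∩ Metric.ball e δ := by simpa using hz
    exact nhdsWithin_le_nhds (hc.continuousAt.preimage_mem_nhds (hopen.mem_nhds this))
  obtain ⟨t, ht, ht0⟩ := (hline.and self_mem_nhdsWithin).exists
  have ht0 : 0 < t := ht0
  have hF2 := hF1 z ⟨interior_subset hz.1, hb1 hz.2⟩ _ ⟨interior_subset ht.1, hb1 ht.2⟩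
  have hG2 := hG1 z ⟨interior_subset hz.1, hb2 hz.2⟩ _ ⟨interior_subset ht.1, hb2 ht.2⟩
  rw [add_sub_cancel_left, map_smul, smul_eq_mul, norm_smul, Real.norm_of_nonneg ht0.le,
    Real.norm_eq_abs, abs_le] at hF2 hG2
  rw [hz0, ← ha] at hF2
  rw [hGz, ← hb] at hG2
  have h1 : 0 < F (z + t • w) := by nlinarith [hF2.1]
  have h2 : G (z + t • w) < 0 := by nlinarith [hG2.2]
  have h3 := hs1 ⟨hb3 ht.2, interior_subset ht.1⟩
  rw [mem_ofPred_eq, sign_pos h1, sign_neg h2] at h3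
  exact absurd h3 (by decide)

variable {H : Type*} [TopologicalSpace H] {M : Type*} [TopologicalSpace M] [ChartedSpace H M]

/-- The differential of a real function on a manifold. -/
def differential (I : ModelWithCorners ℝ E H) (f : M → ℝ) (z : M) : TangentSpace I z →L[ℝ] ℝ :=
  mfderiv I 𝓘(ℝ, ℝ) f z

theorem exists_pos_mul_differential_eq {I : ModelWithCorners ℝ E H} {z : M} {f g : M → ℝ}
    (hf : ContMDiffAt I 𝓘(ℝ, ℝ) 1 f z) (hg : ContMDiffAt I 𝓘(ℝ, ℝ) 1 g z)
    (hs : ∀ᶠ y in 𝓝 z, SignType.sign (f y) = SignType.sign (g y))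
    (hpos : ∃ᶠ y in 𝓝 z, 0 < f y) (hneg : ∃ᶠ y in 𝓝 z, f y < 0)
    (hf0 : differential I f z ≠ 0) (hg0 : differential I g z ≠ 0) :
    ∃ r : ℝ, 0 < r ∧ ∀ w, differential I g z w = r * differential I f z w := by
  have hd : ∀ f : M → ℝ, ContMDiffAt I 𝓘(ℝ, ℝ) 1 f z → differential I f z =
      fderivWithin ℝ (f ∘ (extChartAt I z).symm) (range I) (extChartAt I z z) := fun f hf =>
    (hf.mdifferentiableAt one_ne_zero).mfderiv
  have hc : ∀ f : M → ℝ, ContMDiffAt I 𝓘(ℝ, ℝ) 1 f z → ContDiffWithinAt ℝ 1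
      (f ∘ (extChartAt I z).symm) (range I) (extChartAt I z z) := fun f hf =>
    (contMDiffAt_iff.mp hf).2
  have ht : Tendsto (extChartAt I z).symm (𝓝[range I] (extChartAt I z z)) (𝓝 z) := by
    rw [Tendsto, map_extChartAt_symm_nhdsWithin_range]
  have hfreq : ∀ P : M → Prop, (∃ᶠ y in 𝓝 z, P y) →
      ∃ᶠ y in 𝓝[range I] (extChartAt I z z), P ((extChartAt I z).symm y) := by
    intro P h
    rw [← map_extChartAt_symm_nhdsWithin_range (I := I) z] at h
    exact h
  rw [hd f hf] at hf0 ⊢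
  rw [hd g hg] at hg0 ⊢
  exact exists_pos_mul_fderivWithin_eq I.convex_range I.nonempty_interior
    (extChartAt_target_subset_range z (mem_extChartAt_target z)) (hc f hf) (hc g hg)
    (ht.eventually hs) (hfreq _ hpos) (hfreq _ hneg) hf0 hg0

end

/-! ### Norms on vector bundles -/

section

variable {B F : Type*} [TopologicalSpace B] [NormedAddCommGroup F] {E : B → Type*}
  [TopologicalSpace (Bundle.TotalSpace F E)] [∀ b, TopologicalSpace (E b)] [FiberBundle F E]

theorem FiberBundle.t2Space_totalSpace [T2Space B] : T2Space (Bundle.TotalSpace F E) := by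
  refine ⟨fun ξ η hne => ?_⟩
  by_cases h : ξ.proj = η.proj
  swap
  · exact separated_by_continuous (FiberBundle.continuous_proj F E) h
  let e := trivializationAt F E ξ.proj
  have h1 : ξ ∈ e.source := e.mem_source.mpr (mem_baseSet_trivializationAt F E _)
  have h2 : η ∈ e.source := e.mem_source.mpr (h ▸ mem_baseSet_trivializationAt F E _)
  obtain ⟨U, V, hU, hV, hξ, hη, hd⟩ := t2_separation fun he => hne (e.injOn h1 h2 he)
  exact ⟨_, _, e.continuousOn_toFun.isOpen_inter_preimage e.open_source hU,
    e.continuousOn_toFun.isOpen_inter_preimage e.open_source hV, ⟨h1, hξ⟩, ⟨h2, hη⟩,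
    disjoint_left.mpr fun ζ h h' => disjoint_left.mp hd h.2 h'.2⟩

variable [NormedSpace ℝ F] [∀ b, AddCommMonoid (E b)] [∀ b, Module ℝ (E b)] [VectorBundle ℝ F E]

/-- Norms in local trivializations are added with a partition of unity. Near `b` the sum dominates
one trivialized norm with a positive weight, so smallness of the norm and convergence of the base
point imply convergence to the zero vector. -/
theorem exists_bundle_norm [NormalSpace B] [ParacompactSpace B] :
    ∃ N : Bundle.TotalSpace F E → ℝ, Continuous N ∧
      (∀ (b : B) (r : ℝ) (v : E b), N ⟨b, r • v⟩ = |r| * N ⟨b, v⟩) ∧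
      (∀ (b : B) (v : E b), v ≠ 0 → 0 < N ⟨b, v⟩) ∧
      ∀ (b : B) (l : Filter (Bundle.TotalSpace F E)), Tendsto Bundle.TotalSpace.proj l (𝓝 b) →
        Tendsto N l (𝓝 0) → l ≤ 𝓝 ⟨b, 0⟩ := by
  obtain ⟨ρ, hρ⟩ := PartitionOfUnity.exists_isSubordinate (isClosed_univ (X := B))
    (fun b => (trivializationAt F E b).baseSet) (fun b => (trivializationAt F E b).open_baseSet)
    fun b _ => mem_iUnion.mpr ⟨b, mem_baseSet_trivializationAt F E b⟩
  let T : B → Bundle.TotalSpace F E → ℝ := fun i ξ =>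
    ρ i ξ.proj * ‖(trivializationAt F E i ξ).2‖
  have hT0 : ∀ i ξ, 0 ≤ T i ξ := fun i ξ => mul_nonneg (ρ.nonneg i _) (norm_nonneg _)
  have hTc : ∀ i, Continuous (T i) := by
    intro i
    rw [continuous_iff_continuousAt]
    intro ξ
    by_cases h : ξ.proj ∈ tsupport (ρ i)
    · have h1 : ξ ∈ (trivializationAt F E i).source :=
        (trivializationAt F E i).mem_source.mpr (hρ i h)
      refine ContinuousAt.mul (((ρ i).continuous.comp
        (FiberBundle.continuous_proj F E)).continuousAt) ?_
      exact (continuous_snd.continuousAt.comp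
        ((trivializationAt F E i).continuousAt h1)).norm
    · have h1 : ∀ᶠ η in 𝓝 ξ, T i η = 0 := by
        have := (FiberBundle.continuous_proj F E).continuousAt.preimage_mem_nhds
          ((isClosed_tsupport (ρ i)).isOpen_compl.mem_nhds h)
        filter_upwards [this] with η hη
        simp only [T]
        rw [image_eq_zero_of_notMem_tsupport hη, zero_mul]
      exact (continuousAt_const (y := (0 : ℝ))).congr (h1.mono fun _ h => h.symm)
  have hlf : LocallyFinite fun i => Function.support (T i) := by
    refine (ρ.locallyFinite.preimage_continuous (FiberBundle.continuous_proj F E)).subset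
      fun i ξ hξ => ?_
    exact left_ne_zero_of_mul hξ
  have hfin : ∀ ξ, (Function.support fun i => T i ξ).Finite := fun ξ => hlf.point_finite ξ
  have hle : ∀ i ξ, T i ξ ≤ ∑ᶠ i, T i ξ := fun i ξ =>
    single_le_finsum i (hfin ξ) fun j => hT0 j ξ
  refine ⟨fun ξ => ∑ᶠ i, T i ξ, continuous_finsum hTc hlf, ?_, ?_, ?_⟩
  · intro b r v
    rw [mul_finsum]
    refine finsum_congr fun i => ?_
    simp only [T]
    by_cases h : b ∈ (trivializationAt F E i).baseSet
    · rw [((trivializationAt F E i).linear ℝ h).map_smul, norm_smul, Real.norm_eq_abs]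
      ring
    · have : ρ i b = 0 := image_eq_zero_of_notMem_tsupport fun h' => h (hρ i h')
      rw [this]; ring
  · intro b v hv
    obtain ⟨i, hi⟩ := ρ.exists_pos (mem_univ b)
    refine lt_of_lt_of_le ?_ (hle i _)
    have hb : b ∈ (trivializationAt F E i).baseSet :=
      hρ i (subset_closure hi.ne')
    refine mul_pos hi (norm_pos_iff.mpr fun h => hv ?_)
    have h0 : (trivializationAt F E i ⟨b, (0 : E b)⟩).2 = 0 :=
      ((trivializationAt F E i).linear ℝ hb).map_zero
    have h2 : ∀ w : E b, (trivializationAt F E i ⟨b, w⟩).1 = b := fun w =>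
      (trivializationAt F E i).coe_fst' hb
    have h1 := (trivializationAt F E i).injOn (x₁ := ⟨b, v⟩) (x₂ := ⟨b, 0⟩)
      ((trivializationAt F E i).mem_source.mpr hb) ((trivializationAt F E i).mem_source.mpr hb)
      (Prod.ext ((h2 v).trans (h2 0).symm)
        (h.trans h0.symm))
    simpa using h1
  · intro b l hl hN
    obtain ⟨i, hi⟩ := ρ.exists_pos (mem_univ b)
    have hb : b ∈ (trivializationAt F E i).baseSet := hρ i (subset_closure hi.ne')
    set e := trivializationAt F E i with he
    have hbs : (⟨b, 0⟩ : Bundle.TotalSpace F E) ∈ e.source := e.mem_source.mpr hb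
    have h0 : e ⟨b, (0 : E b)⟩ = (b, 0) :=
      Prod.ext (e.coe_fst' hb) (e.linear ℝ hb).map_zero
    have hmem : ∀ᶠ ξ in l, ξ ∈ e.source :=
      (hl.eventually (e.open_baseSet.mem_nhds hb)).mono fun ξ h => e.mem_source.mpr h
    have h1 : Tendsto (T i) l (𝓝 0) :=
      tendsto_of_tendsto_of_tendsto_of_le_of_le tendsto_const_nhds hN (hT0 i) (hle i)
    have h2 : Tendsto (fun ξ : Bundle.TotalSpace F E => ‖(e ξ).2‖) l (𝓝 0) := by
      have h3 : Tendsto (fun ξ : Bundle.TotalSpace F E => ρ i ξ.proj) l (𝓝 (ρ i b)) :=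
        ((ρ i).continuous.tendsto b).comp hl
      have h4 := h1.div h3 hi.ne'
      rw [zero_div] at h4
      refine h4.congr' ((h3.eventually_ne hi.ne').mono fun ξ h => ?_)
      exact mul_div_cancel_left₀ _ h
    have h3 : Tendsto e l (𝓝 (e ⟨b, (0 : E b)⟩)) := by
      rw [h0, nhds_prod_eq]
      refine Tendsto.prodMk (hl.congr' (hmem.mono fun ξ h => (e.coe_fst h).symm)) ?_
      exact tendsto_zero_iff_norm_tendsto_zero.mpr h2
    have h4 : Tendsto (e.toOpenPartialHomeomorph.symm ∘ e) l (𝓝 ⟨b, (0 : E b)⟩) := by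
      have := e.toOpenPartialHomeomorph.continuousAt_symm
        (e.toOpenPartialHomeomorph.map_source hbs)
      have h5 := e.toOpenPartialHomeomorph.left_inv hbs
      rw [ContinuousAt, h5] at this
      exact this.comp h3
    refine tendsto_id'.mp (h4.congr' (hmem.mono fun ξ h => ?_))
    exact e.toOpenPartialHomeomorph.left_inv h

theorem continuous_totalSpace_smul : Continuous fun p : ℝ × Bundle.TotalSpace F E =>
    (⟨p.2.proj, p.1 • p.2.snd⟩ : Bundle.TotalSpace F E) := by
  rw [continuous_iff_continuousAt]
  rintro ⟨r, ξ⟩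
  have hp : Continuous fun p : ℝ × Bundle.TotalSpace F E => p.2.proj :=
    (FiberBundle.continuous_proj F E).comp continuous_snd
  refine (FiberBundle.continuousAt_totalSpace F _).mpr ⟨hp.continuousAt, ?_⟩
  set e := trivializationAt F E ξ.proj
  have hs : ξ ∈ e.source := e.mem_source.mpr (mem_baseSet_trivializationAt F E _)
  have h1 : ContinuousAt (fun p : ℝ × Bundle.TotalSpace F E => p.1 • (e p.2).2) (r, ξ) := by
    refine continuousAt_fst.smul ?_
    exact continuous_snd.continuousAt.comp
      ((e.continuousAt hs).comp (f := Prod.snd) (x := (r, ξ)) continuousAt_snd)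
  refine h1.congr ?_
  filter_upwards [hp.continuousAt.preimage_mem_nhds
    (e.open_baseSet.mem_nhds (mem_baseSet_trivializationAt F E ξ.proj))] with p hp
  exact ((e.linear ℝ hp).map_smul _ _).symm

end

section

variable {E : Type*} [NormedAddCommGroup E] [NormedSpace ℝ E]
  {H : Type*} [TopologicalSpace H] {M : Type*} [TopologicalSpace M] [ChartedSpace H M]

theorem continuousAt_differential (I : ModelWithCorners ℝ E H) [IsManifold I ∞ M] {f : M → ℝ}
    {z : M} (hf : ContMDiffAt I 𝓘(ℝ, ℝ) 1 f z) :
    ContinuousAt (fun z => (⟨z, differential I f z⟩ : Bundle.TotalSpace (E →L[ℝ] ℝ)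
      fun z : M => TangentSpace I z →L[ℝ] Bundle.Trivial M ℝ z)) z := by
  have : IsManifold I 1 M := IsManifold.of_le (n := ∞) (by simp)
  refine (continuousAt_hom_bundle (RingHom.id ℝ) _).mpr ⟨continuousAt_id, ?_⟩
  have h := (hf.mfderiv_const (m := 0) (by simp)).continuousAt
  refine h.congr (Eventually.of_forall fun y => ?_)
  ext w
  simp [inTangentCoordinates, ContinuousLinearMap.inCoordinates, differential]
  rfl

theorem differential_const_mul (I : ModelWithCorners ℝ E H) {f : M → ℝ} {z : M}
    (hf : ContMDiffAt I 𝓘(ℝ, ℝ) 1 f z) (r : ℝ) :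
    differential I (fun z => r * f z) z = r • differential I f z := by
  have := (hf.mdifferentiableAt one_ne_zero).hasMFDerivAt.const_smul r
  exact this.mfderiv

end

/-! ### Radial lines -/

section

variable {m : ℕ} {x : Fin 4 → ℝ} {i : Fin 4} {T T' : ℝ}

/-- The coordinate along the lines through the vertex `i`, which is at infinity. -/
def radius (m : ℕ) (i : Fin 4) (x : Fin 4 → ℝ) : ℝ := x i / (m - x i)

/-- The point with the coordinate `T` on the line through `x` and the vertex `i`. -/
def radial (m : ℕ) (i : Fin 4) (x : Fin 4 → ℝ) (T : ℝ) : Fin 4 → ℝ :=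
  fun j => if j = i then m * T / (1 + T) else x j / (m - x i) * (m / (1 + T))

theorem radial_self (h : x i < m) (hm : 0 < m) : radial m i x (radius m i x) = x := by
  have h1 : (m : ℝ) - x i ≠ 0 := by linarith
  have hm' : (m : ℝ) ≠ 0 := by exact_mod_cast hm.ne'
  have h2 : 1 + radius m i x = m / (m - x i) := by rw [radius]; field_simp; ring
  ext j
  rw [radial]
  split_ifs with hj
  · rw [h2, radius, hj]; field_simp
  · rw [h2]; field_simp

theorem radial_apply : radial m i x T i = m * T / (1 + T) := if_pos rfl

theorem sub_radial_apply (hT : 0 ≤ T) : m - radial m i x T i = m / (1 + T) := by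
  rw [radial_apply]
  field_simp
  ring

theorem radius_radial (hm : 0 < m) (hT : 0 ≤ T) : radius m i (radial m i x T) = T := by
  have hm' : (m : ℝ) ≠ 0 := by exact_mod_cast hm.ne'
  rw [radius, sub_radial_apply hT, radial_apply]
  field_simp

theorem radial_radial (hm : 0 < m) (hT : 0 ≤ T) :
    radial m i (radial m i x T) T' = radial m i x T' := by
  have hm' : (m : ℝ) ≠ 0 := by exact_mod_cast hm.ne'
  ext j
  by_cases hj : j = i
  · simp only [radial, if_pos hj]
  · rw [radial, if_neg hj, sub_radial_apply hT, radial, if_neg hj, radial, if_neg hj]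
    field_simp

theorem radial_comp (ρ : Equiv.Perm (Fin 4)) :
    radial m (ρ i) (x ∘ ρ.symm) T = radial m i x T ∘ ρ.symm := by
  ext j
  simp only [radial, Function.comp_apply, Equiv.symm_apply_apply, Equiv.symm_apply_eq]

theorem radius_comp (ρ : Equiv.Perm (Fin 4)) : radius m (ρ i) (x ∘ ρ.symm) = radius m i x := by
  simp [radius]

theorem radial_lt (hm : 0 < m) (hT : 0 ≤ T) (h : T < T') :
    radial m i x T i < radial m i x T' i := by
  have hm' : (0 : ℝ) < m := by exact_mod_cast hm
  rw [radial_apply, radial_apply, div_lt_div_iff₀ (by linarith) (by linarith)]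
  nlinarith

theorem radial_le (hx : InSimplex m x) (hxi : x i < m) (hT : 0 ≤ T) (h : T ≤ T') {j : Fin 4}
    (hj : j ≠ i) : radial m i x T' j ≤ radial m i x T j := by
  rw [radial, radial, if_neg hj, if_neg hj]
  have h1 := hx.1 j
  have h2 : 0 < m - x i := by linarith
  gcongr

theorem inSimplex_radial (hx : InSimplex m x) (hxi : x i < m) (hT : 0 ≤ T) :
    InSimplex m (radial m i x T) := by
  have h2 : 0 < m - x i := by linarith
  constructor
  · intro j
    rw [radial]
    split_ifs
    · positivity
    · have := hx.1 j
      positivity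
  · rw [sum_eq_add_sum_erase i, radial_apply]
    have h3 : ∀ j ∈ Finset.univ.erase i, radial m i x T j = x j * (m / (1 + T) / (m - x i)) :=
      fun j hj => by
        rw [radial, if_neg (Finset.ne_of_mem_erase hj)]; field_simp
    rw [Finset.sum_congr rfl h3, ← Finset.sum_mul]
    have h4 := sum_eq_add_sum_erase i x
    rw [hx.2] at h4
    have h5 : ∑ j ∈ Finset.univ.erase i, x j = m - x i := by linarith
    rw [h5]
    field_simp
    ring

theorem radius_nonneg (hx : InSimplex m x) (hxi : x i < m) : 0 ≤ radius m i x :=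
  div_nonneg (hx.1 i) (by linarith)

theorem radius_pos (hxi : x i < m) (h : 0 < x i) : 0 < radius m i x := div_pos h (by linarith)

end

/-- Neighborhoods in a subtype. -/
theorem eventually_subtype_iff {S : (Fin 4 → ℝ) → Prop} {x : {x // S x}}
    {P : {x // S x} → Prop} : (∀ᶠ y in 𝓝 x, P y) ↔ ∀ᶠ y in 𝓝 x.1, ∀ hy, P ⟨y, hy⟩ := by
  rw [nhds_subtype_eq_comap, eventually_comap]
  simp only [Subtype.forall]
  constructor
  · intro h; filter_upwards [h] with y hy hy'; exact hy y hy' rfl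
  · intro h; filter_upwards [h] with y hy y' hy' e; subst e; exact hy hy'

namespace IdealTriangulation

variable {τ : IdealTriangulation.{u}} {m : ℕ}

theorem InTet.lt {t : τ.Tet} {x : Fin 4 → ℝ} (hm : 0 < m) (hx : τ.InTet m t x) (i : Fin 4) :
    x i < m := by
  have h1 := sum_eq_add_sum_erase i x
  rw [hx.2.1] at h1
  have h0 : ∀ j ∈ Finset.univ.erase i, 0 ≤ x j := fun j _ => hx.1 j
  have h2 := Finset.sum_nonneg h0
  refine lt_of_le_of_ne (by linarith) fun e => τ.not_mem_vertex t i ?_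
  have h3 := (Finset.sum_eq_zero_iff_of_nonneg h0).mp (by linarith)
  have : Function.support x = {i} := by
    ext j
    by_cases hj : j = i
    · subst hj
      have : (m : ℝ) ≠ 0 := by exact_mod_cast hm.ne'
      simp [e, this]
    · simp [hj, h3 j (by simp [hj])]
  exact this ▸ hx.2.2

theorem InTet.radial {t : τ.Tet} {x : Fin 4 → ℝ} {i : Fin 4} {T : ℝ} (hm : 0 < m)
    (hx : τ.InTet m t x) (hxi : 0 < x i) (hT : 0 < T) : τ.InTet m t (radial m i x T) := by
  have h1 := hx.lt hm i
  have h2 := inSimplex_radial hx.inSimplex h1 hT.le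
  refine ⟨h2.1, h2.2, ?_⟩
  have : Function.support (_root_.radial m i x T) = Function.support x := by
    ext j
    have hm' : (m : ℝ) ≠ 0 := by exact_mod_cast hm.ne'
    have h3 : (m : ℝ) - x i ≠ 0 := by linarith
    have h4 : 1 + T ≠ 0 := by positivity
    simp only [Function.mem_support, _root_.radial]
    split_ifs with hj
    · subst hj
      simp [hm', hT.ne', h4, hxi.ne']
    · simp [hm', h3, h4]
  rw [this]; exact hx.2.2

theorem Path.radial {t t' : τ.Tet} {x : Fin 4 → ℝ} {ρ : Equiv.Perm (Fin 4)} (h : τ.Path t x t' ρ)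
    {i : Fin 4} (hxi : 0 < x i) (T : ℝ) : τ.Path t (radial m i x T) t' ρ := by
  refine h.mono fun n hn => ?_
  rw [_root_.radial, if_neg, hn, zero_div, zero_mul]
  rintro rfl
  exact hxi.ne' hn

/-! ### Local equations of the surfaces of the diagram -/

/-- `f` has the signs of a local equation of the surface of the diagram through the corner `c`. -/
def IsEquation (c : τ.Corner m) (f : τ.Space m → ℝ) : Prop :=
  ∀ c', τ.CornerEqv m c c' → ∀ᶠ y in 𝓝 c'.1.2,
    SignType.sign (f (τ.toSpace m ⟨c'.1.1, y⟩)) = SignType.sign (c'.1.2.1 c'.2 - y.1 c'.2)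

/-- Chains of gluings valid at a nearby point are valid at `x`, and the level of the plane is the
same, so the sign conditions at `x` contain those at nearby points of the plane. -/
theorem IsEquation.eventually {t : τ.Tet} {x : {x // τ.InTet m t x}} {i : Fin 4} (hi : x.1 i ≠ 0)
    {f : τ.Space m → ℝ} (hf : τ.IsEquation (⟨t, x⟩, i) f) :
    ∀ᶠ y in 𝓝 x, y.1 i = x.1 i → τ.IsEquation (⟨t, y⟩, i) f := by
  have key : ∀ (t' : τ.Tet) (ρ : Equiv.Perm (Fin 4)), ∀ᶠ y in 𝓝 x.1, τ.Path t x.1 t' ρ →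
      ∀ᶠ w in 𝓝 (y ∘ ρ.symm), ∀ hw : τ.InTet m t' w,
        SignType.sign (f (τ.toSpace m ⟨t', w, hw⟩)) = SignType.sign (x.1 i - w (ρ i)) := by
    intro t' ρ
    by_cases hρ : τ.Path t x.1 t' ρ
    swap
    · exact Eventually.of_forall fun _ h => absurd h hρ
    have h1 := hf (⟨t', x.1 ∘ ρ.symm, hρ.inTet x.2⟩, ρ i) ((cornerEqv_iff hi).mpr ⟨ρ, hρ, rfl, rfl⟩)
    rw [eventually_subtype_iff] at h1
    have hc : Continuous fun y : Fin 4 → ℝ => y ∘ ρ.symm := by fun_prop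
    filter_upwards [hc.continuousAt.eventually h1.eventually_nhds] with y hy _
    filter_upwards [hy] with w hw hwt
    rw [hw hwt]
    simp
  rw [eventually_subtype_iff]
  filter_upwards [eventually_path (τ := τ) x.1, eventually_all.mpr fun t' =>
    eventually_all.mpr (key t')] with y h1 h2 hy hyi
  rintro ⟨⟨t', x', hx'⟩, i'⟩ hc
  obtain ⟨ρ, hρ, e, e'⟩ := (cornerEqv_iff (by dsimp only; rw [hyi]; exact hi)).mp hc
  dsimp only at hρ e e'
  subst e e'
  rw [eventually_subtype_iff]
  filter_upwards [h2 t' ρ (h1 _ _ _ hρ)] with w hw hwt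
  rw [hw hwt]
  rw [← hyi, Function.comp_apply, Equiv.symm_apply_apply]

theorem IsEquation.eventually_sign_eq {c : τ.Corner m} (hc : c.1.2.1 c.2 ≠ 0)
    {f g : τ.Space m → ℝ} (hf : τ.IsEquation c f) (hg : τ.IsEquation c g) :
    ∀ᶠ z in 𝓝 (τ.toSpace m c.1), SignType.sign (f z) = SignType.sign (g z) := by
  refine eventually_space fun p hp => ?_
  obtain ⟨t, x⟩ := p
  obtain ⟨ρ, hρ, e⟩ := toSpace_eq_iff.mp hp.symm
  have hcc : τ.CornerEqv m c (⟨t, x⟩, ρ c.2) := (cornerEqv_iff hc).mpr ⟨ρ, hρ, e, rfl⟩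
  rw [eventually_point_iff]
  filter_upwards [hf _ hcc, hg _ hcc] with y h1 h2
  exact h1.trans h2.symm

/-- The line through the vertex crosses the plane transversally and keeps the vanishing coordinates
zero, so both signs occur even at boundary points. -/
theorem IsEquation.frequently {c : τ.Corner m} (hm : 0 < m) (hc : 0 < c.1.2.1 c.2)
    {f : τ.Space m → ℝ} (hf : τ.IsEquation c f) :
    (∃ᶠ z in 𝓝 (τ.toSpace m c.1), 0 < f z) ∧ ∃ᶠ z in 𝓝 (τ.toSpace m c.1), f z < 0 := by
  obtain ⟨⟨t, x, hx⟩, i⟩ := c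
  dsimp only at hc
  have h0 := hf _ (.refl _)
  dsimp only at h0
  have hlt := hx.lt hm i
  set T₀ := radius m i x with hT₀
  have hTpos : 0 < T₀ := radius_pos hlt hc
  have hself : _root_.radial m i x T₀ = x := radial_self hlt hm
  have hcont : ContinuousAt (fun T => _root_.radial m i x T) T₀ := by
    refine continuousAt_pi.mpr fun j => ?_
    have h1 : 1 + T₀ ≠ 0 := by positivity
    simp only [_root_.radial]
    split_ifs
    · exact (continuousAt_const.mul continuousAt_id).div (continuousAt_const.add continuousAt_id) h1
    · exact continuousAt_const.mul
        (continuousAt_const.div (continuousAt_const.add continuousAt_id) h1)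
  have key : ∀ P : ℝ → Prop, (∃ᶠ T in 𝓝 T₀, ∀ r, SignType.sign r =
      SignType.sign (x i - _root_.radial m i x T i) → P r) →
      ∃ᶠ z in 𝓝 (τ.toSpace m ⟨t, x, hx⟩), P (f z) := by
    intro P hP H
    have h1 := continuous_toSpace.continuousAt.eventually H
    rw [eventually_point_iff, eventually_subtype_iff] at h1
    rw [eventually_subtype_iff] at h0
    dsimp only at h1 h0
    rw [ContinuousAt, hself] at hcont
    refine hP ?_
    filter_upwards [hcont.eventually h1, hcont.eventually h0, lt_mem_nhds hTpos]
      with T h2 h3 hT h4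
    have hyt := hx.radial hm hc hT
    exact h2 hyt (h4 _ (h3 hyt))
  constructor
  · refine key (fun r => 0 < r) (Eventually.frequently (f := 𝓝[<] T₀) ?_ |>.filter_mono nhdsWithin_le_nhds)
    filter_upwards [Ioo_mem_nhdsLT hTpos] with T hT r hr
    have := radial_lt (x := x) (i := i) hm hT.1.le hT.2
    rw [hself] at this
    exact sign_eq_one_iff.mp (hr.trans (sign_pos (by linarith)))
  · refine key (fun r => r < 0) (Eventually.frequently (f := 𝓝[>] T₀) ?_ |>.filter_mono nhdsWithin_le_nhds)
    filter_upwards [self_mem_nhdsWithin] with T hT r hr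
    have := radial_lt (x := x) (i := i) hm hTpos.le hT
    rw [hself] at this
    exact sign_eq_neg_one_iff.mp (hr.trans (sign_neg (by linarith)))

/-! ### Conormal rays -/

variable {H : Type*} [TopologicalSpace H] {I : ModelWithCorners ℝ (EuclideanSpace ℝ (Fin 3)) H}
  [ChartedSpace H (τ.Space m)]

theorem IsEquation.exists_smul_eq {c : τ.Corner m} (hm : 0 < m) (hc : 0 < c.1.2.1 c.2)
    {f g : τ.Space m → ℝ} (hf : τ.IsEquation c f) (hg : τ.IsEquation c g)
    (hf1 : ContMDiffAt I 𝓘(ℝ, ℝ) 1 f (τ.toSpace m c.1))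
    (hg1 : ContMDiffAt I 𝓘(ℝ, ℝ) 1 g (τ.toSpace m c.1))
    (hf0 : differential I f (τ.toSpace m c.1) ≠ 0) (hg0 : differential I g (τ.toSpace m c.1) ≠ 0) :
    ∃ r : ℝ, 0 < r ∧
      differential I g (τ.toSpace m c.1) = r • differential I f (τ.toSpace m c.1) := by
  obtain ⟨r, hr, h⟩ := exists_pos_mul_differential_eq hf1 hg1 (hf.eventually_sign_eq hc.ne' hg)
    (hf.frequently hm hc).1 (hf.frequently hm hc).2 hf0 hg0
  exact ⟨r, hr, ContinuousLinearMap.ext h⟩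

variable [IsManifold I ∞ (τ.Space m)]

theorem isConormal_iff {c : τ.Corner m} {ξ : τ.CotangentSpace m I} : τ.IsConormal m I c ξ ↔
    IsHalf (c.1.2.1 c.2) ∧ ξ.snd ≠ 0 ∧ ∃ f : τ.Space m → ℝ,
      ContMDiffAt I 𝓘(ℝ, ℝ) ∞ f (τ.toSpace m c.1) ∧
      ξ = ⟨τ.toSpace m c.1, differential I f (τ.toSpace m c.1)⟩ ∧ τ.IsEquation c f := by
  constructor
  · rintro ⟨h1, h2, h3, f, h4, h5, h6⟩
    obtain ⟨z, s⟩ := ξ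
    dsimp only at h2 h3 h4 h5
    subst h2
    refine ⟨h1, h3, f, h4, ?_, h6⟩
    congr 1
    exact ContinuousLinearMap.ext h5
  · rintro ⟨h1, h2, f, h3, rfl, h5⟩
    exact ⟨h1, rfl, h2, f, h3, fun _ => rfl, h5⟩

theorem IsConormal.smul {c : τ.Corner m} {ξ : τ.CotangentSpace m I} (h : τ.IsConormal m I c ξ)
    {r : ℝ} (hr : 0 < r) : τ.IsConormal m I c ⟨ξ.proj, r • ξ.snd⟩ := by
  rw [isConormal_iff] at h ⊢
  obtain ⟨h1, h2, f, h3, rfl, h5⟩ := h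
  refine ⟨h1, smul_ne_zero hr.ne' h2, fun z => r * f z, ?_, ?_, ?_⟩
  · exact (contMDiffAt_const (I := I) (I' := 𝓘(ℝ, ℝ)) (c := r)).smul h3
  · rw [differential_const_mul I (h3.of_le (by simp))]
  · intro c' hc'
    filter_upwards [h5 c' hc'] with y hy
    rw [sign_mul, sign_pos hr, one_mul, hy]

theorem IsConormal.of_cornerEqv {c c' : τ.Corner m} {ξ : τ.CotangentSpace m I}
    (h : τ.IsConormal m I c ξ) (hc : τ.CornerEqv m c c') : τ.IsConormal m I c' ξ := by
  obtain ⟨h1, h2, h3, f, h4, h5, h6⟩ := h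
  obtain ⟨ρ, hρ, e, e'⟩ := (cornerEqv_iff h1.pos.ne').mp hc
  refine ⟨?_, h2.trans (toSpace_eq_iff.mpr ⟨ρ, hρ, e⟩), h3, f, h4, h5,
    fun c'' hc'' => h6 c'' (hc.trans _ _ _ hc'')⟩
  rw [e, e']; simpa

end IdealTriangulation

/-! ### Unit conormal covectors -/

namespace IdealTriangulation

variable {τ : IdealTriangulation.{u}} {m : ℕ} {H : Type*} [TopologicalSpace H]
  {I : ModelWithCorners ℝ (EuclideanSpace ℝ (Fin 3)) H} [ChartedSpace H (τ.Space m)]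

/-- Needed for the partition of unity. The finite union of tetrahedra is Lindelöf, hence so is its
image, which is locally compact through the charts; it is therefore σ-compact. -/
theorem paracompactSpace_space (I : ModelWithCorners ℝ (EuclideanSpace ℝ (Fin 3)) H) :
    ParacompactSpace (τ.Space m) := by
  have : LocallyCompactSpace (τ.Space m) := Manifold.locallyCompact_of_finiteDimensional I
  have := τ.finite
  have h : IsLindelof (univ : Set (τ.Point m)) := isLindelof_univ
  have : LindelofSpace (τ.Space m) := by
    rw [← isLindelof_univ_iff, ← surjective_toSpace.range_eq, ← image_univ]
    exact h.image continuous_toSpace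
  choose K hK hKx using fun z : τ.Space m => exists_compact_mem_nhds z
  obtain ⟨s, hs, hsK⟩ := countable_cover_nhds hKx
  have : SigmaCompactSpace (τ.Space m) := SigmaCompactSpace.of_countable (K '' s) (hs.image K)
    (by rintro _ ⟨z, -, rfl⟩; exact hK z) (by rw [sUnion_image]; exact hsK)
  infer_instance

variable [IsManifold I ∞ (τ.Space m)]

/-- Multiplication of a covector by a number. -/
def scale (r : ℝ) (ξ : τ.CotangentSpace m I) : τ.CotangentSpace m I := ⟨ξ.proj, r • ξ.snd⟩

theorem continuous_scale :
    Continuous fun p : ℝ × τ.CotangentSpace m I => scale p.1 p.2 := continuous_totalSpace_smul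

theorem scale_scale (r s : ℝ) (ξ : τ.CotangentSpace m I) : scale r (scale s ξ) = scale (r * s) ξ := by
  simp [scale, mul_smul]
  rfl

theorem scale_one (ξ : τ.CotangentSpace m I) : scale 1 ξ = ξ := by
  simp [scale]

theorem scale_zero (ξ : τ.CotangentSpace m I) : scale 0 ξ = ⟨ξ.proj, 0⟩ := by
  simp [scale]

variable (τ m I) in
/-- A continuous norm on the covectors, and the choice of a conormal covector of norm one at every
point of the surfaces of the diagram. -/
structure UnitConormals where
  norm : τ.CotangentSpace m I → ℝ
  continuous_norm : Continuous norm
  norm_scale : ∀ r ξ, norm (scale r ξ) = |r| * norm ξ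
  norm_pos : ∀ ξ, ξ.snd ≠ 0 → 0 < norm ξ
  le_nhds : ∀ z (l : Filter (τ.CotangentSpace m I)), Tendsto Bundle.TotalSpace.proj l (𝓝 z) →
    Tendsto norm l (𝓝 0) → l ≤ 𝓝 ⟨z, 0⟩
  covector : τ.Corner m → τ.CotangentSpace m I
  proj_covector : ∀ c, (covector c).proj = τ.toSpace m c.1
  isConormal : ∀ c, IsHalf (c.1.2.1 c.2) → τ.IsConormal m I c (covector c)
  norm_covector : ∀ c, IsHalf (c.1.2.1 c.2) → norm (covector c) = 1

theorem IsSmoothDiagram.nonempty_unitConormals (h : τ.IsSmoothDiagram m I) :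
    Nonempty (τ.UnitConormals m I) := by
  have := paracompactSpace_space (τ := τ) (m := m) I
  obtain ⟨N, hN, h1, h2, h3⟩ := exists_bundle_norm (F := EuclideanSpace ℝ (Fin 3) →L[ℝ] ℝ)
    (E := fun z : τ.Space m => TangentSpace I z →L[ℝ] Bundle.Trivial (τ.Space m) ℝ z)
  have key : ∀ c : τ.Corner m, ∃ ξ : τ.CotangentSpace m I, ξ.proj = τ.toSpace m c.1 ∧
      (IsHalf (c.1.2.1 c.2) → τ.IsConormal m I c ξ ∧ N ξ = 1) := by
    intro c
    by_cases hc : IsHalf (c.1.2.1 c.2)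
    · obtain ⟨ξ, hξ⟩ := h.1 c hc
      have hpos := h2 ξ.proj ξ.snd hξ.2.2.1
      refine ⟨scale (N ξ)⁻¹ ξ, hξ.2.1, fun _ => ⟨hξ.smul (inv_pos.mpr hpos), ?_⟩⟩
      refine (h1 _ _ _).trans ?_
      rw [abs_of_pos (inv_pos.mpr hpos)]
      exact inv_mul_cancel₀ hpos.ne'
    · exact ⟨⟨τ.toSpace m c.1, 0⟩, rfl, fun h => absurd h hc⟩
  choose uc hp hu using key
  exact ⟨⟨N, hN, fun r ξ => h1 _ _ _, fun ξ => h2 _ _, h3, uc, hp, fun c hc => (hu c hc).1,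
    fun c hc => (hu c hc).2⟩⟩

namespace UnitConormals

variable (U : τ.UnitConormals m I)

theorem covector_eq {c : τ.Corner m} (hm : 0 < m) (hc : IsHalf (c.1.2.1 c.2)) {f : τ.Space m → ℝ}
    (hf : ContMDiffAt I 𝓘(ℝ, ℝ) 1 f (τ.toSpace m c.1)) (hfc : τ.IsEquation c f)
    {ξ : τ.CotangentSpace m I} (hξ : ξ = ⟨τ.toSpace m c.1, differential I f (τ.toSpace m c.1)⟩)
    (h0 : U.norm ξ ≠ 0) : U.covector c = scale (U.norm ξ)⁻¹ ξ := by
  obtain ⟨-, h1, g, h2, h3, h4⟩ := isConormal_iff.mp (U.isConormal c hc)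
  have h5 := U.norm_covector c hc
  have hs : ξ.snd ≠ 0 := by
    intro e
    have h6 : scale 0 ξ = ξ := by
      rw [scale_zero, ← e]
    have h7 := U.norm_scale 0 ξ
    rw [h6, abs_zero, zero_mul] at h7
    exact h0 h7
  rw [h3] at h1
  subst hξ
  obtain ⟨r, hr, h6⟩ := hfc.exists_smul_eq hm hc.pos h4 hf (h2.of_le (by simp)) hs h1
  have h7 : U.covector c = scale r ⟨τ.toSpace m c.1, differential I f (τ.toSpace m c.1)⟩ := by
    rw [h3, scale, h6]
  rw [h7, U.norm_scale, abs_of_pos hr] at h5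
  rw [h7, eq_inv_of_mul_eq_one_left h5]

/-- The conormals at a corner form a single ray, so the norm is a coordinate on it. -/
theorem eq_scale {c : τ.Corner m} (hm : 0 < m) {ξ : τ.CotangentSpace m I}
    (h : τ.IsConormal m I c ξ) : ξ = scale (U.norm ξ) (U.covector c) := by
  have hpos := U.norm_pos ξ h.2.2.1
  obtain ⟨hc, -, f, h2, h3, h4⟩ := isConormal_iff.mp h
  rw [U.covector_eq hm hc (h2.of_le (by simp)) h4 h3 hpos.ne', scale_scale,
    mul_inv_cancel₀ hpos.ne', scale_one]

theorem covector_eq_of_cornerEqv {c c' : τ.Corner m} (hm : 0 < m) (hc : IsHalf (c.1.2.1 c.2))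
    (h : τ.CornerEqv m c c') : U.covector c = U.covector c' := by
  have h1 := (U.isConormal c hc).of_cornerEqv h
  have h2 := U.eq_scale hm h1
  rw [U.norm_covector c hc, scale_one] at h2
  exact h2

/-- One local equation at `x` serves all nearby points of the plane, where the chosen covector must
be its normalized differential; this depends continuously on the point. -/
theorem continuousWithinAt_covector (hm : 0 < m) {t : τ.Tet} {x : {x // τ.InTet m t x}} {i : Fin 4}
    (hi : IsHalf (x.1 i)) :
    ContinuousWithinAt (fun y : {x // τ.InTet m t x} => U.covector (⟨t, y⟩, i))
      {y | y.1 i = x.1 i} x := by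
  have : IsManifold I 1 (τ.Space m) := IsManifold.of_le (n := ∞) (by simp)
  obtain ⟨-, h1, f, h2, h3, h4⟩ := isConormal_iff.mp (U.isConormal (⟨t, x⟩, i) hi)
  have h5 := U.norm_covector (⟨t, x⟩, i) hi
  dsimp only at h2 h3
  have hf1 : ContMDiffAt I 𝓘(ℝ, ℝ) 1 f (τ.toSpace m ⟨t, x⟩) := h2.of_le (by simp)
  have hD := continuousAt_differential I hf1
  set D : τ.Space m → τ.CotangentSpace m I := fun z => ⟨z, differential I f z⟩ with hDdef
  have hfn := (contMDiffAt_iff_contMDiffAt_nhds (by simp)).mp hf1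
  have hN : ContinuousAt (fun z => U.norm (D z)) (τ.toSpace m ⟨t, x⟩) :=
    U.continuous_norm.continuousAt.comp hD
  have hN0 : U.norm (D (τ.toSpace m ⟨t, x⟩)) ≠ 0 := by
    rw [h3] at h5
    exact h5.trans_ne one_ne_zero
  have hq : ContinuousAt (fun y : {x // τ.InTet m t x} => τ.toSpace m ⟨t, y⟩) x :=
    (continuous_toSpace.comp continuous_sigmaMk).continuousAt
  have hcont : ContinuousAt (fun y : {x // τ.InTet m t x} =>
      scale (U.norm (D (τ.toSpace m ⟨t, y⟩)))⁻¹ (D (τ.toSpace m ⟨t, y⟩))) x := by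
    have h6 : ContinuousAt (fun z => scale (U.norm (D z))⁻¹ (D z)) (τ.toSpace m ⟨t, x⟩) :=
      continuous_scale.continuousAt.comp ((hN.inv₀ hN0).prodMk hD)
    exact ContinuousAt.comp (f := fun y : {x // τ.InTet m t x} => τ.toSpace m ⟨t, y⟩) h6 hq
  have hev : ∀ᶠ y in 𝓝 x, y.1 i = x.1 i → U.covector (⟨t, y⟩, i) =
      scale (U.norm (D (τ.toSpace m ⟨t, y⟩)))⁻¹ (D (τ.toSpace m ⟨t, y⟩)) := by
    filter_upwards [hq.eventually hfn, hq.eventually (hN.eventually_ne hN0),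
      h4.eventually hi.pos.ne'] with y h6 h7 h8 hy
    exact U.covector_eq hm (by dsimp only; rw [hy]; exact hi) h6 (h8 hy) rfl h7
  refine hcont.continuousWithinAt.congr_of_eventuallyEq ?_ (hev.self_of_nhds rfl)
  exact eventually_nhdsWithin_iff.mpr hev

end UnitConormals

end IdealTriangulation

/-! ### Folding a zig-zag domain -/

section

variable {m k : ℕ} {x : Fin 4 → ℝ} {i : Fin 4} {T T' : ℝ}

theorem continuousOn_radial (m : ℕ) (i : Fin 4) : ContinuousOn
    (fun p : (Fin 4 → ℝ) × ℝ => radial m i p.1 p.2) {p | p.1 i < m ∧ 0 ≤ p.2} := by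
  refine continuousOn_pi.mpr fun j => ?_
  have h1 : ∀ p ∈ {p : (Fin 4 → ℝ) × ℝ | p.1 i < m ∧ 0 ≤ p.2}, 1 + p.2 ≠ 0 := fun p hp => by
    have := hp.2; positivity
  have h2 : ∀ p ∈ {p : (Fin 4 → ℝ) × ℝ | p.1 i < m ∧ 0 ≤ p.2}, (m : ℝ) - p.1 i ≠ 0 :=
    fun p hp => by have := hp.1; linarith
  have hc : ∀ j, Continuous fun p : (Fin 4 → ℝ) × ℝ => p.1 j := fun j => by fun_prop
  have hT : Continuous fun p : (Fin 4 → ℝ) × ℝ => 1 + p.2 := by fun_prop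
  by_cases hj : j = i
  · simp only [radial, if_pos hj]
    exact (continuous_const.mul continuous_snd).continuousOn.div hT.continuousOn h1
  · simp only [radial, if_neg hj]
    exact ((hc j).continuousOn.div (continuous_const.sub (hc i)).continuousOn h2).mul
      (continuousOn_const.div hT.continuousOn h1)

theorem continuous_radial {α : Type*} [TopologicalSpace α] {f : α → Fin 4 → ℝ} {S : α → ℝ}
    (hf : Continuous f) (hS : Continuous S) (h : ∀ a, f a i < m) (h0 : ∀ a, 0 ≤ S a) :
    Continuous fun a => radial m i (f a) (S a) :=
  (continuousOn_radial m i).comp_continuous (hf.prodMk hS) fun a => ⟨h a, h0 a⟩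

theorem continuousOn_radial_right (hxi : x i < m) : ContinuousOn (radial m i x) (Ici 0) :=
  (continuousOn_radial m i).comp (f := fun T => (x, T)) (by fun_prop) fun _ hT => ⟨hxi, hT⟩

theorem InSheet.not_offSheet_radial (hx : InSimplex m x) (hxi : x i < m) (hm : 0 < m) (hT : 0 ≤ T)
    (h : T < T') (hs : InSheet m (radial m i x T) i k) : ¬ OffSheet m (radial m i x T') i k :=
  hs.not_offSheet (radial_lt hm hT h) fun _ hj => radial_le hx hxi hT h.le hj

/-- The coordinate of the point at which the line through the vertex `i` crosses the zig-zag
surface. -/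
def crossing (m : ℕ) (i : Fin 4) (k : ℕ) (x : Fin 4 → ℝ) : ℝ :=
  sInf {T | 0 ≤ T ∧ InSheet m (radial m i x T) i k}

theorem crossing_radial (hm : 0 < m) (hT : 0 ≤ T) :
    crossing m i k (radial m i x T) = crossing m i k x := by
  simp only [crossing, radial_radial hm hT]

theorem inSheet_comp_symm_iff (ρ : Equiv.Perm (Fin 4)) :
    InSheet m (x ∘ ρ.symm) (ρ i) k ↔ InSheet m x i k := by
  constructor
  · intro h
    have := h.comp (ρ := ρ)
    rwa [Function.comp_assoc, Equiv.symm_comp_self, Function.comp_id] at this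
  · intro h
    exact InSheet.comp (ρ := ρ.symm) (by rwa [Equiv.symm_apply_apply])

theorem offSheet_comp_symm_iff (ρ : Equiv.Perm (Fin 4)) :
    OffSheet m (x ∘ ρ.symm) (ρ i) k ↔ OffSheet m x i k := by
  constructor
  · intro h
    have := h.comp (ρ := ρ)
    rwa [Function.comp_assoc, Equiv.symm_comp_self, Function.comp_id] at this
  · intro h
    exact OffSheet.comp (ρ := ρ.symm) (by rwa [Equiv.symm_apply_apply])

theorem inFlat_comp_symm_iff (ρ : Equiv.Perm (Fin 4)) :
    InFlat m (x ∘ ρ.symm) (ρ i) k ↔ InFlat m x i k := by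
  simp only [InFlat, inSheet_comp_symm_iff, offSheet_comp_symm_iff, Function.comp_apply,
    Equiv.symm_apply_apply]

theorem crossing_comp (ρ : Equiv.Perm (Fin 4)) :
    crossing m (ρ i) k (x ∘ ρ.symm) = crossing m i k x := by
  simp only [crossing, radial_comp, inSheet_comp_symm_iff]

theorem crossing_nonneg : 0 ≤ crossing m i k x := Real.sInf_nonneg fun _ h => h.1

theorem exists_inSheet_radial (hx : InSimplex m x) (hxi : x i < m) (hk : k < m) :
    ∃ T, 0 ≤ T ∧ InSheet m (radial m i x T) i k := by
  have hm : 0 < m := by omega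
  have hm' : (1 : ℝ) ≤ m := by exact_mod_cast hm
  -- At this coordinate `x i` is within `1/4` of `m`, so a rounding with `v i ≤ m - 1` would be off
  -- by more than the possible `3/4`.
  refine ⟨8 * m, by positivity, ?_⟩
  have h0 : (0 : ℝ) ≤ 8 * m := by positivity
  refine (inSheet_or_offSheet (inSimplex_radial hx hxi h0) i k).resolve_right ?_
  rintro ⟨v, hv, hvk⟩
  have h1 := (abs_le.mp (hv.abs_le (inSimplex_radial hx hxi h0) i)).2
  have h2 := sub_radial_apply (m := m) (x := x) (i := i) h0
  have h3 : (m : ℝ) / (1 + 8 * m) < 1 / 4 := by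
    rw [div_lt_div_iff₀ (by positivity) (by norm_num)]; linarith
  have h4 : (v i : ℝ) + 1 ≤ m := by exact_mod_cast (by omega : v i + 1 ≤ m)
  linarith

theorem crossing_mem (hx : InSimplex m x) (hxi : x i < m) (hk : k < m) :
    InSheet m (radial m i x (crossing m i k x)) i k := by
  have hcl : IsClosed {T | 0 ≤ T ∧ InSheet m (radial m i x T) i k} :=
    (continuousOn_radial_right hxi).preimage_isClosed_of_isClosed isClosed_Ici
      (isClosed_setOf_inSheet m i k)
  exact (hcl.csInf_mem (exists_inSheet_radial hx hxi hk) ⟨0, fun _ h => h.1⟩).2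

theorem inSheet_radial_iff (hx : InSimplex m x) (hxi : x i < m) (hk : k < m) (hT : 0 ≤ T) :
    InSheet m (radial m i x T) i k ↔ crossing m i k x ≤ T := by
  have hm : 0 < m := by omega
  constructor
  · exact fun h => csInf_le ⟨0, fun _ h => h.1⟩ ⟨hT, h⟩
  · intro h
    rcases h.eq_or_lt with h | h
    · exact h ▸ crossing_mem hx hxi hk
    · exact (inSheet_or_offSheet (inSimplex_radial hx hxi hT) i k).resolve_right
        ((crossing_mem hx hxi hk).not_offSheet_radial hx hxi hm crossing_nonneg h)

theorem crossing_pos (hx : InSimplex m x) (hxi : x i < m) (hk : k < m) :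
    0 < crossing m i k x := by
  have h := (crossing_mem hx hxi hk).pos (inSimplex_radial hx hxi crossing_nonneg)
  refine crossing_nonneg.lt_of_ne fun e => ?_
  rw [← e, radial_apply] at h
  simp at h

/-- With `inSheet_radial_iff`: the line crosses the zig-zag surface once. Strict monotonicity
excludes points beyond the crossing, and closedness adds the crossing itself as a limit from below.
-/
theorem offSheet_radial_iff (hx : InSimplex m x) (hxi : x i < m) (hk : k < m) (hT : 0 ≤ T) :
    OffSheet m (radial m i x T) i k ↔ T ≤ crossing m i k x := by
  have hm : 0 < m := by omega
  constructor
  · intro h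
    by_contra! h'
    exact (crossing_mem hx hxi hk).not_offSheet_radial hx hxi hm crossing_nonneg h' h
  · intro h
    have key : ∀ S, 0 ≤ S → S < crossing m i k x → OffSheet m (radial m i x S) i k :=
      fun S hS h => (inSheet_or_offSheet (inSimplex_radial hx hxi hS) i k).resolve_left
        fun h' => h.not_ge ((inSheet_radial_iff hx hxi hk hS).mp h')
    rcases h.eq_or_lt with h | h
    · have hpos : 0 < T := h ▸ crossing_pos hx hxi hk
      have hc : Tendsto (radial m i x) (𝓝[<] T) (𝓝 (radial m i x T)) :=
        (((continuousOn_radial_right hxi).continuousAt (Ici_mem_nhds hpos)).tendsto).mono_left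
          nhdsWithin_le_nhds
      refine (isClosed_setOf_offSheet m i k).mem_of_tendsto hc ?_
      filter_upwards [Ioo_mem_nhdsLT hpos] with S hS
      exact key S hS.1.le (h ▸ hS.2)
    · exact key T hT h

theorem inSheet_iff (hx : InSimplex m x) (hxi : x i < m) (hk : k < m) :
    InSheet m x i k ↔ crossing m i k x ≤ radius m i x := by
  rw [← inSheet_radial_iff hx hxi hk (radius_nonneg hx hxi), radial_self hxi (by omega)]

theorem offSheet_iff (hx : InSimplex m x) (hxi : x i < m) (hk : k < m) :
    OffSheet m x i k ↔ radius m i x ≤ crossing m i k x := by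
  rw [← offSheet_radial_iff hx hxi hk (radius_nonneg hx hxi), radial_self hxi (by omega)]

/-- The sets where the crossing is at most or at least `S` are described by the two closed
conditions on the point with coordinate `S`. -/
theorem continuous_crossing {α : Type*} [TopologicalSpace α] {f : α → Fin 4 → ℝ}
    (hf : Continuous f) (hx : ∀ a, InSimplex m (f a)) (h : ∀ a, f a i < m) (hk : k < m) :
    Continuous fun a => crossing m i k (f a) := by
  refine OrderTopology.continuous_iff.mpr fun S => ?_
  rcases lt_or_ge S 0 with hS | hS
  · constructor
    · convert isOpen_univ
      exact eq_univ_of_forall fun a => hS.trans_le crossing_nonneg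
    · convert isOpen_empty
      exact eq_empty_of_forall_notMem fun a ha => (hS.trans_le crossing_nonneg).not_gt ha
  · have hc : Continuous fun a => radial m i (f a) S :=
      continuous_radial hf continuous_const h fun _ => hS
    constructor
    · have := ((isClosed_setOf_inSheet m i k).preimage hc).isOpen_compl
      convert this using 1
      ext a
      exact (not_le.symm.trans (inSheet_radial_iff (hx a) (h a) hk hS).symm.not)
    · have := ((isClosed_setOf_offSheet m i k).preimage hc).isOpen_compl
      convert this using 1
      ext a
      exact (not_le.symm.trans (offSheet_radial_iff (hx a) (h a) hk hS).symm.not)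

/-- The coordinate of the points of the plane `xᵢ = k + 1/2` on the lines through the vertex `i`. -/
def planeRadius (m k : ℕ) : ℝ := (k + 1 / 2) / (m - (k + 1 / 2))

theorem planeRadius_pos (hk : k < m) : 0 < planeRadius m k := by
  have : (k : ℝ) + 1 ≤ m := by exact_mod_cast hk
  exact div_pos (by positivity) (by linarith)

theorem radius_eq_planeRadius (h : x i = k + 1 / 2) : radius m i x = planeRadius m k := by
  rw [radius, h, planeRadius]

theorem radial_planeRadius (hk : k < m) : radial m i x (planeRadius m k) i = k + 1 / 2 := by
  have : (k : ℝ) + 1 ≤ m := by exact_mod_cast hk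
  rw [radial_apply, planeRadius]
  generalize hc : (k : ℝ) + 1 / 2 = c
  have hm : (m : ℝ) ≠ 0 := by exact_mod_cast (by omega : m ≠ 0)
  have h1 : (m : ℝ) - c ≠ 0 := by linarith
  have h2 : 1 + c / (m - c) = m / (m - c) := by field_simp; ring
  rw [h2]
  field_simp

theorem apply_le_iff (hxi : x i < m) (hk : k < m) :
    x i ≤ k + 1 / 2 ↔ radius m i x ≤ planeRadius m k := by
  have : (k : ℝ) + 1 ≤ m := by exact_mod_cast hk
  rw [radius, planeRadius, div_le_div_iff₀ (by linarith) (by linarith)]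
  constructor <;> intro h <;> nlinarith

theorem le_apply_iff (hxi : x i < m) (hk : k < m) :
    k + 1 / 2 ≤ x i ↔ planeRadius m k ≤ radius m i x := by
  have : (k : ℝ) + 1 ≤ m := by exact_mod_cast hk
  rw [radius, planeRadius, div_le_div_iff₀ (by linarith) (by linarith)]
  constructor <;> intro h <;> nlinarith

/-! #### The fold on a half-line -/

/-- The half-line starting at `a` is mapped to the segment between `a` and `b`, followed by a
half-line over `b`. -/
def lineFold (a b s : ℝ) : ℝ := a + max (-s) (min (b - a) s)

def lineHeight (a b s : ℝ) : ℝ := max (s - |b - a|) 0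

variable {a b s r : ℝ}

/-- The fold preserves arc length, so `s` is recovered as the length travelled; this is the formula
behind `unfold`. -/
theorem abs_lineFold_add (hs : 0 ≤ s) : |lineFold a b s - a| + lineHeight a b s = s := by
  rw [lineFold, lineHeight, add_sub_cancel_left]
  rcases le_total a b with h | h
  · rw [abs_of_nonneg (sub_nonneg.mpr h)]
    rcases le_total (b - a) s with h' | h'
    · rw [min_eq_left h', max_eq_right (by linarith), max_eq_left (by linarith),
        abs_of_nonneg (by linarith)]; ring
    · rw [min_eq_right h', max_eq_right (by linarith), max_eq_right (by linarith),
        abs_of_nonneg hs]; ring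
  · rw [abs_of_nonpos (sub_nonpos.mpr h), min_eq_left (by linarith)]
    rcases le_total (a - b) s with h' | h'
    · rw [max_eq_right (by linarith), max_eq_left (by linarith), abs_of_nonpos (by linarith)]; ring
    · rw [max_eq_left (by linarith), max_eq_right (by linarith), abs_neg, abs_of_nonneg hs]; ring

theorem lineFold_cases (a b s : ℝ) (hs : 0 ≤ s) : (lineHeight a b s = 0 ∧
    (a ≤ lineFold a b s ∧ lineFold a b s ≤ b ∨ b ≤ lineFold a b s ∧ lineFold a b s ≤ a)) ∨
    (0 < lineHeight a b s ∧ lineFold a b s = b) := by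
  rw [lineFold, lineHeight]
  rcases le_total a b with h | h
  · rw [abs_of_nonneg (sub_nonneg.mpr h)]
    rcases lt_or_ge (b - a) s with h' | h'
    · right
      rw [min_eq_left h'.le, max_eq_left (by linarith), max_eq_right (by linarith)]
      constructor <;> linarith
    · left
      rw [min_eq_right h', max_eq_right (by linarith), max_eq_right (by linarith)]
      exact ⟨rfl, Or.inl ⟨by linarith, by linarith⟩⟩
  · rw [abs_of_nonpos (sub_nonpos.mpr h), min_eq_left (by linarith)]
    rcases lt_or_ge (a - b) s with h' | h'
    · right
      rw [max_eq_left (by linarith), max_eq_right (a := -s) (by linarith)]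
      constructor <;> linarith
    · left
      rw [max_eq_right (by linarith), max_eq_left (by linarith)]
      exact ⟨rfl, Or.inr ⟨by linarith, by linarith⟩⟩

theorem lineFold_eq_of_between {T : ℝ} (h : a ≤ T ∧ T ≤ b ∨ b ≤ T ∧ T ≤ a) :
    lineFold a b |T - a| = T ∧ lineHeight a b |T - a| = 0 := by
  rw [lineFold, lineHeight]
  rcases h with ⟨h, h'⟩ | ⟨h, h'⟩
  · rw [abs_of_nonneg (sub_nonneg.mpr h), abs_of_nonneg (by linarith), min_eq_right (by linarith),
      max_eq_right (by linarith), max_eq_right (by linarith)]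
    exact ⟨by ring, rfl⟩
  · rw [abs_of_nonpos (sub_nonpos.mpr h'), abs_of_nonpos (a := b - a) (by linarith),
      min_eq_left (by linarith), max_eq_left (by linarith), max_eq_right (by linarith)]
    exact ⟨by ring, rfl⟩

theorem lineFold_eq_right (hr : 0 ≤ r) :
    lineFold a b (|b - a| + r) = b ∧ lineHeight a b (|b - a| + r) = r := by
  have h0 := abs_nonneg (b - a)
  rw [lineHeight, add_sub_cancel_left, max_eq_left hr, lineFold]
  refine ⟨?_, rfl⟩
  rw [min_eq_left (by linarith [le_abs_self (b - a)]),
    max_eq_right (by linarith [neg_abs_le (b - a)])]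
  ring

theorem lineHeight_nonneg : 0 ≤ lineHeight a b s := le_max_right _ _

end

section

variable {m k : ℕ} {x : Fin 4 → ℝ} {i : Fin 4} {r : ℝ}

theorem lineFold_pos {a b s : ℝ} (ha : 0 < a) (hb : 0 < b) (hs : 0 ≤ s) : 0 < lineFold a b s := by
  rcases lineFold_cases a b s hs with ⟨-, h | h⟩ | h
  · linarith
  · linarith
  · linarith [h.2]

theorem lineFold_zero (a b : ℝ) : lineFold a b 0 = a ∧ lineHeight a b 0 = 0 := by
  have h0 := abs_nonneg (b - a)
  rw [lineFold, lineHeight, neg_zero, max_eq_left (min_le_right _ _), max_eq_right (by linarith)]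
  exact ⟨add_zero a, rfl⟩

/-- Along the lines through the vertex `i`, the zig-zag domain is folded along the zig-zag surface
and the plane `xᵢ = k + 1/2`: the part between them is flattened, and what is beyond the plane is
put over the plane, at the distance `foldHeight`. -/
def foldPoint (m : ℕ) (i : Fin 4) (k : ℕ) (x : Fin 4 → ℝ) : Fin 4 → ℝ :=
  radial m i x (lineFold (crossing m i k x) (planeRadius m k) (radius m i x - crossing m i k x))

def foldHeight (m : ℕ) (i : Fin 4) (k : ℕ) (x : Fin 4 → ℝ) : ℝ :=
  lineHeight (crossing m i k x) (planeRadius m k) (radius m i x - crossing m i k x)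

/-- The inverse of the folding. -/
def unfold (m : ℕ) (i : Fin 4) (k : ℕ) (x : Fin 4 → ℝ) (r : ℝ) : Fin 4 → ℝ :=
  radial m i x (crossing m i k x + (|radius m i x - crossing m i k x| + r))

/-- The image of the folding. -/
def IsFolded (m : ℕ) (i : Fin 4) (k : ℕ) (x : Fin 4 → ℝ) (r : ℝ) : Prop :=
  0 ≤ r ∧ (r = 0 ∧ InFlat m x i k ∨ x i = k + 1 / 2)

theorem foldPoint_comp (ρ : Equiv.Perm (Fin 4)) :
    foldPoint m (ρ i) k (x ∘ ρ.symm) = foldPoint m i k x ∘ ρ.symm := by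
  simp only [foldPoint, crossing_comp, radius_comp, radial_comp]

theorem foldHeight_comp (ρ : Equiv.Perm (Fin 4)) :
    foldHeight m (ρ i) k (x ∘ ρ.symm) = foldHeight m i k x := by
  simp only [foldHeight, crossing_comp, radius_comp]

theorem unfold_comp (ρ : Equiv.Perm (Fin 4)) :
    unfold m (ρ i) k (x ∘ ρ.symm) r = unfold m i k x r ∘ ρ.symm := by
  simp only [unfold, crossing_comp, radius_comp, radial_comp]

theorem foldHeight_nonneg : 0 ≤ foldHeight m i k x := lineHeight_nonneg

theorem InFlat.pos (hx : InSimplex m x) (h : InFlat m x i k) : 0 < x i := by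
  rcases h with h | h
  · exact h.1.pos hx
  · have : (0 : ℝ) ≤ k := k.cast_nonneg
    linarith [h.2]

theorem IsFolded.pos (hx : InSimplex m x) (h : IsFolded m i k x r) : 0 < x i := by
  rcases h.2 with h | h
  · exact h.2.pos hx
  · rw [h]; positivity

theorem inFlat_iff (hx : InSimplex m x) (hxi : x i < m) (hk : k < m) : InFlat m x i k ↔
    crossing m i k x ≤ radius m i x ∧ radius m i x ≤ planeRadius m k ∨
    planeRadius m k ≤ radius m i x ∧ radius m i x ≤ crossing m i k x := by
  rw [InFlat, inSheet_iff hx hxi hk, offSheet_iff hx hxi hk, apply_le_iff hxi hk,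
    le_apply_iff hxi hk]
  tauto

theorem lineFold_pos_of_inSheet (hx : InSimplex m x) (hxi : x i < m) (hk : k < m)
    (h : InSheet m x i k) :
    0 < lineFold (crossing m i k x) (planeRadius m k) (radius m i x - crossing m i k x) :=
  lineFold_pos (crossing_pos hx hxi hk) (planeRadius_pos hk)
    (sub_nonneg.mpr ((inSheet_iff hx hxi hk).mp h))

theorem radial_lt_self (hm : 0 < m) {T : ℝ} (hT : 0 ≤ T) : radial m i x T i < m := by
  have hm' : (0 : ℝ) < m := by exact_mod_cast hm
  have := sub_radial_apply (m := m) (x := x) (i := i) hT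
  have : 0 < (m : ℝ) / (1 + T) := by positivity
  linarith

theorem isFolded_foldPoint (hx : InSimplex m x) (hxi : x i < m) (hk : k < m)
    (h : InSheet m x i k) : IsFolded m i k (foldPoint m i k x) (foldHeight m i k x) := by
  have hm : 0 < m := by omega
  have h0 := lineFold_pos_of_inSheet hx hxi hk h
  refine ⟨foldHeight_nonneg, ?_⟩
  rcases lineFold_cases (crossing m i k x) (planeRadius m k) _
    (sub_nonneg.mpr ((inSheet_iff hx hxi hk).mp h)) with h1 | h1
  · refine Or.inl ⟨h1.1, ?_⟩
    rw [foldPoint, inFlat_iff (inSimplex_radial hx hxi h0.le) (radial_lt_self hm h0.le) hk,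
      crossing_radial hm h0.le, radius_radial hm h0.le]
    exact h1.2
  · right
    rw [foldPoint, h1.2, radial_planeRadius hk]

theorem unfold_foldPoint (hx : InSimplex m x) (hxi : x i < m) (hk : k < m)
    (h : InSheet m x i k) : unfold m i k (foldPoint m i k x) (foldHeight m i k x) = x := by
  have hm : 0 < m := by omega
  have h0 := lineFold_pos_of_inSheet hx hxi hk h
  rw [unfold, foldPoint, crossing_radial hm h0.le, radius_radial hm h0.le,
    radial_radial hm h0.le, foldHeight,
    abs_lineFold_add (sub_nonneg.mpr ((inSheet_iff hx hxi hk).mp h)), add_sub_cancel,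
    radial_self hxi hm]

theorem unfold_radius_pos (hx : InSimplex m x) (hxi : x i < m) (hk : k < m) (hr : 0 ≤ r) :
    0 < crossing m i k x + (|radius m i x - crossing m i k x| + r) := by
  have := crossing_pos hx hxi hk
  positivity

theorem inSheet_unfold (hx : InSimplex m x) (hxi : x i < m) (hk : k < m) (hr : 0 ≤ r) :
    InSheet m (unfold m i k x r) i k := by
  rw [unfold, inSheet_radial_iff hx hxi hk (unfold_radius_pos hx hxi hk hr).le]
  have := abs_nonneg (radius m i x - crossing m i k x)
  linarith

theorem IsFolded.foldPoint_unfold (hx : InSimplex m x) (hxi : x i < m) (hk : k < m)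
    (h : IsFolded m i k x r) :
    foldPoint m i k (unfold m i k x r) = x ∧ foldHeight m i k (unfold m i k x r) = r := by
  have hm : 0 < m := by omega
  have h0 := (unfold_radius_pos hx hxi hk h.1).le
  rw [foldPoint, foldHeight, unfold, crossing_radial hm h0, radius_radial hm h0,
    radial_radial hm h0, add_sub_cancel_left]
  have key : lineFold (crossing m i k x) (planeRadius m k)
      (|radius m i x - crossing m i k x| + r) = radius m i x ∧ lineHeight (crossing m i k x)
      (planeRadius m k) (|radius m i x - crossing m i k x| + r) = r := by
    rcases h.2 with ⟨rfl, h'⟩ | h'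
    · rw [add_zero]
      exact lineFold_eq_of_between ((inFlat_iff hx hxi hk).mp h')
    · rw [radius_eq_planeRadius h']
      exact lineFold_eq_right h.1
  rw [key.1, key.2, radial_self hxi hm]
  exact ⟨rfl, rfl⟩

/-- The zig-zag surface is the start of the folded half-lines and is not moved, which makes foldings
of different domains agree on the rectangles. -/
theorem foldPoint_eq_self (hx : InSimplex m x) (hxi : x i < m) (hk : k < m)
    (h : InSheet m x i k) (h' : OffSheet m x i k) :
    foldPoint m i k x = x ∧ foldHeight m i k x = 0 := by
  have e : radius m i x = crossing m i k x :=
    le_antisymm ((offSheet_iff hx hxi hk).mp h') ((inSheet_iff hx hxi hk).mp h)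
  rw [foldPoint, foldHeight, ← e, sub_self, (lineFold_zero _ _).1, (lineFold_zero _ _).2,
    radial_self hxi (by omega)]
  exact ⟨rfl, rfl⟩

theorem unfold_eq_self (hx : InSimplex m x) (hxi : x i < m) (hk : k < m)
    (h : InSheet m x i k) (h' : OffSheet m x i k) : unfold m i k x 0 = x := by
  have e : radius m i x = crossing m i k x :=
    le_antisymm ((offSheet_iff hx hxi hk).mp h') ((inSheet_iff hx hxi hk).mp h)
  rw [unfold, ← e, sub_self, abs_zero, add_zero, add_zero, radial_self hxi (by omega)]

theorem isClosed_setOf_isFolded (m : ℕ) (i : Fin 4) (k : ℕ) :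
    IsClosed {p : (Fin 4 → ℝ) × ℝ | IsFolded m i k p.1 p.2} := by
  have h1 : IsClosed {x : Fin 4 → ℝ | InFlat m x i k} :=
    ((isClosed_setOf_inSheet m i k).inter
      (isClosed_le (f := fun x : Fin 4 → ℝ => x i) (by fun_prop) continuous_const)).union
    ((isClosed_setOf_offSheet m i k).inter
      (isClosed_le (g := fun x : Fin 4 → ℝ => x i) continuous_const (by fun_prop)))
  have h2 : IsClosed {p : (Fin 4 → ℝ) × ℝ | p.1 i = k + 1 / 2} :=
    isClosed_eq (by fun_prop) continuous_const
  exact (isClosed_le continuous_const continuous_snd).inter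
    (((isClosed_eq continuous_snd continuous_const).inter (h1.preimage continuous_fst)).union h2)

variable {α : Type*} [TopologicalSpace α] {f : α → Fin 4 → ℝ}

theorem continuous_radius (hf : Continuous f) (h : ∀ a, f a i < m) :
    Continuous fun a => radius m i (f a) := by
  have hc : Continuous fun a => f a i := (continuous_apply i).comp hf
  exact hc.div (continuous_const.sub hc) fun a => (sub_pos.mpr (h a)).ne'

theorem continuous_foldPoint (hf : Continuous f) (hx : ∀ a, InSimplex m (f a))
    (h : ∀ a, f a i < m) (hk : k < m) (hs : ∀ a, InSheet m (f a) i k) :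
    Continuous fun a => foldPoint m i k (f a) := by
  have h1 := continuous_crossing hf hx h hk
  have h2 := continuous_radius hf h
  refine continuous_radial hf ?_ h fun a => (lineFold_pos_of_inSheet (hx a) (h a) hk (hs a)).le
  exact h1.add ((h2.sub h1).neg.max ((continuous_const.sub h1).min (h2.sub h1)))

theorem continuous_foldHeight (hf : Continuous f) (hx : ∀ a, InSimplex m (f a))
    (h : ∀ a, f a i < m) (hk : k < m) : Continuous fun a => foldHeight m i k (f a) := by
  have h1 := continuous_crossing hf hx h hk
  have h2 := continuous_radius hf h
  exact ((h2.sub h1).sub (continuous_const.sub h1).abs).max continuous_const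

theorem continuous_unfold {g : α → ℝ} (hf : Continuous f) (hg : Continuous g)
    (hx : ∀ a, InSimplex m (f a)) (h : ∀ a, f a i < m) (hk : k < m) (h0 : ∀ a, 0 ≤ g a) :
    Continuous fun a => unfold m i k (f a) (g a) := by
  have h1 := continuous_crossing hf hx h hk
  have h2 := continuous_radius hf h
  exact continuous_radial hf (h1.add ((h2.sub h1).abs.add hg)) h fun a =>
    (unfold_radius_pos (hx a) (h a) hk (h0 a)).le

end

/-- A map on a finite disjoint union is proper if it is proper on each of the parts. -/
theorem IsProperMap.sigma {ι Y : Type*} [Finite ι] {X : ι → Type*} [∀ i, TopologicalSpace (X i)]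
    [TopologicalSpace Y] {f : (Σ i, X i) → Y} (hf : ∀ i, IsProperMap fun x => f ⟨i, x⟩) :
    IsProperMap f := by
  have key : ∀ S, S = ⋃ i, Sigma.mk i '' (Sigma.mk i ⁻¹' S : Set (X i)) := fun S => by
    ext ⟨i, x⟩
    refine ⟨fun h => mem_iUnion.mpr ⟨i, x, h, rfl⟩, fun h => ?_⟩
    obtain ⟨_, _, h, e⟩ := mem_iUnion.mp h
    exact e ▸ h
  refine isProperMap_iff_isClosedMap_and_compact_fibers.mpr
    ⟨continuous_sigma fun i => (hf i).continuous, fun S hS => ?_, fun y => ?_⟩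
  · rw [key S, image_iUnion]
    refine isClosed_iUnion_of_finite fun i => ?_
    rw [← image_comp]
    exact (hf i).isClosedMap _ (hS.preimage continuous_sigmaMk)
  · rw [key (f ⁻¹' {y})]
    refine isCompact_iUnion fun i => IsCompact.image ?_ continuous_sigmaMk
    exact (hf i).isCompact_preimage isCompact_singleton

/-! ### The folding on the disjoint union of the zig-zag domains -/

namespace IdealTriangulation

variable {τ : IdealTriangulation.{u}} {m : ℕ}

/-- The folding is a homeomorphism to its image. -/
def foldHomeomorph {k : ℕ} (hk : k < m) (t : τ.Tet) (i : Fin 4) :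
    {x // τ.InTet m t x ∧ x ∈ zigzagDomain m i k} ≃ₜ
      {p : {x // τ.InTet m t x} × ℝ // IsFolded m i k p.1.1 p.2} :=
  have hm : 0 < m := by omega
  have hs : ∀ y : {x // τ.InTet m t x ∧ x ∈ zigzagDomain m i k}, InSheet m y.1 i k :=
    fun y => ((mem_zigzagDomain_iff hm).mp y.2.2).2
  { toFun := fun y => ⟨(⟨foldPoint m i k y.1, y.2.1.radial hm ((hs y).pos y.2.1.inSimplex)
      (lineFold_pos_of_inSheet y.2.1.inSimplex (y.2.1.lt hm i) hk (hs y))⟩, foldHeight m i k y.1),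
        isFolded_foldPoint y.2.1.inSimplex (y.2.1.lt hm i) hk (hs y)⟩
    invFun := fun p =>
      have h := p.1.1.2.radial hm (p.2.pos p.1.1.2.inSimplex)
        (unfold_radius_pos p.1.1.2.inSimplex (p.1.1.2.lt hm i) hk p.2.1)
      ⟨unfold m i k p.1.1.1 p.1.2, h, (mem_zigzagDomain_iff hm).mpr
        ⟨h.inSimplex, inSheet_unfold p.1.1.2.inSimplex (p.1.1.2.lt hm i) hk p.2.1⟩⟩
    left_inv := fun y =>
      Subtype.ext (unfold_foldPoint y.2.1.inSimplex (y.2.1.lt hm i) hk (hs y))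
    right_inv := fun p => by
      have := p.2.foldPoint_unfold p.1.1.2.inSimplex (p.1.1.2.lt hm i) hk
      exact Subtype.ext (Prod.ext (Subtype.ext this.1) this.2)
    continuous_toFun := by
      refine ((Continuous.subtype_mk ?_ _).prodMk ?_).subtype_mk _
      · exact continuous_foldPoint continuous_subtype_val (fun y => y.2.1.inSimplex)
          (fun y => y.2.1.lt hm i) hk hs
      · exact continuous_foldHeight continuous_subtype_val (fun y => y.2.1.inSimplex)
          (fun y => y.2.1.lt hm i) hk
    continuous_invFun := by
      refine Continuous.subtype_mk ?_ _
      exact continuous_unfold (continuous_subtype_val.comp (continuous_fst.comp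
        continuous_subtype_val)) (continuous_snd.comp continuous_subtype_val)
        (fun p => p.1.1.2.inSimplex) (fun p => p.1.1.2.lt hm i) hk fun p => p.2.1 }

/-- The folded point, in the tetrahedra. -/
def fold (y : τ.SheetPoint m) : τ.Point m :=
  ⟨y.1.1, (foldHomeomorph y.1.2.2.2 y.1.1 y.1.2.1 y.2).1.1⟩

def height (y : τ.SheetPoint m) : ℝ := foldHeight m y.1.2.1 y.1.2.2 y.2.1

/-- On each of the finitely many pieces the folding is a closed embedding, and the passage to the
threefold is proper. -/
theorem isProperMap_fold :
    IsProperMap fun y : τ.SheetPoint m => (τ.toSpace m (fold y), height y) := by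
  have := τ.finite
  refine IsProperMap.sigma fun c => ?_
  have h1 : IsClosedEmbedding (Subtype.val : {p : {x // τ.InTet m c.1 x} × ℝ //
      IsFolded m c.2.1 c.2.2 p.1.1 p.2} → _) :=
    ((isClosed_setOf_isFolded m c.2.1 c.2.2).preimage
      (continuous_subtype_val.prodMap continuous_id)).isClosedEmbedding_subtypeVal
  have h2 := h1.comp (foldHomeomorph (τ := τ) c.2.2.2 c.1 c.2.1).isClosedEmbedding
  have h3 : IsProperMap fun x : {x // τ.InTet m c.1 x} => (⟨c.1, x⟩ : τ.Point m) :=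
    (IsClosedEmbedding.sigmaMk (σ := fun t : τ.Tet => {x // τ.InTet m t x}) (i := c.1)).isProperMap
  exact ((isProperMap_toSpace.comp h3).prodMap isProperMap_id).comp h2.isProperMap

end IdealTriangulation

/-! ### The lift of the folded domains to the cotangent bundle -/

namespace IdealTriangulation

variable {τ : IdealTriangulation.{u}} {m : ℕ}

theorem SheetPoint.inSheet (hm : 0 < m) (y : τ.SheetPoint m) : InSheet m y.2.1 y.1.2.1 y.1.2.2 :=
  ((mem_zigzagDomain_iff hm).mp y.2.2.2).2

theorem SheetPoint.pos (hm : 0 < m) (y : τ.SheetPoint m) : 0 < y.2.1 y.1.2.1 :=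
  (y.inSheet hm).pos y.2.2.1.inSimplex

theorem isFolded_fold (y : τ.SheetPoint m) :
    IsFolded m y.1.2.1 y.1.2.2 (fold y).2.1 (height y) :=
  (foldHomeomorph y.1.2.2.2 y.1.1 y.1.2.1 y.2).2

theorem unfold_fold (hm : 0 < m) (y : τ.SheetPoint m) :
    unfold m y.1.2.1 y.1.2.2 (fold y).2.1 (height y) = y.2.1 :=
  unfold_foldPoint y.2.2.1.inSimplex (y.2.2.1.lt hm _) y.1.2.2.2 (y.inSheet hm)

theorem fold_pos (y : τ.SheetPoint m) : 0 < (fold y).2.1 y.1.2.1 :=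
  (isFolded_fold y).pos (fold y).2.2.inSimplex

theorem exists_fold_eq {p : τ.Point m} {r : ℝ} {i : Fin 4} {k : ℕ} (hk : k < m)
    (h : IsFolded m i k p.2.1 r) :
    ∃ y : τ.SheetPoint m, fold y = p ∧ height y = r ∧ y.1.2.1 = i := by
  obtain ⟨t, x⟩ := p
  have e := (foldHomeomorph hk t i).apply_symm_apply ⟨(x, r), h⟩
  refine ⟨⟨⟨t, i, k, hk⟩, (foldHomeomorph hk t i).symm ⟨(x, r), h⟩⟩, ?_, ?_, rfl⟩
  · exact congrArg (fun p => (⟨t, p.1.1⟩ : τ.Point m)) e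
  · exact congrArg (fun p => p.1.2) e

theorem continuous_toSpace_fold : Continuous fun y : τ.SheetPoint m => τ.toSpace m (fold y) :=
  continuous_fst.comp isProperMap_fold.continuous

theorem continuous_height : Continuous (height : τ.SheetPoint m → ℝ) :=
  continuous_snd.comp isProperMap_fold.continuous

theorem height_nonneg (y : τ.SheetPoint m) : 0 ≤ height y := foldHeight_nonneg

theorem isHalf_of_height_pos {y : τ.SheetPoint m} (h : 0 < height y) :
    (fold y).2.1 y.1.2.1 = y.1.2.2 + 1 / 2 :=
  (isFolded_fold y).2.resolve_left fun h' => h.ne' h'.1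

/-- Points of the same copy of a domain are glued if and only if their folded points are. -/
theorem path_fold_iff (hm : 0 < m) {y y' : τ.SheetPoint m} {ρ : Equiv.Perm (Fin 4)}
    (hi : y'.1.2.1 = ρ y.1.2.1) (hk : (y'.1.2.2 : ℕ) = y.1.2.2) :
    (τ.Path (fold y).1 (fold y).2.1 (fold y').1 ρ ∧ (fold y').2.1 = (fold y).2.1 ∘ ρ.symm ∧
      height y' = height y) ↔
    τ.Path y.1.1 y.2.1 y'.1.1 ρ ∧ y'.2.1 = y.2.1 ∘ ρ.symm := by
  constructor
  · rintro ⟨h1, h2, h3⟩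
    have h4 := unfold_fold hm y
    constructor
    · rw [← h4]
      exact h1.radial (fold_pos y) _
    · rw [← h4, ← unfold_fold hm y', h2, h3, hi, hk, unfold_comp]
  · rintro ⟨h1, h2⟩
    refine ⟨h1.radial (y.pos hm) _, ?_, ?_⟩
    · change foldPoint m y'.1.2.1 y'.1.2.2 y'.2.1 = foldPoint m y.1.2.1 y.1.2.2 y.2.1 ∘ ρ.symm
      rw [h2, hi, hk, foldPoint_comp]
    · change foldHeight m y'.1.2.1 y'.1.2.2 y'.2.1 = foldHeight m y.1.2.1 y.1.2.2 y.2.1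
      rw [h2, hi, hk, foldHeight_comp]

theorem fold_eq_of_offSheet (hm : 0 < m) {y : τ.SheetPoint m}
    (h : OffSheet m y.2.1 y.1.2.1 y.1.2.2) : (fold y).2.1 = y.2.1 ∧ height y = 0 :=
  foldPoint_eq_self y.2.2.1.inSimplex (y.2.2.1.lt hm _) y.1.2.2.2 (y.inSheet hm) h

/-- A tied folded point is on the zig-zag surface, where unfolding at height zero does nothing. -/
theorem fold_eq_of_ties (hm : 0 < m) {y : τ.SheetPoint m} (hy : height y = 0)
    (h : Ties m (fold y).2.1 ((fold y).2.1 y.1.2.1 - y.1.2.2)) : (fold y).2.1 = y.2.1 := by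
  have hx := (fold y).2.2.inSimplex
  have h1 := unfold_eq_self hx ((fold y).2.2.lt hm _) y.1.2.2.2 (h.inSheet hx) (h.offSheet hx)
  rw [← unfold_fold hm y, hy, h1]

variable {H : Type*} [TopologicalSpace H] {I : ModelWithCorners ℝ (EuclideanSpace ℝ (Fin 3)) H}
  [ChartedSpace H (τ.Space m)] [IsManifold I ∞ (τ.Space m)]

namespace UnitConormals

variable (U : τ.UnitConormals m I)

/-- The folded zig-zag domains, lifted to the cotangent bundle. -/
def lift (y : τ.SheetPoint m) : τ.CotangentSpace m I :=
  scale (height y) (U.covector (fold y, y.1.2.1))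

theorem proj_lift (y : τ.SheetPoint m) : (U.lift y).proj = τ.toSpace m (fold y) :=
  U.proj_covector _

theorem lift_eq_of_height_eq_zero {y : τ.SheetPoint m} (h : height y = 0) :
    U.lift y = ⟨τ.toSpace m (fold y), 0⟩ := by
  have h1 := U.proj_covector (fold y, y.1.2.1)
  rw [lift, h, scale_zero]
  dsimp only at h1
  rw [h1]

theorem norm_lift (y : τ.SheetPoint m) : U.norm (U.lift y) = height y := by
  rw [lift, U.norm_scale, abs_of_nonneg (height_nonneg y)]
  rcases (height_nonneg y).eq_or_lt with h | h
  · rw [← h, zero_mul]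
  · rw [U.norm_covector _ ⟨_, isHalf_of_height_pos h⟩, mul_one]

theorem isConormal_lift {y : τ.SheetPoint m} (h : 0 < height y) :
    τ.IsConormal m I (fold y, y.1.2.1) (U.lift y) :=
  (U.isConormal _ ⟨_, isHalf_of_height_pos h⟩).smul h

/-- At positive height the folded point stays on its plane, along which the unit covector is
continuous. At height zero the covector may be arbitrary off the plane, but the norm of the lift is
the height, so it tends to the zero section. -/
theorem continuous_lift (hm : 0 < m) : Continuous U.lift := by
  rw [continuous_iff_continuousAt]
  intro y
  rcases (height_nonneg y).eq_or_lt with h | h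
  · rw [ContinuousAt, U.lift_eq_of_height_eq_zero h.symm]
    refine U.le_nhds _ _ (tendsto_map'_iff.mpr ?_) (tendsto_map'_iff.mpr ?_)
    · refine Tendsto.congr (fun y => (U.proj_lift y).symm) continuous_toSpace_fold.continuousAt
    · refine Tendsto.congr (fun y => (U.norm_lift y).symm) ?_
      rw [h]
      exact continuous_height.continuousAt
  · obtain ⟨c, x⟩ := y
    have hc : Continuous fun x => (⟨c, x⟩ : τ.SheetPoint m) :=
      continuous_sigmaMk (σ := fun c : τ.Tet × Fin 4 × Fin m =>
        {x // τ.InTet m c.1 x ∧ x ∈ zigzagDomain m c.2.1 c.2.2}) (i := c)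
    have hh : Continuous fun x => height (⟨c, x⟩ : τ.SheetPoint m) := continuous_height.comp hc
    have hf : Continuous fun x => (foldHomeomorph (τ := τ) c.2.2.2 c.1 c.2.1 x).1.1 :=
      continuous_fst.comp (continuous_subtype_val.comp
        (foldHomeomorph (τ := τ) c.2.2.2 c.1 c.2.1).continuous)
    have h1 : ContinuousAt (fun x => U.covector (fold (⟨c, x⟩ : τ.SheetPoint m), c.2.1)) x := by
      have h2 := U.continuousWithinAt_covector hm (t := c.1) (i := c.2.1)
        (x := (fold (⟨c, x⟩ : τ.SheetPoint m)).2) ⟨_, isHalf_of_height_pos h⟩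
      refine Tendsto.comp (f := fun x => (foldHomeomorph (τ := τ) c.2.2.2 c.1 c.2.1 x).1.1) h2
        (tendsto_nhdsWithin_iff.mpr ⟨hf.continuousAt, ?_⟩)
      filter_upwards [hh.continuousAt.eventually (lt_mem_nhds h)] with x' hx'
      exact (isHalf_of_height_pos hx').trans (isHalf_of_height_pos h).symm
    have h3 : ContinuousAt (fun x => U.lift ⟨c, x⟩) x :=
      continuous_scale.continuousAt.comp (hh.continuousAt.prodMk h1)
    rw [ContinuousAt, Sigma.nhds_mk, tendsto_map'_iff]
    exact h3

/-- Base point and norm together turn the lift into the folding, which is proper; a continuous first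
factor of a proper composite into a Hausdorff space is proper. -/
theorem isProperMap_lift (hm : 0 < m) : IsProperMap U.lift := by
  have : T2Space (τ.CotangentSpace m I) := FiberBundle.t2Space_totalSpace
  have hp : Continuous fun ξ : τ.CotangentSpace m I => (ξ.proj, U.norm ξ) :=
    (FiberBundle.continuous_proj (EuclideanSpace ℝ (Fin 3) →L[ℝ] ℝ)
      fun z : τ.Space m => TangentSpace I z →L[ℝ] Bundle.Trivial (τ.Space m) ℝ z).prodMk
      U.continuous_norm
  refine isProperMap_of_comp_of_t2 (U.continuous_lift hm) hp ?_
  convert isProperMap_fold (τ := τ) (m := m) using 2 with y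
  exact Prod.ext (U.proj_lift y) (U.norm_lift y)

theorem lift_eq_of_toSpectral_eq (hm : 0 < m) {y y' : τ.SheetPoint m}
    (h : τ.toSpectral m y = τ.toSpectral m y') : U.lift y = U.lift y' := by
  obtain ⟨ρ, h1, h2 | h2, h3⟩ := (toSpectral_eq_iff hm).mp h
  · obtain ⟨h4, h5, h6⟩ := (path_fold_iff hm h2.1 h2.2).mpr ⟨h1, h3⟩
    rcases (height_nonneg y).eq_or_lt with h0 | h0
    · rw [U.lift_eq_of_height_eq_zero h0.symm, U.lift_eq_of_height_eq_zero (h6.trans h0.symm),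
        toSpace_eq_iff.mpr ⟨ρ, h4, h5⟩]
    · have hc : τ.CornerEqv m (fold y, y.1.2.1) (fold y', y'.1.2.1) :=
        (cornerEqv_iff (fold_pos y).ne').mpr ⟨ρ, h4, h5, h2.1⟩
      rw [lift, lift, h6, U.covector_eq_of_cornerEqv hm ⟨_, isHalf_of_height_pos h0⟩ hc]
  · have hx := y.2.2.1.inSimplex
    have hx' := y'.2.2.1.inSimplex
    obtain ⟨e1, e2⟩ := fold_eq_of_offSheet hm (h2.2.offSheet hx)
    have ht : Ties m y'.2.1 (y'.2.1 y'.1.2.1 - y'.1.2.2) := by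
      rw [h3, Function.comp_apply, ← h2.1]
      exact h2.2.comp (ρ := ρ.symm)
    obtain ⟨e3, e4⟩ := fold_eq_of_offSheet hm (ht.offSheet hx')
    have hp : τ.toSpace m (fold y) = τ.toSpace m (fold y') :=
      toSpace_eq_iff.mpr ⟨ρ, by rw [e1]; exact h1, by rw [e1, e3]; exact h3⟩
    rw [U.lift_eq_of_height_eq_zero e2, U.lift_eq_of_height_eq_zero e4, hp]

/-- On the zero section two flat parts share only points of rectangles, where the folding is the
identity and the gluing identifies them. Off the zero section, disjointness of the Legendrians
recovers the corner, and the half-integral coordinate recovers `k`. -/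
theorem toSpectral_eq_of_lift_eq (hI : τ.IsSmoothDiagram m I) (hm : 0 < m) {y y' : τ.SheetPoint m}
    (h : U.lift y = U.lift y') : τ.toSpectral m y = τ.toSpectral m y' := by
  have hh : height y' = height y := by rw [← U.norm_lift, ← U.norm_lift, h]
  rw [toSpectral_eq_iff hm]
  rcases (height_nonneg y).eq_or_lt with h0 | h0
  · have hp : τ.toSpace m (fold y) = τ.toSpace m (fold y') := by
      rw [← U.proj_lift, ← U.proj_lift, h]
    obtain ⟨ρ, h1, h2⟩ := toSpace_eq_iff.mp hp
    have flat : ∀ y : τ.SheetPoint m, height y = 0 →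
        InFlat m (fold y).2.1 y.1.2.1 y.1.2.2 := fun y hy => by
      rcases (isFolded_fold y).2 with h | h
      · exact h.2
      · rcases inSheet_or_offSheet (fold y).2.2.inSimplex y.1.2.1 y.1.2.2 with h' | h'
        · exact Or.inl ⟨h', h.le⟩
        · exact Or.inr ⟨h', h.ge⟩
    have h3 := flat y h0.symm
    have h4 := flat y' (hh.trans h0.symm)
    rw [h2] at h4
    have h5 : InFlat m (fold y).2.1 (ρ.symm y'.1.2.1) y'.1.2.2 := by
      rw [← inFlat_comp_symm_iff ρ, Equiv.apply_symm_apply]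
      exact h4
    rcases h3.eq_or_tie (fold y).2.2.inSimplex h5 with ⟨h6, h7⟩ | ⟨h6, h7⟩
    · have hi : y'.1.2.1 = ρ y.1.2.1 := by rw [h6, Equiv.apply_symm_apply]
      obtain ⟨h8, h9⟩ := (path_fold_iff hm hi h7.symm).mp ⟨h1, h2, hh⟩
      exact ⟨ρ, h8, Or.inl ⟨hi, h7.symm⟩, h9⟩
    · have e1 := fold_eq_of_ties hm h0.symm h7
      have e2 : (fold y').2.1 = y'.2.1 := by
        refine fold_eq_of_ties hm (hh.trans h0.symm) ?_
        rw [h2, Function.comp_apply, ← h6]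
        exact h7.comp (ρ := ρ.symm)
      rw [e1] at h1 h2 h6 h7
      rw [e2] at h2
      exact ⟨ρ, h1, Or.inr ⟨h6, h7⟩, h2⟩
  · have h1 := U.isConormal_lift h0
    have h2 := U.isConormal_lift (hh.symm ▸ h0)
    rw [← h] at h2
    obtain ⟨ρ, h3, h4, h5⟩ := (cornerEqv_iff (fold_pos y).ne').mp (hI.2 _ _ _ h1 h2)
    dsimp only at h3 h4 h5
    have hk : (y'.1.2.2 : ℕ) = y.1.2.2 := by
      have h6 := isHalf_of_height_pos h0
      have h7 := isHalf_of_height_pos (hh.symm ▸ h0)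
      rw [h4, h5, Function.comp_apply, Equiv.symm_apply_apply, h6] at h7
      have h8 : (y.1.2.2 : ℝ) = (y'.1.2.2 : ℕ) := by linarith
      exact_mod_cast h8.symm
    obtain ⟨h8, h9⟩ := (path_fold_iff hm h5 hk).mp ⟨h3, h4, hh⟩
    exact ⟨ρ, h8, Or.inl ⟨h5, hk⟩, h9⟩

/-- The zero section part is the union of the flat parts, which is the diagram with the colored
domains; the rest consists of the full positive rays over the planes. -/
theorem range_lift (hm : 2 ≤ m) : range U.lift = τ.lagrangian m I := by
  have hm0 : 0 < m := by omega
  ext ξ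
  constructor
  · rintro ⟨y, rfl⟩
    rcases (isFolded_fold y).2 with ⟨h, h'⟩ | h
    · rw [U.lift_eq_of_height_eq_zero h]
      refine ⟨Or.inl rfl, fun ⟨_, h1, h2⟩ => h2 ((isColored_domain_iff hm h1).mpr ?_)⟩
      exact h'.roundSum_ne (fold y).2.2.inSimplex (notMem_diagram_iff.mp h1)
    · rcases (height_nonneg y).eq_or_lt with h0 | h0
      · rw [U.lift_eq_of_height_eq_zero h0.symm]
        exact ⟨Or.inl rfl, fun h1 => h1.2.1 (mem_diagram_iff.mpr ⟨_, _, h⟩)⟩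
      · have h1 := U.isConormal_lift h0
        exact ⟨Or.inr ⟨_, h1⟩, fun h2 => h1.2.2.1 h2.1⟩
  · rintro ⟨h | ⟨⟨p, i⟩, h⟩, h'⟩
    · obtain ⟨z, s⟩ := ξ
      obtain rfl : s = 0 := h
      obtain ⟨p, rfl⟩ := surjective_toSpace z
      have h1 : (∃ i, IsHalf (p.2.1 i)) ∨ roundSum p.2.1 ≠ m := by
        by_contra! H
        have h2 : τ.toSpace m p ∉ τ.diagram m := notMem_diagram_iff.mpr H.1
        exact h' ⟨rfl, h2, fun h3 => (isColored_domain_iff hm h2).mp h3 H.2⟩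
      obtain ⟨i, k, hk⟩ := exists_inFlat p.2.2.inSimplex h1
      obtain ⟨y, h2, h3, -⟩ := exists_fold_eq (hk.lt p.2.2.inSimplex) (i := i) (r := 0)
        ⟨le_rfl, Or.inl ⟨rfl, hk⟩⟩
      exact ⟨y, by rw [U.lift_eq_of_height_eq_zero h3, h2]⟩
    · obtain ⟨k, hk⟩ := h.1
      dsimp only at hk
      have hkm : k < m := by
        have h1 := p.2.2.lt hm0 i
        rw [hk] at h1
        have h2 : (k : ℝ) < m := by linarith
        exact_mod_cast h2
      obtain ⟨y, h2, h3, h4⟩ := exists_fold_eq hkm (p := p) (i := i) (r := U.norm ξ)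
        ⟨(U.norm_pos _ h.2.2.1).le, Or.inr hk⟩
      exact ⟨y, by rw [lift, h2, h3, h4, ← U.eq_scale hm0 h]⟩

end UnitConormals

theorem nonempty_homeomorph_lagrangian (hm : 2 ≤ m) (hI : τ.IsSmoothDiagram m I) :
    Nonempty (τ.SpectralSpace m ≃ₜ τ.lagrangian m I) := by
  have hm0 : 0 < m := by omega
  obtain ⟨U⟩ := hI.nonempty_unitConormals
  let g : τ.SpectralSpace m → τ.CotangentSpace m I := Quot.lift U.lift fun y y' h =>
    U.lift_eq_of_toSpectral_eq hm0 (Quot.sound h)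
  have hg : ∀ y, g (τ.toSpectral m y) = U.lift y := fun _ => rfl
  have hcont : Continuous g := continuous_quot_lift _ (U.continuous_lift hm0)
  have hinj : Function.Injective g := by
    intro q q' h
    obtain ⟨y, rfl⟩ := surjective_toSpectral q
    obtain ⟨y', rfl⟩ := surjective_toSpectral q'
    exact U.toSpectral_eq_of_lift_eq hI hm0 h
  have hclosed : IsClosedMap g := by
    intro S hS
    have : g '' S = U.lift '' (τ.toSpectral m ⁻¹' S) := by
      rw [← image_preimage_eq S surjective_toSpectral, ← image_comp, preimage_image_preimage]
      rfl
    rw [this]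
    exact (U.isProperMap_lift hm0).isClosedMap _ (hS.preimage continuous_toSpectral)
  have hemb := (IsClosedEmbedding.of_continuous_injective_isClosedMap hcont hinj hclosed).isEmbedding
  have hrange : range g = τ.lagrangian m I := by
    rw [← U.range_lift hm]
    exact surjective_toSpectral.range_comp g |>.symm
  exact ⟨hemb.toHomeomorph.trans (Homeomorph.setCongr hrange)⟩

end IdealTriangulation

end

theorem mainTheorem12 (τ : IdealTriangulation.{u}) (m : ℕ) (hm : 2 ≤ m) :
    -- the spectral space is homeomorphic to the Lagrangian in `T^*M`
    (∀ (H : Type v) [TopologicalSpace H] (I : ModelWithCorners ℝ (EuclideanSpace ℝ (Fin 3)) H)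
      [ChartedSpace H (τ.Space m)] [IsManifold I ∞ (τ.Space m)],
      τ.IsSmoothDiagram m I → Nonempty (τ.SpectralSpace m ≃ₜ τ.lagrangian m I)) ∧
    -- the spectral map is an `m : 1` cover outside of the singular `•`-vertices and `•`-edges
    IsProperMap (τ.spectralMap m) ∧
    Dense (τ.blackEdges m ∪ τ.blackVertices m)ᶜ ∧
    IsCoveringMapOn (τ.spectralMap m) (τ.blackEdges m ∪ τ.blackVertices m)ᶜ ∧
    (∀ z ∉ τ.blackEdges m ∪ τ.blackVertices m, (τ.spectralMap m ⁻¹' {z}).encard = m) ∧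
    -- the ramification degrees
    (∀ z ∈ τ.blackVertices m,
      IsRamifiedOver (τ.spectralMap m) (τ.blackEdges m ∪ τ.blackVertices m) m 3 z) ∧
    (∀ z ∈ τ.blackEdges m \ τ.blackVertices m,
      IsRamifiedOver (τ.spectralMap m) (τ.blackEdges m ∪ τ.blackVertices m) m 2 z) := by
  have hm0 : 0 < m := by omega
  refine ⟨fun H _ I _ _ hI => IdealTriangulation.nonempty_homeomorph_lagrangian hm hI,
    IdealTriangulation.isProperMap_spectralMap hm0,
    IdealTriangulation.dense_compl_blackLocus hm,
    IdealTriangulation.isCoveringMapOn_spectralMap hm0,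
    fun z hz => IdealTriangulation.encard_fiber_of_notMem hm0 hz,
    fun z hz => IdealTriangulation.isRamifiedOver_of_mem_blackVertices hm0 hz,
    fun z hz => IdealTriangulation.isRamifiedOver_of_mem_blackEdges hm0 hz⟩
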